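/- **Setting.** Let $k$ be a commutative ring (all algebras are unital associative $k$-algebras), and let $H$ be a Hopf $k$-algebra with invertible antipode $S$; write $\Delta(h)=h_{(1)}\otimes h_{(2)}$. *Partial modules.* $H_{par}$ is the quotient of the tensor algebra $T(H)$ by the two-sided ideal generated by the relations (the class of $h\in H$ is denoted by $[h]$), for all $h,g\in H$: $[1_H]=1$, $[h][g_{(1)}][S(g_{(2)})]=[hg_{(1)}][S(g_{(2)})]$, $[h_{(1)}][S(h_{(2)})][g]=[h_{(1)}][S(h_{(2)})g]$, $[h][S(g_{(1)})][g_{(2)}]=[hS(g_{(1)})][g_{(2)}]$, $[S(h_{(1)})][h_{(2)}][g]=[S(h_{(1)})][h_{(2)}g]$. A partial $H$-module is a left $H_{par}$-module. Let $A\subseteq H_{par}$ be the subalgebra generated by the elements $\varepsilon_h=[h_{(1)}][S(h_{(2)})]$, $h\in H$, and let $t:A\to H_{par}$ be the restriction to $A$ of the algebra anti-homomorphism $H_{par}\to H_{par}$, $[h^1]\cdots[h^n]\mapsto [S^{-1}(h^n)]\cdots[S^{-1}(h^1)]$. Every left $H_{par}$-module $M$ is an $A$-bimodule by $a\,m=a\cdot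 m$ and $m\,a=t(a)\cdot m$. The category ${}_{H_{par}}\mathcal M$ of left $H_{par}$-modules is monoidal, with tensor product $M\otimes_A N$ with action $[h](m\otimes n)=[h_{(1)}]m\otimes[h_{(2)}]n$, unit object $A$ with action $[h]\cdot a=[h_{(1)}]\,a\,[S(h_{(2)})]$, associativity constraint $(m\otimes n)\otimes p\mapsto m\otimes(n\otimes p)$, and unit constraints $a\otimes m\mapsto a\,m$ and $m\otimes a\mapsto m\,a$. Let $\mathrm{Alg}({}_{H_{par}}\mathcal M)$ be the category of algebra objects (monoids) $(B,\mu:B\otimes_A B\to B,\eta:A\to B)$ in this monoidal category and their morphisms. *Partial actions.* A symmetric partial $H$-module algebra is a $k$-algebra $B$ with a $k$-linear map $H\otimes B\to B$, $h\otimes b\mapsto h\cdot b$, such that for all $h,g\in H$, $a,b\in B$: $1_H\cdot b=b$, $h\cdot(ab)=(h_{(1)}\cdot a)(h_{(2)}\cdot b)$, $h\cdot(g\cdot b)=(h_{(1)}\cdot 1_B)(h_{(2)}g\cdot b)$ and $h\cdot(g\cdot b)=(h_{(1)}g\cdot b)(h_{(2)}\cdot 1_B)$. With the algebra maps $f$ satisfying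 $f(h\cdot b)=h\cdot f(b)$ as morphisms, these form the category $\mathrm{ParAct}_H$. **Theorem.** Symmetric partial $H$-module algebras are exactly the algebra objects in the monoidal category of partial $H$-modules: there is an isomorphism of categories $$\mathrm{ParAct}_H\;\cong\;\mathrm{Alg}({}_{H_{par}}\mathcal M),$$ which sends $B$ to an algebra object with the same underlying $k$-module (up to a natural $k$-linear identification), with $[h]\,b=h\cdot b$, $\mu(x\otimes y)=xy$ and $\eta(1_A)=1_B$, and which is the identity on the underlying maps of morphisms. -/

import Mathlib

open CategoryTheory TensorProduct

universe u

namespace PartialHopf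

noncomputable section

section PartialReps

variable {k : Type u} [CommRing k]

/-- The Sweedler (convolution) product `c ↦ f (c₁) * g (c₂)` of two linear maps from a coalgebra to
an algebra. -/
def conv {C B : Type*} [AddCommGroup C] [Module k C] [Coalgebra k C] [Ring B] [Algebra k B]
    (f g : C →ₗ[k] B) : C →ₗ[k] B :=
  LinearMap.mul' k B ∘ₗ TensorProduct.map f g ∘ₗ Coalgebra.comul

variable {H : Type u} [Ring H] [HopfAlgebra k H]

/-- A partial representation of the Hopf algebra `H` on the algebra `B`. -/
structure IsPartialRep {B : Type*} [Ring B] [Algebra k B] (π : H →ₗ[k] B) : Prop where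
  /-- `π 1 = 1` -/
  pr1 : π 1 = 1
  /-- `π h * π k₁ * π (S k₂) = π (h k₁) * π (S k₂)` -/
  pr2 : ∀ h g : H, π h * conv π (π ∘ₗ HopfAlgebra.antipode k) g =
    conv (π ∘ₗ LinearMap.mulLeft k h) (π ∘ₗ HopfAlgebra.antipode k) g
  /-- `π h₁ * π (S h₂) * π k = π h₁ * π (S h₂ k)` -/
  pr3 : ∀ h g : H, conv π (π ∘ₗ HopfAlgebra.antipode k) h * π g =
    conv π (π ∘ₗ LinearMap.mulRight k g ∘ₗ HopfAlgebra.antipode k) h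
  /-- `π h * π (S k₁) * π k₂ = π (h S k₁) * π k₂` -/
  pr4 : ∀ h g : H, π h * conv (π ∘ₗ HopfAlgebra.antipode k) π g =
    conv (π ∘ₗ LinearMap.mulLeft k h ∘ₗ HopfAlgebra.antipode k) π g
  /-- `π (S h₁) * π h₂ * π k = π (S h₁) * π (h₂ k)` -/
  pr5 : ∀ h g : H, conv (π ∘ₗ HopfAlgebra.antipode k) π h * π g =
    conv (π ∘ₗ HopfAlgebra.antipode k) (π ∘ₗ LinearMap.mulRight k g) h

end PartialReps

section Hpar

variable (k : Type u) [CommRing k] (H : Type u) [Ring H] [HopfAlgebra k H]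

/-- The relations `1_H = 1`, `h ⊗ k₁ ⊗ S k₂ = h k₁ ⊗ S k₂`, `h₁ ⊗ S h₂ ⊗ k = h₁ ⊗ S h₂ k`,
`h ⊗ S k₁ ⊗ k₂ = h S k₁ ⊗ k₂`, `S h₁ ⊗ h₂ ⊗ k = S h₁ ⊗ h₂ k` in the tensor algebra `T(H)`. -/
inductive HparRel : TensorAlgebra k H → TensorAlgebra k H → Prop
  | one : HparRel (TensorAlgebra.ι k 1) 1
  | two (h g : H) : HparRel
      (TensorAlgebra.ι k h *
        conv (TensorAlgebra.ι k) (TensorAlgebra.ι k ∘ₗ HopfAlgebra.antipode k) g)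
      (conv (TensorAlgebra.ι k ∘ₗ LinearMap.mulLeft k h)
        (TensorAlgebra.ι k ∘ₗ HopfAlgebra.antipode k) g)
  | three (h g : H) : HparRel
      (conv (TensorAlgebra.ι k) (TensorAlgebra.ι k ∘ₗ HopfAlgebra.antipode k) h *
        TensorAlgebra.ι k g)
      (conv (TensorAlgebra.ι k)
        (TensorAlgebra.ι k ∘ₗ LinearMap.mulRight k g ∘ₗ HopfAlgebra.antipode k) h)
  | four (h g : H) : HparRel
      (TensorAlgebra.ι k h *
        conv (TensorAlgebra.ι k ∘ₗ HopfAlgebra.antipode k) (TensorAlgebra.ι k) g)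
      (conv (TensorAlgebra.ι k ∘ₗ LinearMap.mulLeft k h ∘ₗ HopfAlgebra.antipode k)
        (TensorAlgebra.ι k) g)
  | five (h g : H) : HparRel
      (conv (TensorAlgebra.ι k ∘ₗ HopfAlgebra.antipode k) (TensorAlgebra.ι k) h *
        TensorAlgebra.ι k g)
      (conv (TensorAlgebra.ι k ∘ₗ HopfAlgebra.antipode k)
        (TensorAlgebra.ι k ∘ₗ LinearMap.mulRight k g) h)

/-- The partial Hopf algebra `H_par`: the quotient of the tensor algebra `T(H)` by the two-sided
ideal generated by the relations `HparRel`. -/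
def Hpar : Type u := RingQuot (HparRel k H)

instance : Ring (Hpar k H) := inferInstanceAs (Ring (RingQuot (HparRel k H)))

instance : Algebra k (Hpar k H) := inferInstanceAs (Algebra k (RingQuot (HparRel k H)))

/-- The quotient map `T(H) → H_par`. -/
def Hpar.mk : TensorAlgebra k H →ₐ[k] Hpar k H := RingQuot.mkAlgHom k (HparRel k H)

/-- The canonical map `H → H_par`, `h ↦ [h]`. -/
def br : H →ₗ[k] Hpar k H := (Hpar.mk k H).toLinearMap ∘ₗ TensorAlgebra.ι k

variable {k H}

theorem algHom_conv {C B B' : Type*} [AddCommGroup C] [Module k C] [Coalgebra k C] [Ring B]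
    [Algebra k B] [Ring B'] [Algebra k B'] (φ : B →ₐ[k] B') (f g : C →ₗ[k] B) (c : C) :
    φ (conv f g c) = conv (φ.toLinearMap ∘ₗ f) (φ.toLinearMap ∘ₗ g) c := by
  simp only [conv, LinearMap.comp_apply]
  generalize (Coalgebra.comul c : C ⊗[k] C) = t
  induction t with
  | zero => simp
  | tmul a b => simp
  | add x y hx hy => simp only [map_add, hx, hy]

theorem isPartialRep_br : IsPartialRep (br k H) where
  pr1 := by
    have := RingQuot.mkAlgHom_rel k (HparRel.one (k := k) (H := H))
    rw [map_one (RingQuot.mkAlgHom k (HparRel k H))] at this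
    exact this
  pr2 h g := by
    have := RingQuot.mkAlgHom_rel k (HparRel.two (k := k) h g)
    rw [map_mul, algHom_conv, algHom_conv] at this
    exact this
  pr3 h g := by
    have := RingQuot.mkAlgHom_rel k (HparRel.three (k := k) h g)
    rw [map_mul, algHom_conv, algHom_conv] at this
    exact this
  pr4 h g := by
    have := RingQuot.mkAlgHom_rel k (HparRel.four (k := k) h g)
    rw [map_mul, algHom_conv, algHom_conv] at this
    exact this
  pr5 h g := by
    have := RingQuot.mkAlgHom_rel k (HparRel.five (k := k) h g)
    rw [map_mul, algHom_conv, algHom_conv] at this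
    exact this

/-- The algebra map `H_par → B` induced by a partial representation of `H` on `B`. -/
def Hpar.lift {B : Type*} [Ring B] [Algebra k B] (π : H →ₗ[k] B) (hπ : IsPartialRep π) :
    Hpar k H →ₐ[k] B :=
  RingQuot.liftAlgHom k ⟨TensorAlgebra.lift k π, by
    have e : (TensorAlgebra.lift k π).toLinearMap ∘ₗ TensorAlgebra.ι k = π := by ext; simp
    intro x y h
    induction h with
    | one => simpa using hπ.pr1
    | two h g =>
      simp only [map_mul, algHom_conv, ← LinearMap.comp_assoc, e, TensorAlgebra.lift_ι_apply]
      exact hπ.pr2 h g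
    | three h g =>
      simp only [map_mul, algHom_conv, ← LinearMap.comp_assoc, e, TensorAlgebra.lift_ι_apply]
      exact hπ.pr3 h g
    | four h g =>
      simp only [map_mul, algHom_conv, ← LinearMap.comp_assoc, e, TensorAlgebra.lift_ι_apply]
      exact hπ.pr4 h g
    | five h g =>
      simp only [map_mul, algHom_conv, ← LinearMap.comp_assoc, e, TensorAlgebra.lift_ι_apply]
      exact hπ.pr5 h g⟩

@[simp]
theorem Hpar.lift_br {B : Type*} [Ring B] [Algebra k B] (π : H →ₗ[k] B) (hπ : IsPartialRep π)
    (h : H) : Hpar.lift π hπ (br k H h) = π h := by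
  simp only [Hpar.lift, br, Hpar.mk, LinearMap.comp_apply]
  erw [RingQuot.liftAlgHom_mkAlgHom_apply]
  simp

theorem Hpar.adjoin_br : Algebra.adjoin k (Set.range (br k H)) = ⊤ := by
  rw [eq_top_iff]
  rintro x -
  obtain ⟨y, rfl⟩ := RingQuot.mkAlgHom_surjective k (HparRel k H) x
  change Hpar.mk k H y ∈ _
  induction y using TensorAlgebra.induction with
  | algebraMap r => rw [AlgHom.commutes]; exact Subalgebra.algebraMap_mem _ r
  | ι h => exact Algebra.subset_adjoin ⟨h, rfl⟩
  | mul a b ha hb => rw [map_mul]; exact mul_mem ha hb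
  | add a b ha hb => rw [map_add]; exact add_mem ha hb

end Hpar

section Convolution

open WithConv

variable {k : Type u} [CommRing k] {H : Type u} [Ring H] [HopfAlgebra k H]
  {C : Type*} [AddCommGroup C] [Module k C] [Coalgebra k C]
  {B : Type*} [Ring B] [Algebra k B]

/-- Convolution algebra version of post-composition with `π`. -/
def push (π : H →ₗ[k] B) (f : WithConv (C →ₗ[k] H)) : WithConv (C →ₗ[k] B) :=
  toConv (π ∘ₗ f.ofConv)

/-- `u` is a coalgebra map. -/
def IsGL (u : WithConv (C →ₗ[k] H)) : Prop := ∃ φ : C →ₗc[k] H, φ.toLinearMap = u.ofConv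

/-- The convolution inverse `S ∘ u` of a coalgebra map `u`. -/
def sig (u : WithConv (C →ₗ[k] H)) : WithConv (C →ₗ[k] H) :=
  toConv (HopfAlgebra.antipode k ∘ₗ u.ofConv)

/-- `(u, u')` is `(φ, S ∘ φ)` or `(S ∘ φ, φ)` for a coalgebra map `φ`. -/
def InvPair (u u' : WithConv (C →ₗ[k] H)) : Prop :=
  (IsGL u ∧ u' = sig u) ∨ (IsGL u' ∧ u = sig u')

theorem conv_comp_coalgHom {D : Type*} [AddCommGroup D] [Module k D] [Coalgebra k D]
    (f g : D →ₗ[k] B) (φ : C →ₗc[k] D) :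
    conv f g ∘ₗ φ.toLinearMap = conv (f ∘ₗ φ.toLinearMap) (g ∘ₗ φ.toLinearMap) :=
  LinearMap.convMul_comp_coalgHom_distrib (toConv f) (toConv g) φ

theorem toConv_conv (f g : C →ₗ[k] B) : toConv (conv f g) = toConv f * toConv g := rfl

theorem IsGL.mul_sig {u : WithConv (C →ₗ[k] H)} (hu : IsGL u) : u * sig u = 1 := by
  obtain ⟨φ, hφ⟩ := hu
  have := conv_comp_coalgHom (LinearMap.id) (HopfAlgebra.antipode k (A := H)) φ
  have h2 : conv (LinearMap.id) (HopfAlgebra.antipode k (A := H)) =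
    (1 : WithConv (H →ₗ[k] H)).ofConv := congrArg ofConv (LinearMap.id_mul_antipode (R := k) (C := H))
  rw [h2] at this
  apply WithConv.ext
  change conv u.ofConv (HopfAlgebra.antipode k ∘ₗ u.ofConv) = _
  rw [← hφ]
  refine this.symm.trans ?_
  ext c
  simp [LinearMap.convOne_def]

theorem IsGL.sig_mul {u : WithConv (C →ₗ[k] H)} (hu : IsGL u) : sig u * u = 1 := by
  obtain ⟨φ, hφ⟩ := hu
  have := conv_comp_coalgHom (HopfAlgebra.antipode k (A := H)) (LinearMap.id) φ
  have h2 : conv (HopfAlgebra.antipode k (A := H)) (LinearMap.id) =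
    (1 : WithConv (H →ₗ[k] H)).ofConv := congrArg ofConv (LinearMap.antipode_mul_id (R := k) (C := H))
  rw [h2] at this
  apply WithConv.ext
  change conv (HopfAlgebra.antipode k ∘ₗ u.ofConv) u.ofConv = _
  rw [← hφ]
  refine this.symm.trans ?_
  ext c
  simp [LinearMap.convOne_def]

theorem InvPair.symm {u u' : WithConv (C →ₗ[k] H)} (h : InvPair u u') : InvPair u' u :=
  h.elim (fun h => Or.inr h) (fun h => Or.inl h)

theorem InvPair.mul {u u' : WithConv (C →ₗ[k] H)} (h : InvPair u u') : u * u' = 1 := by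
  rcases h with ⟨h, rfl⟩ | ⟨h, rfl⟩
  · exact h.mul_sig
  · exact h.sig_mul

theorem InvPair.of_isGL {u u' : WithConv (C →ₗ[k] H)} (h : IsGL u) (h' : u' * u = 1) :
    InvPair u u' :=
  Or.inl ⟨h, left_inv_eq_right_inv h' h.mul_sig⟩

theorem push_one {π : H →ₗ[k] B} (hπ : IsPartialRep π) :
    push π (1 : WithConv (C →ₗ[k] H)) = 1 := by
  apply WithConv.ext
  ext c
  simp [push, LinearMap.convOne_def, Algebra.algebraMap_eq_smul_one, hπ.pr1]

theorem push_prA_aux (π : H →ₗ[k] B) (a b : H →ₗ[k] H)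
    (h : ∀ x g : H, π x * conv (π ∘ₗ a) (π ∘ₗ b) g =
      conv (π ∘ₗ LinearMap.mulLeft k x ∘ₗ a) (π ∘ₗ b) g)
    (φ : C →ₗc[k] H) (v : WithConv (C →ₗ[k] H)) :
    push π v * (push π (toConv (a ∘ₗ φ.toLinearMap)) * push π (toConv (b ∘ₗ φ.toLinearMap))) =
      push π (v * toConv (a ∘ₗ φ.toLinearMap)) * push π (toConv (b ∘ₗ φ.toLinearMap)) := by
  let G : C ⊗[k] (C ⊗[k] C) →ₗ[k] B := LinearMap.mul' k B ∘ₗ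
    TensorProduct.map (π ∘ₗ LinearMap.mul' k H ∘ₗ TensorProduct.map v.ofConv (a ∘ₗ φ.toLinearMap))
      (π ∘ₗ b ∘ₗ φ.toLinearMap) ∘ₗ (TensorProduct.assoc k C C C).symm.toLinearMap
  have h1 : LinearMap.mul' k B ∘ₗ TensorProduct.map (π ∘ₗ v.ofConv)
      (conv (π ∘ₗ a ∘ₗ φ.toLinearMap) (π ∘ₗ b ∘ₗ φ.toLinearMap)) =
      G ∘ₗ LinearMap.lTensor C Coalgebra.comul := by
    refine TensorProduct.ext' fun x y => ?_
    have e1 := h (v.ofConv x) (φ y)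
    have e2 := LinearMap.congr_fun (conv_comp_coalgHom (π ∘ₗ a) (π ∘ₗ b) φ) y
    have e3 := LinearMap.congr_fun
      (conv_comp_coalgHom (π ∘ₗ LinearMap.mulLeft k (v.ofConv x) ∘ₗ a) (π ∘ₗ b) φ) y
    simp only [LinearMap.comp_assoc] at e2 e3
    simp only [LinearMap.comp_apply, TensorProduct.map_tmul, LinearMap.mul'_apply] at e1 e2 e3 ⊢
    rw [← e2]
    refine e1.trans (e3.trans ?_)
    simp only [conv, LinearMap.comp_apply, LinearMap.lTensor_tmul, G, LinearEquiv.coe_coe]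
    generalize (Coalgebra.comul y : C ⊗[k] C) = t
    induction t with
    | zero => simp
    | tmul a b => simp
    | add x y hx hy => simp only [map_add, TensorProduct.tmul_add, hx, hy]
  apply WithConv.ext
  ext c
  have h2 := LinearMap.congr_fun h1 (Coalgebra.comul c)
  refine h2.trans ?_
  rw [LinearMap.comp_apply, ← Coalgebra.coassoc_apply]
  simp only [G, LinearMap.comp_apply, LinearEquiv.coe_coe, LinearEquiv.symm_apply_apply]
  change _ = LinearMap.mul' k B (TensorProduct.map _ _ (Coalgebra.comul c))
  generalize (Coalgebra.comul c : C ⊗[k] C) = t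
  induction t with
  | zero => simp
  | tmul x y =>
    simp only [LinearMap.rTensor_tmul, TensorProduct.map_tmul, LinearMap.comp_apply]
    rfl
  | add x y hx hy => simp only [map_add, hx, hy]

theorem push_prB_aux (π : H →ₗ[k] B) (a b : H →ₗ[k] H)
    (h : ∀ g x : H, conv (π ∘ₗ a) (π ∘ₗ b) g * π x =
      conv (π ∘ₗ a) (π ∘ₗ LinearMap.mulRight k x ∘ₗ b) g)
    (φ : C →ₗc[k] H) (v : WithConv (C →ₗ[k] H)) :
    push π (toConv (a ∘ₗ φ.toLinearMap)) * push π (toConv (b ∘ₗ φ.toLinearMap)) * push π v =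
      push π (toConv (a ∘ₗ φ.toLinearMap)) * push π (toConv (b ∘ₗ φ.toLinearMap) * v) := by
  let G : (C ⊗[k] C) ⊗[k] C →ₗ[k] B := LinearMap.mul' k B ∘ₗ
    TensorProduct.map (π ∘ₗ a ∘ₗ φ.toLinearMap)
      (π ∘ₗ LinearMap.mul' k H ∘ₗ TensorProduct.map (b ∘ₗ φ.toLinearMap) v.ofConv) ∘ₗ
      (TensorProduct.assoc k C C C).toLinearMap
  have h1 : LinearMap.mul' k B ∘ₗ TensorProduct.map
      (conv (π ∘ₗ a ∘ₗ φ.toLinearMap) (π ∘ₗ b ∘ₗ φ.toLinearMap)) (π ∘ₗ v.ofConv) =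
      G ∘ₗ LinearMap.rTensor C Coalgebra.comul := by
    refine TensorProduct.ext' fun y x => ?_
    have e1 := h (φ y) (v.ofConv x)
    have e2 := LinearMap.congr_fun (conv_comp_coalgHom (π ∘ₗ a) (π ∘ₗ b) φ) y
    have e3 := LinearMap.congr_fun
      (conv_comp_coalgHom (π ∘ₗ a) (π ∘ₗ LinearMap.mulRight k (v.ofConv x) ∘ₗ b) φ) y
    simp only [LinearMap.comp_assoc] at e2 e3
    simp only [LinearMap.comp_apply, TensorProduct.map_tmul, LinearMap.mul'_apply] at e1 e2 e3 ⊢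
    rw [← e2]
    refine e1.trans (e3.trans ?_)
    simp only [conv, LinearMap.comp_apply, LinearMap.rTensor_tmul, G, LinearEquiv.coe_coe]
    generalize (Coalgebra.comul y : C ⊗[k] C) = t
    induction t with
    | zero => simp
    | tmul a b => simp
    | add x y hx hy => simp only [map_add, TensorProduct.add_tmul, hx, hy]
  apply WithConv.ext
  ext c
  have h2 := LinearMap.congr_fun h1 (Coalgebra.comul c)
  refine h2.trans ?_
  simp only [G, LinearMap.comp_apply, LinearEquiv.coe_coe]
  rw [Coalgebra.coassoc_apply]
  change _ = LinearMap.mul' k B (TensorProduct.map _ _ (Coalgebra.comul c))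
  generalize (Coalgebra.comul c : C ⊗[k] C) = t
  induction t with
  | zero => simp
  | tmul x y =>
    simp only [LinearMap.lTensor_tmul, TensorProduct.map_tmul, LinearMap.comp_apply]
    rfl
  | add x y hx hy => simp only [map_add, hx, hy]

variable {π : H →ₗ[k] B} {u u' v v' w w' : WithConv (C →ₗ[k] H)}

theorem IsPartialRep.prA (hπ : IsPartialRep π) (h : InvPair u u')
    (v : WithConv (C →ₗ[k] H)) :
    push π v * (push π u * push π u') = push π (v * u) * push π u' := by
  rcases h with ⟨⟨φ, h⟩, rfl⟩ | ⟨⟨φ, h⟩, rfl⟩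
  · have := push_prA_aux π LinearMap.id (HopfAlgebra.antipode k) hπ.pr2 φ v
    rw [h] at this
    exact this
  · have := push_prA_aux π (HopfAlgebra.antipode k) LinearMap.id hπ.pr4 φ v
    rw [h] at this
    exact this

theorem IsPartialRep.prB (hπ : IsPartialRep π) (h : InvPair u u')
    (v : WithConv (C →ₗ[k] H)) :
    push π u * push π u' * push π v = push π u * push π (u' * v) := by
  rcases h with ⟨⟨φ, h⟩, rfl⟩ | ⟨⟨φ, h⟩, rfl⟩
  · have := push_prB_aux π LinearMap.id (HopfAlgebra.antipode k) hπ.pr3 φ v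
    rw [h] at this
    exact this
  · have := push_prB_aux π (HopfAlgebra.antipode k) LinearMap.id hπ.pr5 φ v
    rw [h] at this
    exact this

theorem IsPartialRep.key (hπ : IsPartialRep π) (h : InvPair u u') :
    push π u * push π u' * push π u = push π u := by
  rw [hπ.prB h, h.symm.mul, push_one hπ, mul_one]

/-- `[v] ε_w = ε_{vw} [v]` -/
theorem IsPartialRep.move (hπ : IsPartialRep π) (hw : InvPair w w')
    (hvw : InvPair (v * w) (w' * v')) :
    push π v * (push π w * push π w') =
      push π (v * w) * push π (w' * v') * push π v := by
  have h1 : v * w * w' = v := by rw [mul_assoc, hw.mul, mul_one]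
  calc push π v * (push π w * push π w') = push π (v * w) * push π w' := hπ.prA hw v
    _ = push π (v * w) * push π (w' * v') * push π (v * w) * push π w' := by rw [hπ.key hvw]
    _ = push π (v * w) * (push π (w' * v') * push π (v * w) * push π w') := by
        simp only [mul_assoc]
    _ = push π (v * w) * (push π (w' * v') * push π (v * w * w')) := by rw [hπ.prB hvw.symm]
    _ = _ := by rw [h1, mul_assoc]

end Convolution

section TwoVariables

open WithConv

variable {k : Type u} [CommRing k] {H : Type u} [Ring H] [HopfAlgebra k H]
  {B : Type*} [Ring B] [Algebra k B]

variable (k H) in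
/-- `h ⊗ g ↦ ε(g) h` -/
def inl : WithConv (H ⊗[k] H →ₗ[k] H) :=
  toConv ((TensorProduct.rid k H).toLinearMap ∘ₗ LinearMap.lTensor H Coalgebra.counit)

variable (k H) in
/-- `h ⊗ g ↦ ε(h) g` -/
def inr : WithConv (H ⊗[k] H →ₗ[k] H) :=
  toConv ((TensorProduct.lid k H).toLinearMap ∘ₗ LinearMap.rTensor H Coalgebra.counit)

@[simp] theorem inl_tmul (h g : H) :
    (inl k H).ofConv (h ⊗ₜ g) = Coalgebra.counit (R := k) g • h := by simp [inl]

@[simp] theorem inr_tmul (h g : H) :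
    (inr k H).ofConv (h ⊗ₜ g) = Coalgebra.counit (R := k) h • g := by simp [inr]

theorem isGL_inl : IsGL (inl k H) :=
  ⟨(Coalgebra.TensorProduct.rid k k H).toCoalgHom.comp
    (Coalgebra.TensorProduct.map (CoalgHom.id k H) (Coalgebra.counitCoalgHom k H)), by
    refine TensorProduct.ext' fun x y => ?_
    simp⟩

theorem isGL_inr : IsGL (inr k H) :=
  ⟨(Coalgebra.TensorProduct.lid k H).toCoalgHom.comp
    (Coalgebra.TensorProduct.map (Coalgebra.counitCoalgHom k H) (CoalgHom.id k H)), by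
    refine TensorProduct.ext' fun x y => ?_
    simp⟩

section Eval

variable (f : H ⊗[k] H →ₗ[k] B) (g : H →ₗ[k] B) (x y : H)

theorem conv_inr_right : conv f (g ∘ₗ (inr k H).ofConv) (x ⊗ₜ y) =
    conv (f ∘ₗ TensorProduct.mk k H H x) g y := by
  have key : ∀ s t : H ⊗[k] H, LinearMap.mul' k B (TensorProduct.map f (g ∘ₗ (inr k H).ofConv)
      (TensorProduct.AlgebraTensorModule.tensorTensorTensorComm k k k k H H H H (s ⊗ₜ t))) =
      LinearMap.mul' k B (TensorProduct.map (f ∘ₗ TensorProduct.mk k H H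
        (TensorProduct.rid k H (LinearMap.lTensor H Coalgebra.counit s))) g t) := by
    intro s t
    induction s with
    | zero => simp
    | add s s' hs hs' =>
      simp only [TensorProduct.add_tmul, map_add, hs, hs', LinearMap.comp_add,
        TensorProduct.map_add_left, LinearMap.add_apply]
    | tmul a b =>
      induction t with
      | zero => simp
      | add s s' hs hs' => simp only [TensorProduct.tmul_add, map_add, hs, hs']
      | tmul c d =>
        simp [← TensorProduct.smul_tmul']
  have := key (Coalgebra.comul x) (Coalgebra.comul y)
  rw [Coalgebra.lTensor_counit_comul] at this
  simpa [conv] using this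

theorem conv_inr_left : conv (g ∘ₗ (inr k H).ofConv) f (x ⊗ₜ y) =
    conv g (f ∘ₗ TensorProduct.mk k H H x) y := by
  have key : ∀ s t : H ⊗[k] H, LinearMap.mul' k B (TensorProduct.map (g ∘ₗ (inr k H).ofConv) f
      (TensorProduct.AlgebraTensorModule.tensorTensorTensorComm k k k k H H H H (s ⊗ₜ t))) =
      LinearMap.mul' k B (TensorProduct.map g (f ∘ₗ TensorProduct.mk k H H
        (TensorProduct.lid k H (LinearMap.rTensor H Coalgebra.counit s))) t) := by
    intro s t
    induction s with
    | zero => simp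
    | add s s' hs hs' =>
      simp only [TensorProduct.add_tmul, map_add, hs, hs', LinearMap.comp_add,
        TensorProduct.map_add_right, LinearMap.add_apply]
    | tmul a b =>
      induction t with
      | zero => simp
      | add s s' hs hs' => simp only [TensorProduct.tmul_add, map_add, hs, hs']
      | tmul c d =>
        simp [← TensorProduct.smul_tmul']
  have := key (Coalgebra.comul x) (Coalgebra.comul y)
  rw [Coalgebra.rTensor_counit_comul] at this
  simpa [conv] using this

theorem conv_inl_right : conv f (g ∘ₗ (inl k H).ofConv) (x ⊗ₜ y) =
    conv (f ∘ₗ (TensorProduct.mk k H H).flip y) g x := by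
  have key : ∀ s t : H ⊗[k] H, LinearMap.mul' k B (TensorProduct.map f (g ∘ₗ (inl k H).ofConv)
      (TensorProduct.AlgebraTensorModule.tensorTensorTensorComm k k k k H H H H (s ⊗ₜ t))) =
      LinearMap.mul' k B (TensorProduct.map (f ∘ₗ (TensorProduct.mk k H H).flip
        (TensorProduct.rid k H (LinearMap.lTensor H Coalgebra.counit t))) g s) := by
    intro s t
    induction t with
    | zero => simp
    | add s s' hs hs' =>
      simp only [TensorProduct.tmul_add, map_add, hs, hs', LinearMap.comp_add,
        TensorProduct.map_add_left, LinearMap.add_apply]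
    | tmul a b =>
      induction s with
      | zero => simp
      | add s s' hs hs' => simp only [TensorProduct.add_tmul, map_add, hs, hs']
      | tmul c d =>
        simp
  have := key (Coalgebra.comul x) (Coalgebra.comul y)
  rw [Coalgebra.lTensor_counit_comul] at this
  simpa [conv] using this

theorem conv_inl_left : conv (g ∘ₗ (inl k H).ofConv) f (x ⊗ₜ y) =
    conv g (f ∘ₗ (TensorProduct.mk k H H).flip y) x := by
  have key : ∀ s t : H ⊗[k] H, LinearMap.mul' k B (TensorProduct.map (g ∘ₗ (inl k H).ofConv) f
      (TensorProduct.AlgebraTensorModule.tensorTensorTensorComm k k k k H H H H (s ⊗ₜ t))) =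
      LinearMap.mul' k B (TensorProduct.map g (f ∘ₗ (TensorProduct.mk k H H).flip
        (TensorProduct.lid k H (LinearMap.rTensor H Coalgebra.counit t))) s) := by
    intro s t
    induction t with
    | zero => simp
    | add s s' hs hs' =>
      simp only [TensorProduct.tmul_add, map_add, hs, hs', LinearMap.comp_add,
        TensorProduct.map_add_right, LinearMap.add_apply]
    | tmul a b =>
      induction s with
      | zero => simp
      | add s s' hs hs' => simp only [TensorProduct.add_tmul, map_add, hs, hs']
      | tmul c d =>
        simp
  have := key (Coalgebra.comul x) (Coalgebra.comul y)
  rw [Coalgebra.rTensor_counit_comul] at this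
  simpa [conv] using this

theorem conv_inl_inr (f : H →ₗ[k] B) :
    conv (f ∘ₗ (inl k H).ofConv) (g ∘ₗ (inr k H).ofConv) (x ⊗ₜ y) = f x * g y := by
  rw [conv_inr_right]
  have : (f ∘ₗ (inl k H).ofConv) ∘ₗ TensorProduct.mk k H H x =
      LinearMap.toSpanSingleton k B (f x) ∘ₗ Coalgebra.counit := by
    ext z; simp
  rw [this]
  have h2 := LinearMap.congr_fun (Coalgebra.rTensor_counit_comp_comul (R := k) (A := H)) y
  have h3 := congrArg (LinearMap.mul' k B ∘ₗ TensorProduct.map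
    (LinearMap.toSpanSingleton k B (f x)) g) h2
  simp only [conv, LinearMap.comp_apply] at h3 ⊢
  rw [← LinearMap.comp_apply (TensorProduct.map _ _), LinearMap.rTensor,
    ← TensorProduct.map_comp] at h3
  simpa using h3

theorem conv_inr_inl (f : H →ₗ[k] B) :
    conv (g ∘ₗ (inr k H).ofConv) (f ∘ₗ (inl k H).ofConv) (x ⊗ₜ y) = g y * f x := by
  rw [conv_inr_left]
  have : (f ∘ₗ (inl k H).ofConv) ∘ₗ TensorProduct.mk k H H x =
      LinearMap.toSpanSingleton k B (f x) ∘ₗ Coalgebra.counit := by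
    ext z; simp
  rw [this]
  have h2 := LinearMap.congr_fun (Coalgebra.lTensor_counit_comp_comul (R := k) (A := H)) y
  have h3 := congrArg (LinearMap.mul' k B ∘ₗ TensorProduct.map
    g (LinearMap.toSpanSingleton k B (f x))) h2
  simp only [conv, LinearMap.comp_apply] at h3 ⊢
  rw [← LinearMap.comp_apply (TensorProduct.map _ _), LinearMap.lTensor,
    ← TensorProduct.map_comp] at h3
  simpa using h3

end Eval

theorem commute_inl_inr (f g : H →ₗ[k] B) (h : ∀ x y, Commute (f x) (g y)) :
    Commute (toConv (f ∘ₗ (inl k H).ofConv)) (toConv (g ∘ₗ (inr k H).ofConv)) := by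
  apply WithConv.ext
  refine TensorProduct.ext' fun x y => ?_
  exact (conv_inl_inr g x y f).trans (((h x y).eq).trans (conv_inr_inl g x y f).symm)

theorem inl_mul_inr : inl k H * inr k H = toConv (LinearMap.mul' k H) := by
  apply WithConv.ext
  refine TensorProduct.ext' fun x y => ?_
  exact conv_inl_inr LinearMap.id x y LinearMap.id

theorem inr_mul_inl_tmul (x y : H) : (inr k H * inl k H).ofConv (x ⊗ₜ y) = y * x :=
  conv_inr_inl LinearMap.id x y LinearMap.id

theorem isGL_inl_mul_inr : IsGL (inl k H * inr k H) :=
  ⟨Bialgebra.mulCoalgHom k H, by rw [inl_mul_inr]; rfl⟩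

theorem isGL_inr_mul_inl : IsGL (inr k H * inl k H) :=
  ⟨(Bialgebra.mulCoalgHom k H).comp
    ((Bialgebra.TensorProduct.comm k H H : H ⊗[k] H →ₐc[k] H ⊗[k] H) : H ⊗[k] H →ₗc[k] H ⊗[k] H), by
    refine TensorProduct.ext' fun x y => ?_
    rw [inr_mul_inl_tmul]
    rfl⟩

theorem pair_inl : InvPair (inl k H) (sig (inl k H)) := Or.inl ⟨isGL_inl, rfl⟩

theorem pair_inr : InvPair (inr k H) (sig (inr k H)) := Or.inl ⟨isGL_inr, rfl⟩

theorem pair_inl_inr : InvPair (inl k H * inr k H) (sig (inr k H) * sig (inl k H)) :=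
  InvPair.of_isGL isGL_inl_mul_inr (by
    rw [mul_assoc, ← mul_assoc (sig (inl k H)), pair_inl.symm.mul, one_mul, pair_inr.symm.mul])

theorem pair_inr_inl : InvPair (inr k H * inl k H) (sig (inl k H) * sig (inr k H)) :=
  InvPair.of_isGL isGL_inr_mul_inl (by
    rw [mul_assoc, ← mul_assoc (sig (inr k H)), pair_inr.symm.mul, one_mul, pair_inl.symm.mul])

end TwoVariables

section Pointwise

open WithConv

variable {k : Type u} [CommRing k] {H : Type u} [Ring H] [HopfAlgebra k H]
  {B : Type*} [Ring B] [Algebra k B]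

/-- `ε_h = π h₁ * π (S h₂)` -/
def eps (π : H →ₗ[k] B) : H →ₗ[k] B := conv π (π ∘ₗ HopfAlgebra.antipode k)

/-- `ẽ_h = π (S h₁) * π h₂` -/
def teps (π : H →ₗ[k] B) : H →ₗ[k] B := conv (π ∘ₗ HopfAlgebra.antipode k) π

theorem push_mul_push_sig {C : Type*} [AddCommGroup C] [Module k C] [Coalgebra k C]
    (π : H →ₗ[k] B) {u : WithConv (C →ₗ[k] H)} (hu : IsGL u) :
    push π u * push π (sig u) = toConv (eps π ∘ₗ u.ofConv) := by
  obtain ⟨φ, hφ⟩ := hu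
  rw [← hφ, eps, conv_comp_coalgHom, hφ]
  rfl

theorem push_sig_mul_push {C : Type*} [AddCommGroup C] [Module k C] [Coalgebra k C]
    (π : H →ₗ[k] B) {u : WithConv (C →ₗ[k] H)} (hu : IsGL u) :
    push π (sig u) * push π u = toConv (teps π ∘ₗ u.ofConv) := by
  obtain ⟨φ, hφ⟩ := hu
  rw [← hφ, teps, conv_comp_coalgHom, hφ]
  rfl

theorem sig_mul_sig : sig (inr k H) * sig (inl k H) = sig (inl k H * inr k H) := by
  have h := pair_inl_inr (k := k) (H := H)
  exact left_inv_eq_right_inv h.symm.mul isGL_inl_mul_inr.mul_sig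

theorem sig_mul_sig' : sig (inl k H) * sig (inr k H) = sig (inr k H * inl k H) := by
  have h := pair_inr_inl (k := k) (H := H)
  exact left_inv_eq_right_inv h.symm.mul isGL_inr_mul_inl.mul_sig

variable {π : H →ₗ[k] B}

theorem IsPartialRep.mul_eps (hπ : IsPartialRep π) (h g : H) :
    π h * eps π g = conv (eps π ∘ₗ LinearMap.mulRight k g) π h := by
  have := hπ.move pair_inr pair_inl_inr
  rw [push_mul_push_sig π isGL_inr, sig_mul_sig, push_mul_push_sig π isGL_inl_mul_inr] at this
  have h2 := LinearMap.congr_fun (congrArg ofConv this) (h ⊗ₜ g)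
  refine (conv_inl_inr (eps π) h g π).symm.trans (h2.trans ?_)
  refine (conv_inl_right _ π h g).trans ?_
  congr 2
  ext x
  rw [inl_mul_inr]
  rfl

theorem IsPartialRep.mul_teps (hπ : IsPartialRep π) (h g : H) :
    π (HopfAlgebra.antipode k h) * teps π g =
      conv (teps π ∘ₗ LinearMap.mulLeft k g) (π ∘ₗ HopfAlgebra.antipode k) h := by
  have := hπ.move pair_inr.symm (v := sig (inl k H)) (v' := inl k H) pair_inr_inl.symm
  rw [push_sig_mul_push π isGL_inr, sig_mul_sig', push_sig_mul_push π isGL_inr_mul_inl] at this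
  have h2 := LinearMap.congr_fun (congrArg ofConv this) (h ⊗ₜ g)
  refine (conv_inl_inr (teps π) h g (π ∘ₗ HopfAlgebra.antipode k)).symm.trans (h2.trans ?_)
  refine (conv_inl_right _ (π ∘ₗ HopfAlgebra.antipode k) h g).trans ?_
  congr 2
  ext x
  exact congrArg (teps π) (inr_mul_inl_tmul x g)

theorem IsPartialRep.commute_eps_teps (hπ : IsPartialRep π) (h g : H) : Commute (eps π h) (teps π g) := by
  have h1 := hπ.move pair_inl pair_inr_inl
  have h2 := hπ.move (w := inr k H * inl k H) (w' := sig (inl k H) * sig (inr k H))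
    (v := sig (inr k H)) (v' := inr k H) pair_inr_inl (by
      rw [← mul_assoc, pair_inr.symm.mul, one_mul, mul_assoc, pair_inr.symm.mul, mul_one]
      exact pair_inl)
  rw [← mul_assoc (sig (inr k H)), pair_inr.symm.mul, one_mul, mul_assoc (sig (inl k H)),
    pair_inr.symm.mul, mul_one] at h2
  have h3 : push π (sig (inr k H)) * push π (inr k H) * (push π (inl k H) *
      push π (sig (inl k H))) = push π (inl k H) * push π (sig (inl k H)) *
      (push π (sig (inr k H)) * push π (inr k H)) := by
    rw [mul_assoc, h1, ← mul_assoc, h2]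
    simp only [mul_assoc]
  rw [push_mul_push_sig π isGL_inl, push_sig_mul_push π isGL_inr] at h3
  have h4 := LinearMap.congr_fun (congrArg ofConv h3) (h ⊗ₜ g)
  exact ((conv_inl_inr (teps π) h g (eps π)).symm.trans h4.symm).trans
    (conv_inr_inl (teps π) h g (eps π))

theorem IsPartialRep.eps_key (hπ : IsPartialRep π) : conv (eps π) π = π := by
  have := hπ.key (C := H) (u := toConv LinearMap.id) (Or.inl ⟨⟨CoalgHom.id k H, rfl⟩, rfl⟩)
  exact congrArg ofConv this

theorem IsPartialRep.teps_key (hπ : IsPartialRep π) :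
    conv (teps π) (π ∘ₗ HopfAlgebra.antipode k) = π ∘ₗ HopfAlgebra.antipode k := by
  have := hπ.key (C := H) (u' := toConv LinearMap.id) (Or.inr ⟨⟨CoalgHom.id k H, rfl⟩, rfl⟩)
  exact congrArg ofConv this

theorem IsPartialRep.comp (hπ : IsPartialRep π) {B' : Type*} [Ring B'] [Algebra k B'] (φ : B →ₐ[k] B') :
    IsPartialRep (φ.toLinearMap ∘ₗ π) where
  pr1 := by simp [hπ.pr1]
  pr2 h g := by simpa [algHom_conv, LinearMap.comp_assoc] using congrArg φ (hπ.pr2 h g)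
  pr3 h g := by simpa [algHom_conv, LinearMap.comp_assoc] using congrArg φ (hπ.pr3 h g)
  pr4 h g := by simpa [algHom_conv, LinearMap.comp_assoc] using congrArg φ (hπ.pr4 h g)
  pr5 h g := by simpa [algHom_conv, LinearMap.comp_assoc] using congrArg φ (hπ.pr5 h g)

end Pointwise

section Antipode

open WithConv

variable {k : Type u} [CommRing k] {H : Type u} [Ring H] [HopfAlgebra k H]
  {B : Type*} [Ring B] [Algebra k B]

theorem toConv_algHom_comp_antipode_mul (φ : H →ₐ[k] B) :
    toConv (φ.toLinearMap ∘ₗ HopfAlgebra.antipode k) * toConv φ.toLinearMap = 1 := by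
  have h1 := LinearMap.algHom_comp_convMul_distrib φ
    (toConv (HopfAlgebra.antipode k (A := H))) (toConv LinearMap.id)
  rw [LinearMap.antipode_mul_id] at h1
  apply WithConv.ext
  refine h1.symm.trans ?_
  ext
  simp [LinearMap.convOne_def]

theorem comul_antipode (h : H) : Coalgebra.comul (R := k) (HopfAlgebra.antipode k h) =
    TensorProduct.comm k H H (TensorProduct.map (HopfAlgebra.antipode k) (HopfAlgebra.antipode k)
      (Coalgebra.comul h)) := by
  let iL : H →ₐ[k] H ⊗[k] H := Algebra.TensorProduct.includeLeft
  let iR : H →ₐ[k] H ⊗[k] H := Algebra.TensorProduct.includeRight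
  have hδ : toConv (Coalgebra.comul (R := k) (A := H)) =
      toConv iL.toLinearMap * toConv iR.toLinearMap := by
    apply WithConv.ext
    ext h
    change Coalgebra.comul h = LinearMap.mul' k _ (TensorProduct.map _ _ (Coalgebra.comul h))
    generalize (Coalgebra.comul h : H ⊗[k] H) = t
    induction t with
    | zero => simp
    | tmul a b => simp [iL, iR]
    | add x y hx hy => rw [map_add, map_add, ← hx, ← hy]
  have h1 : toConv (iR.toLinearMap ∘ₗ HopfAlgebra.antipode k) *
      toConv (iL.toLinearMap ∘ₗ HopfAlgebra.antipode k) *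
      toConv (Coalgebra.comul (R := k) (A := H)) = 1 := by
    rw [hδ, mul_assoc, ← mul_assoc (toConv (iL.toLinearMap ∘ₗ _)),
      toConv_algHom_comp_antipode_mul, one_mul, toConv_algHom_comp_antipode_mul]
  have h2 := left_inv_eq_right_inv h1 LinearMap.comul_right_inv
  refine (LinearMap.congr_fun (congrArg ofConv h2) h).symm.trans ?_
  change LinearMap.mul' k _ (TensorProduct.map _ _ (Coalgebra.comul h)) = _
  generalize (Coalgebra.comul h : H ⊗[k] H) = t
  induction t with
  | zero => simp
  | tmul a b => simp [iL, iR]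
  | add x y hx hy => simp only [map_add, hx, hy]

theorem conv_antipode (f g : H →ₗ[k] B) (h : H) :
    conv f g (HopfAlgebra.antipode k h) = LinearMap.mul' k B (TensorProduct.comm k B B
      (TensorProduct.map (g ∘ₗ HopfAlgebra.antipode k) (f ∘ₗ HopfAlgebra.antipode k)
      (Coalgebra.comul h))) := by
  simp only [conv, LinearMap.comp_apply, comul_antipode]
  generalize (Coalgebra.comul h : H ⊗[k] H) = t
  induction t with
  | zero => simp
  | tmul a b => simp
  | add x y hx hy => simp only [map_add, hx, hy]

theorem conv_antipode_of_commute (f g : H →ₗ[k] B) (hfg : ∀ x y, Commute (f x) (g y)) (h : H) :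
    conv f g (HopfAlgebra.antipode k h) =
      conv (g ∘ₗ HopfAlgebra.antipode k) (f ∘ₗ HopfAlgebra.antipode k) h := by
  rw [conv_antipode, conv, LinearMap.comp_apply, LinearMap.comp_apply]
  generalize (Coalgebra.comul h : H ⊗[k] H) = t
  induction t with
  | zero => simp
  | tmul a b => simpa using (hfg _ _).eq
  | add x y hx hy => simp only [map_add, hx, hy]

variable (k H) in
/-- The antipode of `H` is invertible. -/
class HasInvertibleAntipode : Prop where
  bijective : Function.Bijective (HopfAlgebra.antipode k : H →ₗ[k] H)

variable (k H) in
/-- The inverse `S⁻¹` of the antipode. -/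
def Sinv [HasInvertibleAntipode k H] : H →ₗ[k] H :=
  (LinearEquiv.ofBijective (HopfAlgebra.antipode k : H →ₗ[k] H)
    HasInvertibleAntipode.bijective).symm.toLinearMap

@[simp] theorem Sinv_antipode [HasInvertibleAntipode k H] (h : H) :
    Sinv k H (HopfAlgebra.antipode k h) = h :=
  (LinearEquiv.ofBijective (HopfAlgebra.antipode k : H →ₗ[k] H)
    HasInvertibleAntipode.bijective).symm_apply_apply h

theorem antipode_surjective [HasInvertibleAntipode k H] (h : H) :
    ∃ g : H, HopfAlgebra.antipode k g = h := HasInvertibleAntipode.bijective.2 h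

theorem Sinv_mul [HasInvertibleAntipode k H] (g h : H) :
    Sinv k H (g * h) = Sinv k H h * Sinv k H g := by
  obtain ⟨h, rfl⟩ := antipode_surjective (k := k) h
  obtain ⟨g, rfl⟩ := antipode_surjective (k := k) g
  rw [← HopfAlgebra.antipode_mul_antidistrib]
  simp

theorem conv_op_antipode (f g : H →ₗ[k] B) (h : H) :
    conv ((MulOpposite.opLinearEquiv k).toLinearMap ∘ₗ f)
      ((MulOpposite.opLinearEquiv k).toLinearMap ∘ₗ g) (HopfAlgebra.antipode k h) =
    MulOpposite.op (conv (g ∘ₗ HopfAlgebra.antipode k) (f ∘ₗ HopfAlgebra.antipode k) h) := by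
  rw [conv_antipode, conv, LinearMap.comp_apply, LinearMap.comp_apply]
  generalize (Coalgebra.comul h : H ⊗[k] H) = t
  induction t with
  | zero => simp
  | tmul a b => simp
  | add x y hx hy => simp only [map_add, hx, hy, MulOpposite.op_add]

theorem isPartialRep_op [HasInvertibleAntipode k H] :
    IsPartialRep ((MulOpposite.opLinearEquiv k).toLinearMap ∘ₗ br k H ∘ₗ Sinv k H) := by
  have b := isPartialRep_br (k := k) (H := H)
  constructor
  · have : Sinv k H 1 = 1 := by
      have := Sinv_antipode (k := k) (1 : H)
      rwa [HopfAlgebra.antipode_one] at this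
    simp [this, b.pr1]
  all_goals
    intro h g
    obtain ⟨h, rfl⟩ := antipode_surjective (k := k) h
    obtain ⟨g, rfl⟩ := antipode_surjective (k := k) g
    simp only [LinearMap.comp_apply, Sinv_antipode, MulOpposite.coe_opLinearEquiv,
      LinearEquiv.coe_coe]
    simp only [LinearMap.comp_assoc, conv_op_antipode]
    rw [← MulOpposite.op_mul]
    congr 1
  · convert b.pr5 g h using 3 <;> first | (ext; simp [Sinv_mul]) | (congr 1 <;> (ext; simp))
  · convert b.pr4 g h using 3 <;> first | (ext; simp [Sinv_mul]) | (congr 1 <;> (ext; simp))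
  · convert b.pr3 g h using 3 <;> first | (ext; simp [Sinv_mul]) | (congr 1 <;> (ext; simp))
  · convert b.pr2 g h using 3 <;> first | (ext; simp [Sinv_mul]) | (congr 1 <;> (ext; simp))

end Antipode

section Base

variable (k : Type u) [CommRing k] (H : Type u) [Ring H] [HopfAlgebra k H]

/-- The base algebra `A ⊆ H_par`, generated by the elements `ε_h = [h₁][S h₂]`. -/
def baseAlg : Subalgebra k (Hpar k H) := Algebra.adjoin k (Set.range (eps (br k H)))

variable [HasInvertibleAntipode k H]

/-- The anti-algebra map `H_par → H_par`, `[h¹] ⋯ [hⁿ] ↦ [S⁻¹ hⁿ] ⋯ [S⁻¹ h¹]`. -/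
def opAntipode : Hpar k H →ₐ[k] (Hpar k H)ᵐᵒᵖ := Hpar.lift _ isPartialRep_op

variable {k H}

/-- The target map `t : a ↦ 𝒮'(a)`, where `𝒮' ([h¹] ⋯ [hⁿ]) = [S⁻¹ hⁿ] ⋯ [S⁻¹ h¹]`. It is used on
the base algebra `A` only. -/
def tgt (a : Hpar k H) : Hpar k H := (opAntipode k H a).unop

theorem tgt_br (h : H) : tgt (br k H h) = br k H (Sinv k H h) := by simp [tgt, opAntipode]

theorem tgt_algebraMap (c : k) :
    tgt (algebraMap k (Hpar k H) c) = algebraMap k (Hpar k H) c := by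
  simp [tgt, AlgHom.commutes, MulOpposite.algebraMap_apply]

theorem tgt_one : tgt (1 : Hpar k H) = 1 := by simp [tgt]

theorem tgt_add (a b : Hpar k H) : tgt (a + b) = tgt a + tgt b := by simp [tgt]

theorem tgt_mul (a b : Hpar k H) : tgt (a * b) = tgt b * tgt a := by simp [tgt]

theorem tgt_eps (h : H) :
    tgt (eps (br k H) (HopfAlgebra.antipode k h)) = teps (br k H) h := by
  have e : (opAntipode k H).toLinearMap ∘ₗ br k H =
      (MulOpposite.opLinearEquiv k).toLinearMap ∘ₗ br k H ∘ₗ Sinv k H := by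
    ext h; simp [opAntipode]
  rw [tgt, eps, algHom_conv, ← LinearMap.comp_assoc, e]
  rw [LinearMap.comp_assoc, conv_op_antipode, MulOpposite.unop_op, teps]
  congr 1 <;> congr 1 <;> (ext; simp)

theorem eps_mem (h : H) : eps (br k H) h ∈ baseAlg k H := Algebra.subset_adjoin ⟨h, rfl⟩

theorem commute_eps_tgt_eps (g h : H) :
    Commute (eps (br k H) g) (tgt (eps (br k H) h)) := by
  obtain ⟨h, rfl⟩ := antipode_surjective (k := k) h
  rw [tgt_eps]
  exact isPartialRep_br.commute_eps_teps g h

theorem commute_tgt {a b : Hpar k H} (ha : a ∈ baseAlg k H) (hb : b ∈ baseAlg k H) :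
    Commute a (tgt b) := by
  induction ha using Algebra.adjoin_induction with
  | mem a ha =>
    obtain ⟨g, rfl⟩ := ha
    induction hb using Algebra.adjoin_induction with
    | mem b hb => obtain ⟨h, rfl⟩ := hb; exact commute_eps_tgt_eps g h
    | algebraMap r => rw [tgt_algebraMap]; exact (Algebra.commutes r _).symm
    | add x y _ _ hx hy => rw [tgt_add]; exact hx.add_right hy
    | mul x y _ _ hx hy => rw [tgt_mul]; exact hy.mul_right hx
  | algebraMap r => exact Algebra.commutes r _
  | add x y _ _ hx hy => exact hx.add_left hy
  | mul x y _ _ hx hy => exact hx.mul_left hy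

end Base

section TensorAux

open WithConv

variable {k : Type u} [CommRing k] {H : Type u} [Ring H] [HopfAlgebra k H]
  {V Q : Type*} [AddCommGroup V] [Module k V] [AddCommGroup Q] [Module k Q]
  {C : Type*} [AddCommGroup C] [Module k C] [Coalgebra k C]

/-- Two families of operators on `V` agree after applying `q : V → Q`. -/
def EqMod (q : V →ₗ[k] Q) (X Y : WithConv (C →ₗ[k] Module.End k V)) : Prop :=
  ∀ c, q ∘ₗ X.ofConv c = q ∘ₗ Y.ofConv c

theorem EqMod.mul_right {q : V →ₗ[k] Q} {X Y : WithConv (C →ₗ[k] Module.End k V)}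
    (h : EqMod q X Y) (Z : WithConv (C →ₗ[k] Module.End k V)) : EqMod q (X * Z) (Y * Z) := by
  intro c
  change q ∘ₗ LinearMap.mul' k _ (TensorProduct.map _ _ (Coalgebra.comul c)) =
    q ∘ₗ LinearMap.mul' k _ (TensorProduct.map _ _ (Coalgebra.comul c))
  generalize (Coalgebra.comul c : C ⊗[k] C) = t
  induction t with
  | zero => simp
  | tmul a b =>
    simp only [TensorProduct.map_tmul, LinearMap.mul'_apply, Module.End.mul_eq_comp,
      ← LinearMap.comp_assoc, h a]
  | add x y hx hy => simp only [map_add, LinearMap.comp_add, hx, hy]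

theorem EqMod.mul_left {q : V →ₗ[k] Q} {X Y : WithConv (C →ₗ[k] Module.End k V)}
    (h : EqMod q X Y) (Z : WithConv (C →ₗ[k] Module.End k V)) (Z' : C → Q →ₗ[k] Q)
    (hZ : ∀ c, Z' c ∘ₗ q = q ∘ₗ Z.ofConv c) : EqMod q (Z * X) (Z * Y) := by
  intro c
  change q ∘ₗ LinearMap.mul' k _ (TensorProduct.map _ _ (Coalgebra.comul c)) =
    q ∘ₗ LinearMap.mul' k _ (TensorProduct.map _ _ (Coalgebra.comul c))
  generalize (Coalgebra.comul c : C ⊗[k] C) = t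
  induction t with
  | zero => simp
  | tmul a b =>
    simp only [TensorProduct.map_tmul, LinearMap.mul'_apply, Module.End.mul_eq_comp,
      ← LinearMap.comp_assoc, ← hZ a]
    simp only [LinearMap.comp_assoc, h b]
  | add x y hx hy => simp only [map_add, LinearMap.comp_add, hx, hy]

theorem EqMod.trans {q : V →ₗ[k] Q} {X Y Z : WithConv (C →ₗ[k] Module.End k V)}
    (h : EqMod q X Y) (h' : EqMod q Y Z) : EqMod q X Z := fun c => (h c).trans (h' c)

theorem EqMod.symm {q : V →ₗ[k] Q} {X Y : WithConv (C →ₗ[k] Module.End k V)}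
    (h : EqMod q X Y) : EqMod q Y X := fun c => (h c).symm

theorem EqMod.of_eq {q : V →ₗ[k] Q} {X Y : WithConv (C →ₗ[k] Module.End k V)}
    (h : X = Y) : EqMod q X Y := fun c => by rw [h]

section Eval

variable {B : Type*} [Ring B] [Algebra k B] (π : H →ₗ[k] B) (h g : H)

theorem eval_two_left : (push π (inl k H) * (push π (inr k H) * push π (sig (inr k H)))).ofConv
    (h ⊗ₜ g) = π h * conv π (π ∘ₗ HopfAlgebra.antipode k) g := by
  rw [push_mul_push_sig π isGL_inr]
  exact conv_inl_inr _ h g π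

theorem eval_two_right : (push π (inl k H * inr k H) * push π (sig (inr k H))).ofConv (h ⊗ₜ g) =
    conv (π ∘ₗ LinearMap.mulLeft k h) (π ∘ₗ HopfAlgebra.antipode k) g := by
  rw [inl_mul_inr]
  exact conv_inr_right _ (π ∘ₗ HopfAlgebra.antipode k) h g

theorem eval_three_left : (push π (inl k H) * push π (sig (inl k H)) *
    push π (sig (inr k H))).ofConv (h ⊗ₜ g) =
      conv π (π ∘ₗ HopfAlgebra.antipode k) h * π (HopfAlgebra.antipode k g) := by
  rw [push_mul_push_sig π isGL_inl]
  exact conv_inl_inr (π ∘ₗ HopfAlgebra.antipode k) h g _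

theorem eval_three_right : (push π (inl k H) *
    push π (sig (inl k H) * sig (inr k H))).ofConv (h ⊗ₜ g) =
      conv π (π ∘ₗ LinearMap.mulRight k (HopfAlgebra.antipode k g) ∘ₗ HopfAlgebra.antipode k) h := by
  refine (conv_inl_left _ π h g).trans ?_
  congr 2
  ext x
  exact congrArg π (conv_inl_inr (HopfAlgebra.antipode k) x g (HopfAlgebra.antipode k))

theorem eval_four_left : (push π (sig (inl k H)) * (push π (sig (inr k H)) *
    push π (inr k H))).ofConv (h ⊗ₜ g) =
      π (HopfAlgebra.antipode k h) * conv (π ∘ₗ HopfAlgebra.antipode k) π g := by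
  rw [push_sig_mul_push π isGL_inr]
  exact conv_inl_inr _ h g (π ∘ₗ HopfAlgebra.antipode k)

theorem eval_four_right : (push π (sig (inl k H) * sig (inr k H)) *
    push π (inr k H)).ofConv (h ⊗ₜ g) =
      conv (π ∘ₗ LinearMap.mulLeft k (HopfAlgebra.antipode k h) ∘ₗ HopfAlgebra.antipode k) π g := by
  refine (conv_inr_right _ π h g).trans ?_
  congr 2
  ext x
  exact congrArg π (conv_inl_inr (HopfAlgebra.antipode k) h x (HopfAlgebra.antipode k))

theorem eval_five_left : (push π (sig (inl k H)) * push π (inl k H) *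
    push π (inr k H)).ofConv (h ⊗ₜ g) = conv (π ∘ₗ HopfAlgebra.antipode k) π h * π g := by
  rw [push_sig_mul_push π isGL_inl]
  exact conv_inl_inr π h g _

theorem eval_five_right : (push π (sig (inl k H)) *
    push π (inl k H * inr k H)).ofConv (h ⊗ₜ g) =
      conv (π ∘ₗ HopfAlgebra.antipode k) (π ∘ₗ LinearMap.mulRight k g) h := by
  rw [inl_mul_inr]
  exact conv_inl_left _ (π ∘ₗ HopfAlgebra.antipode k) h g

end Eval

theorem conv_comp_of_intertwine (q : V →ₗ[k] Q) (x x' : C →ₗ[k] Module.End k V)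
    (y y' : C →ₗ[k] Module.End k Q) (h : ∀ c, y c ∘ₗ q = q ∘ₗ x c)
    (h' : ∀ c, y' c ∘ₗ q = q ∘ₗ x' c) (c : C) :
    conv y y' c ∘ₗ q = q ∘ₗ conv x x' c := by
  simp only [conv, LinearMap.comp_apply]
  generalize (Coalgebra.comul c : C ⊗[k] C) = t
  induction t with
  | zero => simp
  | tmul a b =>
    simp only [TensorProduct.map_tmul, LinearMap.mul'_apply, Module.End.mul_eq_comp,
      LinearMap.comp_assoc, h']
    simp only [← LinearMap.comp_assoc, h]
  | add x y hx hy => simp only [map_add, LinearMap.comp_add, LinearMap.add_comp, hx, hy]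

theorem IsPartialRep.of_eqMod [HasInvertibleAntipode k H] (q : V →ₗ[k] Q)
    (hq : Function.Surjective q) (x : H →ₗ[k] Module.End k V) (y : H →ₗ[k] Module.End k Q)
    (hxy : ∀ h, y h ∘ₗ q = q ∘ₗ x h) (h1 : q ∘ₗ x 1 = q)
    (h2 : EqMod q (push x (inl k H) * (push x (inr k H) * push x (sig (inr k H))))
      (push x (inl k H * inr k H) * push x (sig (inr k H))))
    (h3 : EqMod q (push x (inl k H) * push x (sig (inl k H)) * push x (sig (inr k H)))
      (push x (inl k H) * push x (sig (inl k H) * sig (inr k H))))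
    (h4 : EqMod q (push x (sig (inl k H)) * (push x (sig (inr k H)) * push x (inr k H)))
      (push x (sig (inl k H) * sig (inr k H)) * push x (inr k H)))
    (h5 : EqMod q (push x (sig (inl k H)) * push x (inl k H) * push x (inr k H))
      (push x (sig (inl k H)) * push x (inl k H * inr k H))) :
    IsPartialRep y := by
  have hcomp : ∀ f : H →ₗ[k] H, ∀ h, (y ∘ₗ f) h ∘ₗ q = q ∘ₗ (x ∘ₗ f) h := fun f h => hxy _
  have hinj : ∀ a b : Module.End k Q, a ∘ₗ q = b ∘ₗ q → a = b := fun a b h =>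
    LinearMap.ext fun z => by obtain ⟨v, rfl⟩ := hq z; exact LinearMap.congr_fun h v
  have hl : ∀ (h : H) (a : Module.End k Q) (b : Module.End k V), a ∘ₗ q = q ∘ₗ b →
      (y h * a) ∘ₗ q = q ∘ₗ (x h * b) := fun h a b e => by
    rw [Module.End.mul_eq_comp, LinearMap.comp_assoc, e, ← LinearMap.comp_assoc, hxy]; rfl
  have hr : ∀ (h : H) (a : Module.End k Q) (b : Module.End k V), a ∘ₗ q = q ∘ₗ b →
      (a * y h) ∘ₗ q = q ∘ₗ (b * x h) := fun h a b e => by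
    rw [Module.End.mul_eq_comp, LinearMap.comp_assoc, hxy, ← LinearMap.comp_assoc, e]; rfl
  constructor
  · apply hinj
    rw [hxy, h1]; rfl
  · intro h g
    apply hinj
    have e := h2 (h ⊗ₜ g)
    rw [eval_two_left, eval_two_right] at e
    rw [hl _ _ _ (conv_comp_of_intertwine q _ _ _ _ hxy (hcomp _) g), e,
      conv_comp_of_intertwine q _ _ _ _ (hcomp _) (hcomp _) g]
  · intro h g
    obtain ⟨g, rfl⟩ := antipode_surjective (k := k) g
    apply hinj
    have e := h3 (h ⊗ₜ g)
    rw [eval_three_left, eval_three_right] at e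
    rw [hr _ _ _ (conv_comp_of_intertwine q _ _ _ _ hxy (hcomp _) h), e,
      conv_comp_of_intertwine q _ _ _ _ hxy (hcomp _) h]
  · intro h g
    obtain ⟨h, rfl⟩ := antipode_surjective (k := k) h
    apply hinj
    have e := h4 (h ⊗ₜ g)
    rw [eval_four_left, eval_four_right] at e
    rw [hl _ _ _ (conv_comp_of_intertwine q _ _ _ _ (hcomp _) hxy g), e,
      conv_comp_of_intertwine q _ _ _ _ (hcomp _) hxy g]
  · intro h g
    apply hinj
    have e := h5 (h ⊗ₜ g)
    rw [eval_five_left, eval_five_right] at e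
    rw [hr _ _ _ (conv_comp_of_intertwine q _ _ _ _ (hcomp _) hxy h), e,
      conv_comp_of_intertwine q _ _ _ _ (hcomp _) (hcomp _) h]

end TensorAux

section TensorAbstract

open WithConv

variable {k : Type u} [CommRing k] {H : Type u} [Ring H] [HopfAlgebra k H]
  [HasInvertibleAntipode k H]
  {V Q : Type*} [AddCommGroup V] [Module k V] [AddCommGroup Q] [Module k Q]
  {α β : H →ₗ[k] Module.End k V}

theorem commute_conv {B C : Type*} [Ring B] [Algebra k B] [AddCommGroup C] [Module k C]
    [Coalgebra k C] (b : B) (f g : C →ₗ[k] B)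
    (hf : ∀ y, Commute b (f y)) (hg : ∀ y, Commute b (g y)) (y : C) :
    Commute b (conv f g y) := by
  simp only [conv, LinearMap.comp_apply]
  generalize (Coalgebra.comul y : C ⊗[k] C) = t
  induction t with
  | zero => simp
  | tmul a b => simpa using (hf a).mul_right (hg b)
  | add x y hx hy => simp only [map_add]; exact hx.add_right hy

theorem flip_aux (hβ : IsPartialRep β)
    (hαβ : ∀ x y, Commute (α x) (β y))
    (q : V →ₗ[k] Q)
    (hq : ∀ y, q ∘ₗ teps α y = q ∘ₗ eps β (HopfAlgebra.antipode k y)) (g x : H) : q ∘ₗ conv (β ∘ₗ HopfAlgebra.antipode k)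
    (teps α ∘ₗ LinearMap.mulLeft k x) g =
    q ∘ₗ (β (HopfAlgebra.antipode k g) * eps β (HopfAlgebra.antipode k x)) := by
  rw [hβ.mul_eps, conv_antipode, conv, LinearMap.comp_apply, LinearMap.comp_apply]
  generalize (Coalgebra.comul g : H ⊗[k] H) = t
  induction t with
  | zero => simp
  | tmul a b =>
    have c : Commute (β (HopfAlgebra.antipode k a)) (teps α (x * b)) :=
      commute_conv _ (α ∘ₗ HopfAlgebra.antipode k) α (fun y => (hαβ _ _).symm) (fun y => (hαβ _ _).symm) _
    simp only [TensorProduct.map_tmul, LinearMap.comp_apply, LinearMap.mulLeft_apply,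
      LinearMap.mul'_apply, TensorProduct.comm_tmul, LinearMap.mulRight_apply]
    rw [c.eq, ← HopfAlgebra.antipode_mul_antidistrib, Module.End.mul_eq_comp,
      ← LinearMap.comp_assoc, hq, LinearMap.comp_assoc]
    rfl
  | add x y hx hy => simp only [map_add, LinearMap.comp_add, hx, hy]

theorem flip_teps (hβ : IsPartialRep β)
    (hαβ : ∀ x y, Commute (α x) (β y))
    (q : V →ₗ[k] Q)
    (hq : ∀ y, q ∘ₗ teps α y = q ∘ₗ eps β (HopfAlgebra.antipode k y)) (g : H) : q ∘ₗ conv (β ∘ₗ HopfAlgebra.antipode k) (teps α) g =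
    q ∘ₗ β (HopfAlgebra.antipode k g) := by
  have h := flip_aux hβ hαβ q hq g 1
  have h1 : eps β (HopfAlgebra.antipode k (1 : H)) = 1 := by
    simp [eps, conv, hβ.pr1, Algebra.TensorProduct.one_def]
  rw [h1, mul_one] at h
  rw [← h]
  congr 2
  ext x : 1
  simp

theorem flip_eps (hα : IsPartialRep α)
    (hαβ : ∀ x y, Commute (α x) (β y))
    (q : V →ₗ[k] Q)
    (hq : ∀ y, q ∘ₗ teps α y = q ∘ₗ eps β (HopfAlgebra.antipode k y)) (h : H) : q ∘ₗ conv α (eps β) h = q ∘ₗ α h := by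
  obtain ⟨g, rfl⟩ := antipode_surjective (k := k) h
  have e := LinearMap.congr_fun hα.teps_key g
  rw [LinearMap.comp_apply] at e
  rw [← e, conv_antipode, conv, LinearMap.comp_apply, LinearMap.comp_apply]
  generalize (Coalgebra.comul g : H ⊗[k] H) = t
  induction t with
  | zero => simp
  | tmul a b =>
    have c : Commute (α (HopfAlgebra.antipode k b)) (eps β (HopfAlgebra.antipode k a)) :=
      commute_conv _ β (β ∘ₗ HopfAlgebra.antipode k) (fun y => hαβ _ _) (fun y => hαβ _ _) _
    simp only [TensorProduct.map_tmul, LinearMap.comp_apply,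
      LinearMap.mul'_apply, TensorProduct.comm_tmul]
    rw [c.eq, Module.End.mul_eq_comp, ← LinearMap.comp_assoc, ← hq, LinearMap.comp_assoc]
    rfl
  | add x y hx hy => simp only [map_add, LinearMap.comp_add, hx, hy]

/-- The operators `x h = Σ α h₁ ∘ β h₂` are compatible with the relation defining `q`. -/
theorem takeuchi (hα : IsPartialRep α)
    (hβ : IsPartialRep β)
    (hαβ : ∀ x y, Commute (α x) (β y))
    (q : V →ₗ[k] Q)
    (hq : ∀ y, q ∘ₗ teps α y = q ∘ₗ eps β (HopfAlgebra.antipode k y)) (h y : H) : q ∘ₗ (conv α β h * teps α y) =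
    q ∘ₗ (conv α β h * eps β (HopfAlgebra.antipode k y)) := by
  obtain ⟨g, rfl⟩ := antipode_surjective (k := k) h
  rw [conv_antipode_of_commute _ _ hαβ]
  let X : WithConv (H →ₗ[k] Module.End k V) := toConv (β ∘ₗ HopfAlgebra.antipode k)
  let Y : WithConv (H →ₗ[k] Module.End k V) := toConv (α ∘ₗ HopfAlgebra.antipode k)
  have e1 : conv (β ∘ₗ HopfAlgebra.antipode k) (α ∘ₗ HopfAlgebra.antipode k) g * teps α y =
      (X * toConv (teps α ∘ₗ LinearMap.mulLeft k y) * Y).ofConv g := by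
    have : (toConv (LinearMap.mulRight k (teps α y) ∘ₗ Y.ofConv)) =
        toConv (teps α ∘ₗ LinearMap.mulLeft k y) * Y := by
      apply WithConv.ext
      ext1 x
      exact hα.mul_teps x y
    rw [mul_assoc, ← this]
    change _ = LinearMap.mul' k _ (TensorProduct.map _ _ (Coalgebra.comul g))
    rw [conv, LinearMap.comp_apply, LinearMap.comp_apply]
    generalize (Coalgebra.comul g : H ⊗[k] H) = t
    induction t with
    | zero => simp
    | tmul a b => simp [X, Y, mul_assoc]
    | add x y hx hy => simp only [map_add, add_mul, hx, hy]
  have e2 : conv (β ∘ₗ HopfAlgebra.antipode k) (α ∘ₗ HopfAlgebra.antipode k) g *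
      eps β (HopfAlgebra.antipode k y) =
      (toConv (LinearMap.mulRight k (eps β (HopfAlgebra.antipode k y)) ∘ₗ X.ofConv) *
        Y).ofConv g := by
    change _ = LinearMap.mul' k _ (TensorProduct.map _ _ (Coalgebra.comul g))
    rw [conv, LinearMap.comp_apply, LinearMap.comp_apply]
    generalize (Coalgebra.comul g : H ⊗[k] H) = t
    induction t with
    | zero => simp
    | tmul a b =>
      have c : Commute (α (HopfAlgebra.antipode k b)) (eps β (HopfAlgebra.antipode k y)) :=
        commute_conv _ β (β ∘ₗ HopfAlgebra.antipode k) (fun y => hαβ _ _) (fun y => hαβ _ _) _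
      simp [X, Y, mul_assoc, c.eq]
    | add x y hx hy => simp only [map_add, add_mul, hx, hy]
  rw [e1, e2]
  refine EqMod.mul_right (q := q) (fun c => ?_) Y g
  exact flip_aux hβ hαβ q hq c y

theorem isPartialRep_tensor (hα : IsPartialRep α)
    (hβ : IsPartialRep β)
    (hαβ : ∀ x y, Commute (α x) (β y))
    (q : V →ₗ[k] Q)
    (hq : ∀ y, q ∘ₗ teps α y = q ∘ₗ eps β (HopfAlgebra.antipode k y))
    (hsurj : Function.Surjective q) (y : H →ₗ[k] Module.End k Q)
    (hxy : ∀ h, y h ∘ₗ q = q ∘ₗ conv α β h) : IsPartialRep y := by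
  have xGL : ∀ {u : WithConv (H ⊗[k] H →ₗ[k] H)}, IsGL u →
      push (conv α β) u = push α u * push β u := by
    rintro u ⟨φ, hφ⟩
    rw [push, ← hφ, conv_comp_coalgHom, hφ]; rfl
  have xS : ∀ {u : WithConv (H ⊗[k] H →ₗ[k] H)}, IsGL u →
      push (conv α β) (sig u) = push β (sig u) * push α (sig u) := by
    rintro u ⟨φ, hφ⟩
    have : conv α β ∘ₗ HopfAlgebra.antipode k =
        conv (β ∘ₗ HopfAlgebra.antipode k) (α ∘ₗ HopfAlgebra.antipode k) :=
      LinearMap.ext fun h => conv_antipode_of_commute _ _ hαβ h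
    change toConv (conv α β ∘ₗ (HopfAlgebra.antipode k ∘ₗ u.ofConv)) = _
    rw [← LinearMap.comp_assoc, this, ← hφ, conv_comp_coalgHom, LinearMap.comp_assoc,
      LinearMap.comp_assoc, hφ]; rfl
  have F2 : ∀ {u : WithConv (H ⊗[k] H →ₗ[k] H)}, IsGL u →
      EqMod q (push α u * (push β u * push β (sig u))) (push α u) := by
    intro u hu c
    rw [push_mul_push_sig β hu]
    obtain ⟨φ, hφ⟩ := hu
    change q ∘ₗ conv (α ∘ₗ u.ofConv) (eps β ∘ₗ u.ofConv) c = q ∘ₗ α (u.ofConv c)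
    rw [← hφ, ← conv_comp_coalgHom]
    exact flip_eps hα hαβ q hq _
  have F1 : ∀ {u : WithConv (H ⊗[k] H →ₗ[k] H)}, IsGL u →
      EqMod q (push β (sig u) * (push α (sig u) * push α u)) (push β (sig u)) := by
    intro u hu c
    rw [push_sig_mul_push α hu]
    obtain ⟨φ, hφ⟩ := hu
    change q ∘ₗ conv (β ∘ₗ (HopfAlgebra.antipode k ∘ₗ u.ofConv)) (teps α ∘ₗ u.ofConv) c =
      q ∘ₗ β (HopfAlgebra.antipode k (u.ofConv c))
    rw [← hφ, ← LinearMap.comp_assoc, ← conv_comp_coalgHom]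
    exact flip_teps hβ hαβ q hq _
  have L : ∀ v : WithConv (H ⊗[k] H →ₗ[k] H),
      ∀ {X Y : WithConv (H ⊗[k] H →ₗ[k] Module.End k V)}, EqMod q X Y →
        EqMod q (push (conv α β) v * X) (push (conv α β) v * Y) := fun v X Y h =>
    h.mul_left _ (fun c => y (v.ofConv c)) (fun c => hxy _)
  -- commutation of operators depending on different variables
  have cLR : ∀ f g : H →ₗ[k] H, Commute (toConv ((α ∘ₗ f) ∘ₗ (inl k H).ofConv))
      (toConv ((β ∘ₗ g) ∘ₗ (inr k H).ofConv)) := fun f g =>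
    commute_inl_inr _ _ fun x y => hαβ _ _
  have cRL : ∀ f g : H →ₗ[k] H, Commute (toConv ((β ∘ₗ f) ∘ₗ (inl k H).ofConv))
      (toConv ((α ∘ₗ g) ∘ₗ (inr k H).ofConv)) := fun f g =>
    commute_inl_inr _ _ fun x y => (hαβ _ _).symm
  have c1 : Commute (push β (inl k H)) (push α (inr k H)) := cRL LinearMap.id LinearMap.id
  have c2 : Commute (push β (inl k H)) (push α (sig (inr k H))) :=
    cRL LinearMap.id (HopfAlgebra.antipode k)
  have c3 : Commute (push α (inl k H)) (push β (sig (inr k H))) :=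
    cLR LinearMap.id (HopfAlgebra.antipode k)
  have c4 : Commute (push α (sig (inl k H))) (push β (sig (inr k H))) :=
    cLR (HopfAlgebra.antipode k) (HopfAlgebra.antipode k)
  have c5 : Commute (push α (sig (inl k H))) (push β (inr k H)) :=
    cLR (HopfAlgebra.antipode k) LinearMap.id
  have c6 : Commute (push β (sig (inl k H))) (push α (inr k H)) :=
    cRL (HopfAlgebra.antipode k) LinearMap.id
  refine IsPartialRep.of_eqMod q hsurj (conv α β) y hxy ?_ ?_ ?_ ?_ ?_
  · have : conv α β (1 : H) = 1 := by
      simp [conv, hα.pr1, hβ.pr1, Algebra.TensorProduct.one_def]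
    rw [this]; rfl
  · have s1 := (L (inl k H) ((F2 isGL_inr).mul_right (push α (sig (inr k H)))))
    have s2 := (F2 isGL_inl_mul_inr).mul_right (push β (inl k H) * push α (sig (inr k H)))
    refine (EqMod.of_eq ?_).trans (s1.trans ((EqMod.of_eq ?_).trans
      (s2.symm.trans (EqMod.of_eq ?_))))
    · rw [xGL isGL_inr, xS isGL_inr]; simp only [mul_assoc]
    · rw [xGL isGL_inl, mul_assoc, (c1.mul_right c2).eq, ← mul_assoc, hα.prA pair_inr, mul_assoc,
        c2.eq]
    · rw [xGL isGL_inl_mul_inr, xS isGL_inr, ← sig_mul_sig]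
      have m := hβ.move pair_inr pair_inl_inr
      rw [hβ.prA pair_inr] at m
      simp only [mul_assoc] at m ⊢
      rw [← mul_assoc (push β (inl k H * inr k H)) (push β (sig (inr k H))), m]
      simp only [mul_assoc]
  · have s1 := (F2 isGL_inl).mul_right
      (push α (sig (inl k H)) * (push β (sig (inr k H)) * push α (sig (inr k H))))
    have s2 := (F2 isGL_inl).mul_right
      (push β (sig (inr k H)) * push α (sig (inl k H) * sig (inr k H)))
    refine (EqMod.of_eq ?_).trans (s1.trans ((EqMod.of_eq ?_).trans
      (s2.symm.trans (EqMod.of_eq ?_))))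
    · rw [xGL isGL_inl, xS isGL_inl, xS isGL_inr]; simp only [mul_assoc]
    · rw [← mul_assoc, ← mul_assoc, (c3.mul_left c4).eq, ← mul_assoc (push α (inl k H)), c3.eq,
        mul_assoc, mul_assoc, mul_assoc (push β (sig (inr k H))) (push α (inl k H)),
        ← hα.prB pair_inl]
      simp only [mul_assoc]
    · rw [sig_mul_sig', xGL isGL_inl, xS isGL_inr_mul_inl, ← sig_mul_sig']
      have m := hβ.prB pair_inl (sig (inr k H))
      simp only [mul_assoc] at m ⊢
      rw [← mul_assoc (push β (inl k H)) (push β (sig (inl k H) * sig (inr k H))), ← m]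
      simp only [mul_assoc]
  · have s1 := L (sig (inl k H)) ((F1 isGL_inr).mul_right (push β (inr k H)))
    have s2 := (F1 isGL_inr_mul_inl).mul_right (push α (sig (inl k H)) * push β (inr k H))
    refine (EqMod.of_eq ?_).trans (s1.trans ((EqMod.of_eq ?_).trans
      (s2.symm.trans (EqMod.of_eq ?_))))
    · rw [xGL isGL_inr, xS isGL_inr]; simp only [mul_assoc]
    · rw [xS isGL_inl, mul_assoc, (c4.mul_right c5).eq, ← mul_assoc, hβ.prA pair_inr.symm,
        mul_assoc, c5.eq, sig_mul_sig']
    · rw [sig_mul_sig', xS isGL_inr_mul_inl, xGL isGL_inr]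
      have m := hα.move (v := sig (inl k H)) (v' := inl k H) pair_inr.symm pair_inr_inl.symm
      rw [hα.prA pair_inr.symm, sig_mul_sig'] at m
      simp only [mul_assoc] at m ⊢
      rw [← mul_assoc (push α (sig (inr k H * inl k H))) (push α (inr k H)), m]
      simp only [mul_assoc]
  · have s1 := (F1 isGL_inl).mul_right (push β (inl k H) * (push α (inr k H) * push β (inr k H)))
    have s2 := (F1 isGL_inl).mul_right (push α (inr k H) * push β (inl k H * inr k H))
    refine (EqMod.of_eq ?_).trans (s1.trans ((EqMod.of_eq ?_).trans
      (s2.symm.trans (EqMod.of_eq ?_))))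
    · rw [xGL isGL_inr, xS isGL_inl, xGL isGL_inl]; simp only [mul_assoc]
    · rw [← mul_assoc (push β (inl k H)), c1.eq, mul_assoc (push α (inr k H)),
        ← mul_assoc, c6.eq, mul_assoc, ← mul_assoc (push β (sig _)), hβ.prB pair_inl.symm,
        ← mul_assoc (push β (sig _)), c6.eq]
      simp only [mul_assoc]
    · rw [xS isGL_inl, xGL isGL_inl_mul_inr]
      have m := hα.prB pair_inl.symm (inr k H)
      simp only [mul_assoc] at m ⊢
      rw [← mul_assoc (push α (sig (inl k H))) (push α (inl k H * inr k H)), ← m]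
      simp only [mul_assoc]

end TensorAbstract

section TensorA

open WithConv

variable {k : Type u} [CommRing k] {H : Type u} [Ring H] [HopfAlgebra k H]

/-- `H_par`-modules are `k`-modules by restriction of scalars. -/
instance modK (M : ModuleCat.{u} (Hpar k H)) : Module k M :=
  Module.compHom M (algebraMap k (Hpar k H))

theorem algebraMap_smul' (M : ModuleCat.{u} (Hpar k H)) (c : k) (m : M) :
    algebraMap k (Hpar k H) c • m = c • m := rfl

instance (M : ModuleCat.{u} (Hpar k H)) : IsScalarTower k (Hpar k H) M where
  smul_assoc c x m := by rw [Algebra.smul_def, mul_smul]; rfl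

instance (M : ModuleCat.{u} (Hpar k H)) : SMulCommClass (Hpar k H) k M where
  smul_comm x c m := by
    rw [← algebraMap_smul' M c m, ← algebraMap_smul' M c, ← mul_smul, ← mul_smul,
      Algebra.commutes]

/-- The action of `H_par` on a module, as an algebra map. -/
def lin (M : ModuleCat.{u} (Hpar k H)) : Hpar k H →ₐ[k] Module.End k M := Algebra.lsmul k k M

@[simp] theorem lin_apply (M : ModuleCat.{u} (Hpar k H)) (x : Hpar k H) (m : M) :
    lin M x m = x • m := rfl

/-- `H_par` acting on the left factor of `M ⊗[k] N`. -/
def linL (M N : ModuleCat.{u} (Hpar k H)) : Hpar k H →ₐ[k] Module.End k (M ⊗[k] N) :=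
  (Module.End.rTensorAlgHom k M N).comp (lin M)

/-- `H_par` acting on the right factor of `M ⊗[k] N`. -/
def linR (M N : ModuleCat.{u} (Hpar k H)) : Hpar k H →ₐ[k] Module.End k (M ⊗[k] N) :=
  (Module.End.lTensorAlgHom k N M).comp (lin N)

@[simp] theorem linL_tmul (M N : ModuleCat.{u} (Hpar k H)) (x : Hpar k H) (m : M) (n : N) :
    linL M N x (m ⊗ₜ n) = (x • m) ⊗ₜ n := rfl

@[simp] theorem linR_tmul (M N : ModuleCat.{u} (Hpar k H)) (x : Hpar k H) (m : M) (n : N) :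
    linR M N x (m ⊗ₜ n) = m ⊗ₜ (x • n) := rfl

theorem commute_linL_linR (M N : ModuleCat.{u} (Hpar k H)) (x y : Hpar k H) :
    Commute (linL M N x) (linR M N y) := by
  refine TensorProduct.ext' fun m n => ?_
  simp [Module.End.mul_apply]

/-- The operator `m ⊗ n ↦ [h₁] m ⊗ [h₂] n`. -/
def diag (M N : ModuleCat.{u} (Hpar k H)) : H →ₗ[k] Module.End k (M ⊗[k] N) :=
  conv ((linL M N).toLinearMap ∘ₗ br k H) ((linR M N).toLinearMap ∘ₗ br k H)

variable [HasInvertibleAntipode k H]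

/-- The submodule spanned by `m a ⊗ n - m ⊗ a n` for `a` in the base algebra, where
`m a = t(a) • m`. -/
def balanced (M N : ModuleCat.{u} (Hpar k H)) : Submodule k (M ⊗[k] N) :=
  Submodule.span k {z | ∃ a ∈ baseAlg k H, ∃ (m : M) (n : N),
    z = (tgt a • m) ⊗ₜ[k] n - m ⊗ₜ[k] (a • n)}

theorem mkQ_balanced (M N : ModuleCat.{u} (Hpar k H)) {a : Hpar k H} (ha : a ∈ baseAlg k H) :
    (balanced M N).mkQ ∘ₗ linL M N (tgt a) = (balanced M N).mkQ ∘ₗ linR M N a := by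
  refine TensorProduct.ext' fun m n => ?_
  simp only [LinearMap.comp_apply, linL_tmul, linR_tmul]
  rw [← sub_eq_zero, ← map_sub]
  exact (Submodule.Quotient.mk_eq_zero _).2 (Submodule.subset_span ⟨a, ha, m, n, rfl⟩)

theorem mkQ_teps (M N : ModuleCat.{u} (Hpar k H)) (y : H) :
    (balanced M N).mkQ ∘ₗ teps ((linL M N).toLinearMap ∘ₗ br k H) y =
    (balanced M N).mkQ ∘ₗ eps ((linR M N).toLinearMap ∘ₗ br k H) (HopfAlgebra.antipode k y) := by
  have h := mkQ_balanced M N (eps_mem (HopfAlgebra.antipode k y))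
  rw [tgt_eps, teps, eps, algHom_conv, algHom_conv] at h
  exact h

theorem isPartialRep_linL (M N : ModuleCat.{u} (Hpar k H)) :
    IsPartialRep ((linL M N).toLinearMap ∘ₗ br k H) := isPartialRep_br.comp _

theorem isPartialRep_linR (M N : ModuleCat.{u} (Hpar k H)) :
    IsPartialRep ((linR M N).toLinearMap ∘ₗ br k H) := isPartialRep_br.comp _

theorem mkQ_diag (M N : ModuleCat.{u} (Hpar k H)) (h : H) {a : Hpar k H}
    (ha : a ∈ baseAlg k H) :
    (balanced M N).mkQ ∘ₗ (diag M N h * linL M N (tgt a)) =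
      (balanced M N).mkQ ∘ₗ (diag M N h * linR M N a) := by
  induction ha using Algebra.adjoin_induction with
  | mem a ha =>
    obtain ⟨g, rfl⟩ := ha
    obtain ⟨y, rfl⟩ := antipode_surjective (k := k) g
    have := takeuchi (isPartialRep_linL M N) (isPartialRep_linR M N)
      (fun x y => commute_linL_linR M N _ _) _ (mkQ_teps M N) h y
    rw [tgt_eps, teps, eps, algHom_conv, algHom_conv]
    exact this
  | algebraMap r => rw [tgt_algebraMap, AlgHom.commutes, AlgHom.commutes]
  | add x y _ _ hx hy =>
    rw [tgt_add, map_add, map_add, mul_add, mul_add, LinearMap.comp_add, LinearMap.comp_add,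
      hx, hy]
  | mul x y _ _ hx hy =>
    have e : ∀ X Y Z : Module.End k (M ⊗[k] N), (balanced M N).mkQ ∘ₗ X =
        (balanced M N).mkQ ∘ₗ Y → (balanced M N).mkQ ∘ₗ (X * Z) =
        (balanced M N).mkQ ∘ₗ (Y * Z) := fun X Y Z h => by
      rw [Module.End.mul_eq_comp, Module.End.mul_eq_comp, ← LinearMap.comp_assoc, h,
        LinearMap.comp_assoc]
    rw [tgt_mul, map_mul, map_mul, ← mul_assoc, ← mul_assoc, e _ _ _ hy, mul_assoc,
      ← (commute_linL_linR M N (tgt x) y).eq, ← mul_assoc, e _ _ _ hx]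

/-- The operator induced by `diag` on `M ⊗_A N`. -/
def diagQ (M N : ModuleCat.{u} (Hpar k H)) :
    H →ₗ[k] Module.End k ((M ⊗[k] N) ⧸ balanced M N) where
  toFun h := (balanced M N).liftQ ((balanced M N).mkQ ∘ₗ diag M N h) (by
    rw [balanced, Submodule.span_le]
    rintro z ⟨a, ha, m, n, rfl⟩
    have := LinearMap.congr_fun (mkQ_diag M N h ha) (m ⊗ₜ n)
    rw [SetLike.mem_coe, LinearMap.mem_ker, map_sub, sub_eq_zero]
    exact this)
  map_add' h g := by
    apply Submodule.linearMap_qext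
    ext; simp
  map_smul' c h := by
    apply Submodule.linearMap_qext
    ext; simp

theorem diagQ_mkQ (M N : ModuleCat.{u} (Hpar k H)) (h : H) :
    diagQ M N h ∘ₗ (balanced M N).mkQ = (balanced M N).mkQ ∘ₗ diag M N h :=
  Submodule.liftQ_mkQ _ _ _

theorem isPartialRep_diagQ (M N : ModuleCat.{u} (Hpar k H)) : IsPartialRep (diagQ M N) :=
  isPartialRep_tensor (isPartialRep_linL M N) (isPartialRep_linR M N)
    (fun _ _ => commute_linL_linR M N _ _) _ (mkQ_teps M N) (Submodule.mkQ_surjective _) _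
    (diagQ_mkQ M N)

/-- The `H_par`-module `M ⊗_A N`, with `[h] (m ⊗ n) = [h₁] m ⊗ [h₂] n`. -/
def tens (M N : ModuleCat.{u} (Hpar k H)) : ModuleCat.{u} (Hpar k H) :=
  letI : Module (Hpar k H) ((M ⊗[k] N) ⧸ balanced M N) :=
    Module.compHom _ (Hpar.lift (diagQ M N) (isPartialRep_diagQ M N)).toRingHom
  ModuleCat.of (Hpar k H) ((M ⊗[k] N) ⧸ balanced M N)

/-- The quotient map `M ⊗[k] N → M ⊗_A N`. -/
def tens.mk (M N : ModuleCat.{u} (Hpar k H)) : M ⊗[k] N →ₗ[k] tens M N where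
  toFun z := (balanced M N).mkQ z
  map_add' _ _ := map_add (balanced M N).mkQ _ _
  map_smul' c z := by
    change _ = (Hpar.lift (diagQ M N) (isPartialRep_diagQ M N)) (algebraMap k _ c) _
    rw [AlgHom.commutes, map_smul]
    rfl

theorem tens.mk_surjective (M N : ModuleCat.{u} (Hpar k H)) : Function.Surjective (tens.mk M N) :=
  Submodule.mkQ_surjective _

theorem br_smul_mk (M N : ModuleCat.{u} (Hpar k H)) (h : H) (z : M ⊗[k] N) :
    br k H h • tens.mk M N z = tens.mk M N (diag M N h z) := by
  change (Hpar.lift (diagQ M N) (isPartialRep_diagQ M N)) (br k H h) _ = _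
  rw [Hpar.lift_br]
  exact LinearMap.congr_fun (diagQ_mkQ M N h) z

/-- The class of `m ⊗ n` in `M ⊗_A N`. -/
def tmul {M N : ModuleCat.{u} (Hpar k H)} (m : M) (n : N) : tens M N := tens.mk M N (m ⊗ₜ n)

variable {M N : ModuleCat.{u} (Hpar k H)}

@[simp] theorem mk_tmul (m : M) (n : N) : tens.mk M N (m ⊗ₜ n) = tmul m n := rfl

theorem add_tmul (m m' : M) (n : N) : tmul (m + m') n = tmul m n + tmul m' n := by
  rw [tmul, TensorProduct.add_tmul, map_add]; rfl

theorem tmul_add (m : M) (n n' : N) : tmul m (n + n') = tmul m n + tmul m n' := by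
  rw [tmul, TensorProduct.tmul_add, map_add]; rfl

theorem tgt_smul_tmul {a : Hpar k H} (ha : a ∈ baseAlg k H) (m : M) (n : N) :
    tmul (tgt a • m) n = tmul m (a • n) :=
  LinearMap.congr_fun (mkQ_balanced M N ha) (m ⊗ₜ n)

theorem tens.induction {p : tens M N → Prop} (h : ∀ m n, p (tmul m n))
    (hadd : ∀ x y, p x → p y → p (x + y)) (z : tens M N) : p z := by
  obtain ⟨z, rfl⟩ := tens.mk_surjective M N z
  induction z with
  | zero =>
    have := h 0 0
    rwa [tmul, TensorProduct.zero_tmul] at this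
  | tmul m n => exact h m n
  | add x y hx hy => rw [map_add]; exact hadd _ _ hx hy

theorem br_smul_tmul {ι : Type*} (h : H) (r : Coalgebra.Repr k h ι) (m : M) (n : N) :
    br k H h • tmul m n = ∑ i ∈ r.index, tmul (br k H (r.left i) • m) (br k H (r.right i) • n) := by
  rw [tmul, br_smul_mk]
  simp only [diag, conv, LinearMap.comp_apply]
  rw [← r.eq]
  simp [Module.End.mul_apply]

/-- `m ⊗ n`, as a `k`-bilinear map. -/
def tmulL (M N : ModuleCat.{u} (Hpar k H)) : M →ₗ[k] N →ₗ[k] tens M N :=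
  TensorProduct.curry (tens.mk M N)

@[simp] theorem tmulL_apply (m : M) (n : N) : tmulL M N m n = tmul m n := rfl

theorem balanced_smul {X : Type*} [AddCommGroup X] (f : M →+ N →+ X)
    (hf : ∀ a ∈ baseAlg k H, ∀ m n, f (tgt a • m) n = f m (a • n)) (c : k) (m : M) (n : N) :
    f (c • m) n = f m (c • n) := by
  have := hf _ (Subalgebra.algebraMap_mem (baseAlg k H) c) m n
  rwa [tgt_algebraMap] at this

/-- The additive map `M ⊗_A N → X` induced by a balanced biadditive map. -/
def tens.lift {X : Type*} [AddCommGroup X] (f : M →+ N →+ X)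
    (hf : ∀ a ∈ baseAlg k H, ∀ m n, f (tgt a • m) n = f m (a • n)) : tens M N →+ X :=
  QuotientAddGroup.lift (balanced M N).toAddSubgroup
    (TensorProduct.liftAddHom f (balanced_smul f hf)) (by
    intro z hz
    have hz' : z ∈ balanced M N := hz
    have : ∀ c : k, TensorProduct.liftAddHom f (balanced_smul f hf) (c • z) = 0 := by
      clear hz
      rw [balanced] at hz'
      induction hz' using Submodule.span_induction with
      | mem z hz =>
        obtain ⟨a, ha, m, n, rfl⟩ := hz
        intro c
        rw [smul_sub, map_sub, ← TensorProduct.tmul_smul c (tgt a • m), ← TensorProduct.tmul_smul c m,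
          TensorProduct.liftAddHom_tmul, TensorProduct.liftAddHom_tmul, hf a ha,
          smul_comm, sub_self]
      | zero => intro c; rw [smul_zero, map_zero]
      | add x y hx hy hx' hy' =>
        intro c; rw [smul_add, map_add, hx', hy', add_zero]
      | smul d x hx hx' => intro c; rw [smul_smul]; exact hx' _
    have := this 1
    rwa [one_smul] at this)

@[simp] theorem tens.lift_tmul {X : Type*} [AddCommGroup X] (f : M →+ N →+ X)
    (hf : ∀ a ∈ baseAlg k H, ∀ m n, f (tgt a • m) n = f m (a • n)) (m : M) (n : N) :
    tens.lift f hf (tmul m n) = f m n := by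
  exact TensorProduct.liftAddHom_tmul (R := k) f (balanced_smul f hf) m n

/-- An additive map which commutes with all `[h]` is `H_par`-linear. -/
theorem smul_of_br {M N : ModuleCat.{u} (Hpar k H)} (f : M →+ N)
    (hf : ∀ (h : H) (m : M), f (br k H h • m) = br k H h • f m) (x : Hpar k H) (m : M) :
    f (x • m) = x • f m := by
  have hx : x ∈ Algebra.adjoin k (Set.range (br k H)) := by rw [Hpar.adjoin_br]; trivial
  induction hx using Algebra.adjoin_induction generalizing m with
  | mem x hx => obtain ⟨h, rfl⟩ := hx; exact hf h m
  | algebraMap c =>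
    have e : br k H (c • 1) = algebraMap k (Hpar k H) c := by
      rw [LinearMap.map_smul, isPartialRep_br.pr1, ← Algebra.algebraMap_eq_smul_one]
    rw [← e]
    exact hf (c • 1) m
  | add x y _ _ hx hy => rw [add_smul, add_smul, map_add, hx, hy]
  | mul x y _ _ hx hy => rw [mul_smul, mul_smul, hx, hy]

/-- The morphism given by an additive map which commutes with all `[h]`. -/
def homOfAdd {M N : ModuleCat.{u} (Hpar k H)} (f : M →+ N)
    (hf : ∀ (h : H) (m : M), f (br k H h • m) = br k H h • f m) : M ⟶ N :=
  ModuleCat.ofHom { f with map_smul' := smul_of_br f hf }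

@[simp] theorem homOfAdd_apply {M N : ModuleCat.{u} (Hpar k H)} (f : M →+ N)
    (hf : ∀ (h : H) (m : M), f (br k H h • m) = br k H h • f m) (m : M) :
    homOfAdd f hf m = f m := rfl

theorem tens.hom_ext {X : ModuleCat.{u} (Hpar k H)} {f g : tens M N ⟶ X}
    (h : ∀ m n, f (tmul m n) = g (tmul m n)) : f = g := by
  ext z
  induction z using tens.induction with
  | h m n => exact h m n
  | hadd x y hx hy => rw [map_add, map_add, hx, hy]

theorem eps_smul_tmul (g : H) (m : M) (n : N) :
    eps (br k H) g • tmul m n = tmul (eps (br k H) g • m) n := by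
  have h1 := conv_comp_of_intertwine (balanced M N).mkQ (diag M N)
    (diag M N ∘ₗ HopfAlgebra.antipode k) (diagQ M N) (diagQ M N ∘ₗ HopfAlgebra.antipode k)
    (diagQ_mkQ M N) (fun c => diagQ_mkQ M N _) g
  have e0 : diag M N ∘ₗ HopfAlgebra.antipode k =
      conv (((linR M N).toLinearMap ∘ₗ br k H) ∘ₗ HopfAlgebra.antipode k)
        (((linL M N).toLinearMap ∘ₗ br k H) ∘ₗ HopfAlgebra.antipode k) :=
    LinearMap.ext fun h => conv_antipode_of_commute _ _ (fun _ _ => commute_linL_linR M N _ _) h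
  have h2 : EqMod (balanced M N).mkQ
      (toConv (diag M N) * toConv (diag M N ∘ₗ HopfAlgebra.antipode k))
      (toConv (eps ((linL M N).toLinearMap ∘ₗ br k H))) := by
    have := EqMod.mul_right (q := (balanced M N).mkQ)
      (X := toConv ((linL M N).toLinearMap ∘ₗ br k H) *
        toConv (eps ((linR M N).toLinearMap ∘ₗ br k H)))
      (Y := toConv ((linL M N).toLinearMap ∘ₗ br k H))
      (fun h => flip_eps (isPartialRep_linL M N)
        (fun _ _ => commute_linL_linR M N _ _) _ (mkQ_teps M N) h)
      (toConv (((linL M N).toLinearMap ∘ₗ br k H) ∘ₗ HopfAlgebra.antipode k))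
    refine (EqMod.of_eq ?_).trans this
    rw [e0, diag, toConv_conv, toConv_conv, eps, toConv_conv]
    simp only [mul_assoc]
  have h3 := LinearMap.congr_fun (h1.trans (h2 g)) (m ⊗ₜ n)
  change Hpar.lift (diagQ M N) (isPartialRep_diagQ M N) (eps (br k H) g) _ = _
  rw [eps, algHom_conv, ← LinearMap.comp_assoc]
  have e1 : (Hpar.lift (diagQ M N) (isPartialRep_diagQ M N)).toLinearMap ∘ₗ br k H =
    diagQ M N := by ext1 h; simp
  rw [e1]
  refine h3.trans ?_
  have e2 : eps ((linL M N).toLinearMap ∘ₗ br k H) g = linL M N (eps (br k H) g) := by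
    rw [eps, eps, algHom_conv]; rfl
  exact congrArg (fun f => (balanced M N).mkQ (f (m ⊗ₜ n))) e2

theorem teps_smul_tmul (g : H) (m : M) (n : N) :
    teps (br k H) g • tmul m n = tmul m (teps (br k H) g • n) := by
  have h1 := conv_comp_of_intertwine (balanced M N).mkQ
    (diag M N ∘ₗ HopfAlgebra.antipode k) (diag M N) (diagQ M N ∘ₗ HopfAlgebra.antipode k)
    (diagQ M N) (fun c => diagQ_mkQ M N _) (diagQ_mkQ M N) g
  have e0 : diag M N ∘ₗ HopfAlgebra.antipode k =
      conv (((linR M N).toLinearMap ∘ₗ br k H) ∘ₗ HopfAlgebra.antipode k)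
        (((linL M N).toLinearMap ∘ₗ br k H) ∘ₗ HopfAlgebra.antipode k) :=
    LinearMap.ext fun h => conv_antipode_of_commute _ _ (fun _ _ => commute_linL_linR M N _ _) h
  have h2 : EqMod (balanced M N).mkQ
      (toConv (diag M N ∘ₗ HopfAlgebra.antipode k) * toConv (diag M N))
      (toConv (teps ((linR M N).toLinearMap ∘ₗ br k H))) := by
    have := EqMod.mul_right (q := (balanced M N).mkQ)
      (X := toConv (((linR M N).toLinearMap ∘ₗ br k H) ∘ₗ HopfAlgebra.antipode k) *
        toConv (teps ((linL M N).toLinearMap ∘ₗ br k H)))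
      (Y := toConv (((linR M N).toLinearMap ∘ₗ br k H) ∘ₗ HopfAlgebra.antipode k))
      (fun h => flip_teps (isPartialRep_linR M N)
        (fun _ _ => commute_linL_linR M N _ _) _ (mkQ_teps M N) h)
      (toConv ((linR M N).toLinearMap ∘ₗ br k H))
    refine (EqMod.of_eq ?_).trans this
    rw [e0, diag, toConv_conv, toConv_conv, teps, toConv_conv]
    simp only [mul_assoc]
  have h3 := LinearMap.congr_fun (h1.trans (h2 g)) (m ⊗ₜ n)
  change Hpar.lift (diagQ M N) (isPartialRep_diagQ M N) (teps (br k H) g) _ = _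
  rw [teps, algHom_conv, ← LinearMap.comp_assoc]
  have e1 : (Hpar.lift (diagQ M N) (isPartialRep_diagQ M N)).toLinearMap ∘ₗ br k H =
    diagQ M N := by ext1 h; simp
  rw [e1]
  refine h3.trans ?_
  have e2 : teps ((linR M N).toLinearMap ∘ₗ br k H) g = linR M N (teps (br k H) g) := by
    rw [teps, teps, algHom_conv]; rfl
  exact congrArg (fun f => (balanced M N).mkQ (f (m ⊗ₜ n))) e2

theorem base_smul_tmul {a : Hpar k H} (ha : a ∈ baseAlg k H) (m : M) (n : N) :
    a • tmul m n = tmul (a • m) n := by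
  induction ha using Algebra.adjoin_induction generalizing m n with
  | mem a ha => obtain ⟨g, rfl⟩ := ha; exact eps_smul_tmul g m n
  | algebraMap r =>
    exact ((tens.mk M N).map_smul r (m ⊗ₜ n)).symm
  | add x y _ _ hx hy => rw [add_smul, add_smul, hx, hy, add_tmul]
  | mul x y _ _ hx hy => rw [mul_smul, mul_smul, hy, hx]

theorem tgt_smul_tmul' {a : Hpar k H} (ha : a ∈ baseAlg k H) (m : M) (n : N) :
    tgt a • tmul m n = tmul m (tgt a • n) := by
  induction ha using Algebra.adjoin_induction generalizing m n with
  | mem a ha =>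
    obtain ⟨g, rfl⟩ := ha
    obtain ⟨y, rfl⟩ := antipode_surjective (k := k) g
    rw [tgt_eps]
    exact teps_smul_tmul y m n
  | algebraMap r =>
    rw [tgt_algebraMap]
    refine ((tens.mk M N).map_smul r (m ⊗ₜ n)).symm.trans ?_
    rw [← TensorProduct.tmul_smul]
    rfl
  | add x y _ _ hx hy => rw [tgt_add, add_smul, add_smul, hx, hy, tmul_add]
  | mul x y _ _ hx hy => rw [tgt_mul, mul_smul, mul_smul, hx, hy]

end TensorA

section PartialAction

open WithConv

variable {k : Type u} [CommRing k] {H : Type u} [Ring H] [HopfAlgebra k H]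

/-- A symmetric partial action of the Hopf algebra `H` on the algebra `B`. -/
structure IsSymPartialAction {B : Type*} [Ring B] [Algebra k B] (act : H →ₗ[k] B →ₗ[k] B) :
    Prop where
  /-- `1 · a = a` -/
  one_act : ∀ a, act 1 a = a
  /-- `h · (a b) = (h₁ · a) (h₂ · b)` -/
  act_mul : ∀ h a b, act h (a * b) = conv (act.flip a) (act.flip b) h
  /-- `h · (g · a) = (h₁ · 1) (h₂ g · a)` -/
  act_act : ∀ h g a, act h (act g a) =
    conv (act.flip 1) (act.flip a ∘ₗ LinearMap.mulRight k g) h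
  /-- `h · (g · a) = (h₁ g · a) (h₂ · 1)` -/
  act_act' : ∀ h g a, act h (act g a) =
    conv (act.flip a ∘ₗ LinearMap.mulRight k g) (act.flip 1) h

/-- `π (W h) * π g = X h₁ * π (W h₂ g)` for all `h`, `g`, in the convolution algebra. -/
theorem push_mul_push {E C : Type*} [Ring E] [Algebra k E] [AddCommGroup C] [Module k C]
    [Coalgebra k C] (π X : H →ₗ[k] E) (W : H →ₗ[k] H)
    (h : ∀ x g : H, π (W x) * π g = conv X (π ∘ₗ LinearMap.mulRight k g ∘ₗ W) x)
    (φ : C →ₗc[k] H) (v : WithConv (C →ₗ[k] H)) :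
    push π (toConv (W ∘ₗ φ.toLinearMap)) * push π v =
      toConv (X ∘ₗ φ.toLinearMap) * push π (toConv (W ∘ₗ φ.toLinearMap) * v) := by
  let G : (C ⊗[k] C) ⊗[k] C →ₗ[k] E := LinearMap.mul' k E ∘ₗ
    TensorProduct.map (X ∘ₗ φ.toLinearMap)
      (π ∘ₗ LinearMap.mul' k H ∘ₗ TensorProduct.map (W ∘ₗ φ.toLinearMap) v.ofConv) ∘ₗ
      (TensorProduct.assoc k C C C).toLinearMap
  have h1 : LinearMap.mul' k E ∘ₗ TensorProduct.map
      (π ∘ₗ W ∘ₗ φ.toLinearMap) (π ∘ₗ v.ofConv) =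
      G ∘ₗ LinearMap.rTensor C Coalgebra.comul := by
    refine TensorProduct.ext' fun y x => ?_
    have e1 := h (φ y) (v.ofConv x)
    have e3 := LinearMap.congr_fun
      (conv_comp_coalgHom X (π ∘ₗ LinearMap.mulRight k (v.ofConv x) ∘ₗ W) φ) y
    simp only [LinearMap.comp_assoc] at e3
    refine e1.trans (e3.trans ?_)
    simp only [conv, LinearMap.comp_apply, LinearMap.rTensor_tmul, G, LinearEquiv.coe_coe]
    generalize (Coalgebra.comul y : C ⊗[k] C) = t
    induction t with
    | zero => simp
    | tmul a b => simp
    | add x y hx hy => simp only [map_add, TensorProduct.add_tmul, hx, hy]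
  apply WithConv.ext
  ext c
  have h2 := LinearMap.congr_fun h1 (Coalgebra.comul c)
  refine h2.trans ?_
  simp only [G, LinearMap.comp_apply, LinearEquiv.coe_coe]
  rw [Coalgebra.coassoc_apply]
  change _ = LinearMap.mul' k E (TensorProduct.map _ _ (Coalgebra.comul c))
  generalize (Coalgebra.comul c : C ⊗[k] C) = t
  induction t with
  | zero => simp
  | tmul x y =>
    simp only [LinearMap.lTensor_tmul, TensorProduct.map_tmul, LinearMap.comp_apply]
    rfl
  | add x y hx hy => simp only [map_add, hx, hy]

theorem conv_assoc {B : Type*} [Ring B] [Algebra k B] (f g e : H →ₗ[k] B) :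
    conv (conv f g) e = conv f (conv g e) :=
  congrArg ofConv (mul_assoc (toConv f) (toConv g) (toConv e))

variable {B : Type*} [Ring B] [Algebra k B] {act : H →ₗ[k] B →ₗ[k] B}

/-- `h ↦ L (h · 1)` -/
def actL (act : H →ₗ[k] B →ₗ[k] B) : H →ₗ[k] Module.End k B := LinearMap.mul k B ∘ₗ act.flip 1

/-- `h ↦ R (S h · 1)` -/
def actR (act : H →ₗ[k] B →ₗ[k] B) : H →ₗ[k] Module.End k B :=
  (LinearMap.mul k B).flip ∘ₗ act.flip 1 ∘ₗ HopfAlgebra.antipode k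

theorem IsSymPartialAction.hL (ha : IsSymPartialAction act) (x g : H) :
    (act x : Module.End k B) * act g =
    conv (B := Module.End k B) (actL act)
      (act ∘ₗ LinearMap.mulRight k g ∘ₗ LinearMap.id) x := by
  ext a
  refine (ha.act_act x g a).trans ?_
  simp only [conv, LinearMap.comp_apply]
  generalize (Coalgebra.comul x : H ⊗[k] H) = t
  induction t with
  | zero => simp
  | tmul a b => simp [actL, Module.End.mul_apply]
  | add x y hx hy => simp only [map_add, hx, hy, LinearMap.add_apply]

theorem IsSymPartialAction.hR (ha : IsSymPartialAction act) (x g : H) :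
    (act (HopfAlgebra.antipode k x) : Module.End k B) * act g =
    conv (B := Module.End k B) (actR act)
      (act ∘ₗ LinearMap.mulRight k g ∘ₗ HopfAlgebra.antipode k) x := by
  ext a
  refine (ha.act_act' _ g a).trans ?_
  rw [conv_antipode]
  simp only [conv, LinearMap.comp_apply]
  generalize (Coalgebra.comul x : H ⊗[k] H) = t
  induction t with
  | zero => simp
  | tmul a b => simp [actR, Module.End.mul_apply]
  | add x y hx hy => simp only [map_add, hx, hy, LinearMap.add_apply]

theorem IsSymPartialAction.eps_eq (ha : IsSymPartialAction act) :
    eps (B := Module.End k B) act = actL act := by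
  have p1 : push (B := Module.End k B) act (1 : WithConv (H →ₗ[k] H)) = 1 := by
    apply WithConv.ext
    ext x a
    simp [push, LinearMap.convOne_def, Algebra.algebraMap_eq_smul_one, ha.one_act]
  have hid : IsGL (toConv (LinearMap.id : H →ₗ[k] H)) := ⟨CoalgHom.id k H, rfl⟩
  have h := push_mul_push (E := Module.End k B) act (actL act) LinearMap.id ha.hL
    (CoalgHom.id k H) (sig (toConv LinearMap.id))
  have e : toConv ((LinearMap.id : H →ₗ[k] H) ∘ₗ (CoalgHom.id k H).toLinearMap) *
    sig (toConv LinearMap.id) = 1 := hid.mul_sig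
  rw [e, p1, mul_one] at h
  exact congrArg ofConv h

theorem IsSymPartialAction.teps_eq (ha : IsSymPartialAction act) :
    teps (B := Module.End k B) act = actR act := by
  have p1 : push (B := Module.End k B) act (1 : WithConv (H →ₗ[k] H)) = 1 := by
    apply WithConv.ext
    ext x a
    simp [push, LinearMap.convOne_def, Algebra.algebraMap_eq_smul_one, ha.one_act]
  have hid : IsGL (toConv (LinearMap.id : H →ₗ[k] H)) := ⟨CoalgHom.id k H, rfl⟩
  have h := push_mul_push (E := Module.End k B) act (actR act) (HopfAlgebra.antipode k) ha.hR
    (CoalgHom.id k H) (toConv LinearMap.id)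
  have e : toConv ((HopfAlgebra.antipode k : H →ₗ[k] H) ∘ₗ (CoalgHom.id k H).toLinearMap) *
    toConv LinearMap.id = 1 := hid.sig_mul
  rw [e, p1, mul_one] at h
  exact congrArg ofConv h

theorem IsSymPartialAction.isPartialRep [HasInvertibleAntipode k H]
    (ha : IsSymPartialAction act) : IsPartialRep (B := Module.End k B) act := by
  -- the versions of these in the convolution algebra
  have pL : ∀ {u v : WithConv (H ⊗[k] H →ₗ[k] H)}, IsGL u →
      push (B := Module.End k B) act u * push act v =
        push (B := Module.End k B) (actL act) u * push act (u * v) := by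
    rintro u v ⟨φ, hφ⟩
    have := push_mul_push (E := Module.End k B) act (actL act) LinearMap.id ha.hL φ v
    rw [hφ] at this
    exact this
  have pR : ∀ {u v : WithConv (H ⊗[k] H →ₗ[k] H)}, IsGL u →
      push (B := Module.End k B) act (sig u) * push act v =
        push (B := Module.End k B) (actR act) u * push act (sig u * v) := by
    rintro u v ⟨φ, hφ⟩
    have := push_mul_push (E := Module.End k B) act (actR act) (HopfAlgebra.antipode k) ha.hR φ v
    rw [hφ] at this
    exact this
  have p1 : push (B := Module.End k B) act (1 : WithConv (H ⊗[k] H →ₗ[k] H)) = 1 := by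
    apply WithConv.ext
    ext x y a
    simp [push, LinearMap.convOne_def, Algebra.algebraMap_eq_smul_one, ha.one_act]
  have eL : ∀ {u : WithConv (H ⊗[k] H →ₗ[k] H)}, IsGL u →
      push (B := Module.End k B) act u * push act (sig u) = push (actL act) u := fun hu => by
    rw [pL hu, hu.mul_sig, p1, mul_one]
  have eR : ∀ {u : WithConv (H ⊗[k] H →ₗ[k] H)}, IsGL u →
      push (B := Module.End k B) act (sig u) * push act u = push (actR act) u := fun hu => by
    rw [pR hu, hu.sig_mul, p1, mul_one]
  have one_mul_act : ∀ a : B, conv (act.flip 1) (act.flip a) = act.flip a := fun a => by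
    ext h
    rw [← ha.act_mul, one_mul]; rfl
  have mul_act_one : ∀ a : B, conv (act.flip a) (act.flip 1) = act.flip a := fun a => by
    ext h
    rw [← ha.act_mul, mul_one]; rfl
  refine IsPartialRep.of_eqMod (V := B) LinearMap.id Function.surjective_id act act
    (fun _ => rfl) (by ext a; exact ha.one_act a) ?_ ?_ ?_ ?_
  · refine EqMod.of_eq ?_
    have : push (B := Module.End k B) act (inl k H) * push (actL act) (inr k H) =
        push (actL act) (inl k H * inr k H) * push act (inl k H) := by
      apply WithConv.ext
      refine TensorProduct.ext' fun h g => ?_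
      refine (conv_inl_inr (B := Module.End k B) (actL act) h g act).trans ?_
      rw [inl_mul_inr]
      refine Eq.trans ?_ (conv_inl_right (B := Module.End k B) _ act h g).symm
      ext a
      have e1 : act.flip (act g 1) =
          conv (act.flip 1 ∘ₗ LinearMap.mulRight k g) (act.flip 1) := by
        ext x; exact ha.act_act' x g 1
      change act h (act g 1 * a) = _
      rw [ha.act_mul, e1, conv_assoc, one_mul_act]
      simp only [conv, LinearMap.comp_apply]
      generalize (Coalgebra.comul h : H ⊗[k] H) = t
      induction t with
      | zero => simp
      | tmul a b => simp [actL, Module.End.mul_apply, push]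
      | add x y hx hy => simp only [map_add, hx, hy, LinearMap.add_apply]
    rw [eL isGL_inr, this, pL isGL_inl_mul_inr, mul_assoc, pair_inr.mul, mul_one]
  · refine EqMod.of_eq ?_
    rw [eL isGL_inl, pL isGL_inl, ← mul_assoc, pair_inl.mul, one_mul]
  · refine EqMod.of_eq ?_
    have : push (B := Module.End k B) act (sig (inl k H)) * push (actR act) (inr k H) =
        push (actR act) (inr k H * inl k H) * push act (sig (inl k H)) := by
      apply WithConv.ext
      refine TensorProduct.ext' fun h g => ?_
      refine (conv_inl_inr (B := Module.End k B) (actR act) h g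
        (act ∘ₗ HopfAlgebra.antipode k)).trans ?_
      refine Eq.trans ?_ (conv_inl_right (B := Module.End k B) _
        (act ∘ₗ HopfAlgebra.antipode k) h g).symm
      ext a
      have e1 : act.flip (act (HopfAlgebra.antipode k g) 1) =
          conv (act.flip 1) (act.flip 1 ∘ₗ LinearMap.mulRight k (HopfAlgebra.antipode k g)) := by
        ext x; exact ha.act_act x _ 1
      change act (HopfAlgebra.antipode k h) (a * act (HopfAlgebra.antipode k g) 1) = _
      rw [ha.act_mul, e1, ← conv_assoc, mul_act_one, conv_antipode]
      simp only [conv, LinearMap.comp_apply]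
      generalize (Coalgebra.comul h : H ⊗[k] H) = t
      induction t with
      | zero => simp
      | tmul a b =>
        have e2 : (inr k H * inl k H).ofConv (a ⊗ₜ g) = g * a := inr_mul_inl_tmul a g
        simp [actR, Module.End.mul_apply, push, e2, HopfAlgebra.antipode_mul_antidistrib]
      | add x y hx hy => simp only [map_add, hx, hy, LinearMap.add_apply]
    rw [eR isGL_inr, this, sig_mul_sig', pR isGL_inr_mul_inl, ← sig_mul_sig', mul_assoc,
      pair_inr.symm.mul, mul_one]
  · refine EqMod.of_eq ?_
    rw [eR isGL_inl, pR isGL_inl, ← mul_assoc, pair_inl.symm.mul, one_mul]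

end PartialAction

section UnitObject

open WithConv

variable {k : Type u} [CommRing k] {H : Type u} [Ring H] [HopfAlgebra k H]

section Const

variable {C : Type*} [AddCommGroup C] [Module k C] [Coalgebra k C] {B : Type*} [Ring B]
  [Algebra k B]

/-- The map `c ↦ ε(c) a`. -/
def cst (a : B) : WithConv (C →ₗ[k] B) :=
  toConv (LinearMap.toSpanSingleton k B a ∘ₗ Coalgebra.counit)

theorem cst_mul (a : B) (f : WithConv (C →ₗ[k] B)) :
    cst a * f = toConv (LinearMap.mulLeft k a ∘ₗ f.ofConv) := by
  apply WithConv.ext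
  ext c
  change LinearMap.mul' k B (TensorProduct.map _ _ (Coalgebra.comul c)) = a * f.ofConv c
  have h2 : f.ofConv c = _ := congrArg f.ofConv (TensorProduct.lid k C |>.eq_symm_apply.1
    (Coalgebra.rTensor_counit_comul (R := k) c)).symm
  rw [h2]
  generalize (Coalgebra.comul c : C ⊗[k] C) = t
  induction t with
  | zero => simp
  | tmul x y => simp [cst]
  | add x y hx hy => simp only [map_add, mul_add, hx, hy]

theorem mul_cst (a : B) (f : WithConv (C →ₗ[k] B)) :
    f * cst a = toConv (LinearMap.mulRight k a ∘ₗ f.ofConv) := by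
  apply WithConv.ext
  ext c
  change LinearMap.mul' k B (TensorProduct.map _ _ (Coalgebra.comul c)) = f.ofConv c * a
  have h2 : f.ofConv c = _ := congrArg f.ofConv (TensorProduct.rid k C |>.eq_symm_apply.1
    (Coalgebra.lTensor_counit_comul (R := k) c)).symm
  rw [h2]
  generalize (Coalgebra.comul c : C ⊗[k] C) = t
  induction t with
  | zero => simp
  | tmul x y => simp [cst]
  | add x y hx hy => simp only [map_add, add_mul, hx, hy]

theorem commute_cst {a : B} {f : WithConv (C →ₗ[k] B)} (h : ∀ c, Commute a (f.ofConv c)) :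
    Commute (cst a) f := by
  rw [Commute, SemiconjBy, cst_mul, mul_cst]
  apply WithConv.ext
  ext c
  exact h c

theorem cst_mul_cst (a b : B) : (cst a * cst b : WithConv (C →ₗ[k] B)) = cst (a * b) := by
  rw [cst_mul]
  apply WithConv.ext
  ext c
  simp [cst]

end Const

variable (k H) in
/-- `h · a = [h₁] a [S h₂]` on `H_par`. -/
def adj : H →ₗ[k] Hpar k H →ₗ[k] Hpar k H :=
  conv (B := Module.End k (Hpar k H)) (LinearMap.mul k (Hpar k H) ∘ₗ br k H)
    ((LinearMap.mul k (Hpar k H)).flip ∘ₗ br k H ∘ₗ HopfAlgebra.antipode k)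

theorem adj_flip (a : Hpar k H) : (adj k H).flip a =
    conv (LinearMap.mulRight k a ∘ₗ br k H) (br k H ∘ₗ HopfAlgebra.antipode k) := by
  ext h
  simp only [adj, conv, LinearMap.comp_apply, LinearMap.flip_apply]
  generalize (Coalgebra.comul h : H ⊗[k] H) = t
  induction t with
  | zero => simp
  | tmul x y => simp [Module.End.mul_apply, mul_assoc]
  | add x y hx hy => simp only [map_add, hx, hy, LinearMap.add_apply]

theorem adj_one (h : H) : adj k H h 1 = eps (br k H) h := by
  rw [← LinearMap.flip_apply (adj k H), adj_flip, LinearMap.mulRight_one, eps]; rfl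

theorem push_adj {C : Type*} [AddCommGroup C] [Module k C] [Coalgebra k C]
    {u : WithConv (C →ₗ[k] H)} (hu : IsGL u) (a : Hpar k H) :
    push ((adj k H).flip a) u =
      push (br k H) u * cst a * push (br k H) (sig u) := by
  obtain ⟨φ, hφ⟩ := hu
  rw [mul_cst, push, adj_flip, ← hφ, conv_comp_coalgHom, hφ]
  rfl

theorem commute_teps {a : Hpar k H} [HasInvertibleAntipode k H] (ha : a ∈ baseAlg k H) (g : H) :
    Commute a (teps (br k H) g) := by
  rw [← tgt_eps]; exact commute_tgt ha (eps_mem _)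

variable [HasInvertibleAntipode k H]

theorem commute_cst_push {C : Type*} [AddCommGroup C] [Module k C] [Coalgebra k C]
    {u : WithConv (C →ₗ[k] H)} (hu : IsGL u) {a : Hpar k H} (ha : a ∈ baseAlg k H) :
    Commute (cst a) (push (br k H) (sig u) * push (br k H) u) := by
  rw [push_sig_mul_push _ hu]
  exact commute_cst fun c => commute_teps ha _

theorem adj_mul {C : Type*} [AddCommGroup C] [Module k C] [Coalgebra k C]
    {u : WithConv (C →ₗ[k] H)} (hu : IsGL u) {a : Hpar k H} (ha : a ∈ baseAlg k H)
    (b : Hpar k H) :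
    push ((adj k H).flip (a * b)) u = push ((adj k H).flip a) u * push ((adj k H).flip b) u := by
  rw [push_adj hu, push_adj hu, push_adj hu, ← cst_mul_cst]
  have h1 := (commute_cst_push hu ha).eq
  have h2 := isPartialRep_br.key (π := br k H) (Or.inl ⟨hu, rfl⟩ : InvPair u (sig u))
  calc push (br k H) u * (cst a * cst b) * push (br k H) (sig u)
      = push (br k H) u * push (br k H) (sig u) * push (br k H) u * cst a * cst b *
        push (br k H) (sig u) := by rw [h2]; simp only [mul_assoc]
    _ = push (br k H) u * ((push (br k H) (sig u) * push (br k H) u) * cst a) * cst b *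
        push (br k H) (sig u) := by simp only [mul_assoc]
    _ = _ := by rw [← h1]; simp only [mul_assoc]

theorem adj_mul' {a : Hpar k H} (ha : a ∈ baseAlg k H) (b : Hpar k H) :
    (adj k H).flip (a * b) = conv ((adj k H).flip a) ((adj k H).flip b) := by
  have hid : IsGL (toConv (LinearMap.id : H →ₗ[k] H)) := ⟨CoalgHom.id k H, rfl⟩
  have h := adj_mul hid ha b
  exact congrArg ofConv h

theorem conv_mem (f g : H →ₗ[k] Hpar k H) (hf : ∀ h, f h ∈ baseAlg k H)
    (hg : ∀ h, g h ∈ baseAlg k H) (h : H) : conv f g h ∈ baseAlg k H := by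
  simp only [conv, LinearMap.comp_apply]
  generalize (Coalgebra.comul h : H ⊗[k] H) = t
  induction t with
  | zero => rw [map_zero, map_zero]; exact zero_mem _
  | tmul x y => exact mul_mem (hf x) (hg y)
  | add x y hx hy => rw [map_add, map_add]; exact add_mem hx hy

theorem adj_mem (h : H) {a : Hpar k H} (ha : a ∈ baseAlg k H) : adj k H h a ∈ baseAlg k H := by
  induction ha using Algebra.adjoin_induction generalizing h with
  | mem a ha =>
    obtain ⟨g, rfl⟩ := ha
    have e : LinearMap.mulRight k (eps (br k H) g) ∘ₗ br k H =
        conv (eps (br k H) ∘ₗ LinearMap.mulRight k g) (br k H) := by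
      ext x; exact isPartialRep_br.mul_eps x g
    rw [← LinearMap.flip_apply (adj k H), adj_flip, e, conv_assoc]
    exact conv_mem (eps (br k H) ∘ₗ LinearMap.mulRight k g) (eps (br k H)) (fun _ => eps_mem _)
      (fun _ => eps_mem _) _
  | algebraMap r =>
    rw [Algebra.algebraMap_eq_smul_one, map_smul, adj_one]
    exact Subalgebra.smul_mem _ (eps_mem _) r
  | add x y _ _ hx hy => rw [map_add]; exact add_mem (hx h) (hy h)
  | mul x y hx' _ hx hy =>
    rw [← LinearMap.flip_apply (adj k H), adj_mul' hx']
    exact conv_mem _ _ (fun h => hx h) (fun h => hy h) h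

variable (k H) in
/-- The partial action `h · a = [h₁] a [S h₂]` on the base algebra `A`. -/
def actA : H →ₗ[k] baseAlg k H →ₗ[k] baseAlg k H where
  toFun h := (adj k H h).restrict (p := (baseAlg k H).toSubmodule)
    (q := (baseAlg k H).toSubmodule) fun _ ha => adj_mem h ha
  map_add' x y := by ext a; simp [LinearMap.restrict_apply]
  map_smul' c x := by ext a; simp [LinearMap.restrict_apply]

theorem coe_actA (h : H) (a : baseAlg k H) : (actA k H h a : Hpar k H) = adj k H h a := rfl

theorem coe_conv (f g : H →ₗ[k] baseAlg k H) (h : H) : (conv f g h : Hpar k H) =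
    conv ((baseAlg k H).val.toLinearMap ∘ₗ f) ((baseAlg k H).val.toLinearMap ∘ₗ g) h :=
  algHom_conv (baseAlg k H).val f g h

theorem adj_adj (h g : H) (a : Hpar k H) : adj k H h (adj k H g a) =
    (push (br k H) (inl k H) * (push (br k H) (inr k H) * cst a *
      push (br k H) (sig (inr k H))) * push (br k H) (sig (inl k H))).ofConv (h ⊗ₜ g) := by
  rw [← push_adj isGL_inr]
  refine Eq.trans ?_ (conv_inl_right _ (br k H ∘ₗ HopfAlgebra.antipode k) h g).symm
  rw [← LinearMap.flip_apply (adj k H), adj_flip]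
  congr 2
  ext x
  exact (conv_inl_inr ((adj k H).flip a) x g (br k H)).symm

theorem cst_one : (cst (1 : Hpar k H) : WithConv (H ⊗[k] H →ₗ[k] Hpar k H)) = 1 := by
  apply WithConv.ext
  ext x y
  simp [cst, LinearMap.convOne_def, Algebra.algebraMap_eq_smul_one]

theorem adj_adj_left {a : Hpar k H} (ha : a ∈ baseAlg k H) :
    push (br k H) (inl k H) * (push (br k H) (inr k H) * cst a *
      push (br k H) (sig (inr k H))) * push (br k H) (sig (inl k H)) =
    push ((adj k H).flip 1) (inl k H) * push ((adj k H).flip a) (inl k H * inr k H) := by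
  rw [push_adj isGL_inl, push_adj isGL_inl_mul_inr, ← sig_mul_sig]
  have c := (commute_cst_push (k := k) isGL_inr ha).eq
  have k1 := isPartialRep_br.prB (π := br k H) pair_inl (inl k H * inr k H)
  rw [← mul_assoc (sig (inl k H)), pair_inl.symm.mul, one_mul] at k1
  have k2 := isPartialRep_br.prB (π := br k H) pair_inr.symm
    (sig (inr k H) * sig (inl k H))
  rw [← mul_assoc (inr k H), pair_inr.mul, one_mul] at k2
  have k3 := isPartialRep_br.key (π := br k H) (pair_inr (k := k))
  rw [cst_one, mul_one, ← mul_assoc (push (br k H) (inl k H) * push (br k H) (sig (inl k H))),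
    ← mul_assoc (push (br k H) (inl k H) * push (br k H) (sig (inl k H))), k1]
  symm
  calc _ = push (br k H) (inl k H) * (push (br k H) (inr k H) *
          push (br k H) (sig (inr k H)) * push (br k H) (inr k H)) * cst a *
          push (br k H) (sig (inr k H) * sig (inl k H)) := by rw [k3]
    _ = push (br k H) (inl k H) * push (br k H) (inr k H) *
          ((push (br k H) (sig (inr k H)) * push (br k H) (inr k H)) * cst a) *
          push (br k H) (sig (inr k H) * sig (inl k H)) := by simp only [mul_assoc]
    _ = push (br k H) (inl k H) * push (br k H) (inr k H) * cst a *
          (push (br k H) (sig (inr k H)) * push (br k H) (inr k H) *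
          push (br k H) (sig (inr k H) * sig (inl k H))) := by
        rw [← c]; simp only [mul_assoc]
    _ = _ := by rw [k2]; simp only [mul_assoc]

theorem adj_adj_right {a : Hpar k H} (ha : a ∈ baseAlg k H) :
    push (br k H) (inl k H) * (push (br k H) (inr k H) * cst a *
      push (br k H) (sig (inr k H))) * push (br k H) (sig (inl k H)) =
    push ((adj k H).flip a) (inl k H * inr k H) * push ((adj k H).flip 1) (inl k H) := by
  rw [push_adj isGL_inl, push_adj isGL_inl_mul_inr, ← sig_mul_sig]
  have c := (commute_cst_push (k := k) isGL_inr ha).eq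
  have k1 := isPartialRep_br.prA (π := br k H) pair_inl (sig (inr k H) * sig (inl k H))
  rw [mul_assoc (sig (inr k H)), pair_inl.symm.mul, mul_one] at k1
  have k2 := isPartialRep_br.prA (π := br k H) pair_inr.symm (inl k H * inr k H)
  rw [mul_assoc (inl k H), pair_inr.mul, mul_one] at k2
  have k3 := isPartialRep_br.key (π := br k H) (pair_inr (k := k)).symm
  rw [cst_one, mul_one, mul_assoc (push (br k H) (inl k H * inr k H) * cst a), k1]
  symm
  calc _ = push (br k H) (inl k H * inr k H) * cst a * (push (br k H) (sig (inr k H)) *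
          push (br k H) (inr k H) * push (br k H) (sig (inr k H)) *
          push (br k H) (sig (inl k H))) := by rw [k3]
    _ = push (br k H) (inl k H * inr k H) * (cst a * (push (br k H) (sig (inr k H)) *
          push (br k H) (inr k H))) * (push (br k H) (sig (inr k H)) *
          push (br k H) (sig (inl k H))) := by simp only [mul_assoc]
    _ = push (br k H) (inl k H * inr k H) * (push (br k H) (sig (inr k H)) *
          push (br k H) (inr k H)) * cst a * (push (br k H) (sig (inr k H)) *
          push (br k H) (sig (inl k H))) := by
        rw [c]; simp only [mul_assoc]
    _ = _ := by rw [k2]; simp only [mul_assoc]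

theorem isSymPartialAction_actA : IsSymPartialAction (actA k H) where
  one_act a := by
    apply Subtype.ext
    rw [coe_actA, ← LinearMap.flip_apply (adj k H), adj_flip]
    simp [conv, Algebra.TensorProduct.one_def, isPartialRep_br.pr1]
  act_mul h a b := by
    apply Subtype.ext
    rw [coe_conv]
    exact LinearMap.congr_fun (adj_mul' a.2 (b : Hpar k H)) h
  act_act h g a := by
    apply Subtype.ext
    rw [coe_actA, coe_actA, adj_adj, adj_adj_left a.2, coe_conv, inl_mul_inr]
    exact conv_inl_left _ ((adj k H).flip 1) h g
  act_act' h g a := by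
    apply Subtype.ext
    rw [coe_actA, coe_actA, adj_adj, adj_adj_right a.2, coe_conv, inl_mul_inr]
    exact conv_inl_right _ ((adj k H).flip 1) h g

theorem isPartialRep_actA : IsPartialRep (B := Module.End k (baseAlg k H)) (actA k H) :=
  isSymPartialAction_actA.isPartialRep

variable (k H) in
/-- The unit object: the base algebra `A` with the action `[h] • a = [h₁] a [S h₂]`. -/
def unitObj : ModuleCat.{u} (Hpar k H) :=
  letI : Module (Hpar k H) (baseAlg k H) :=
    Module.compHom _ (Hpar.lift (B := Module.End k (baseAlg k H)) (actA k H)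
      isPartialRep_actA).toRingHom
  ModuleCat.of (Hpar k H) (baseAlg k H)

variable (k H) in
/-- The underlying additive group of the unit object is `A`. -/
def unitEquiv : baseAlg k H ≃+ unitObj k H := AddEquiv.refl _

theorem smul_unitEquiv (x : Hpar k H) (a : baseAlg k H) : x • unitEquiv k H a =
    unitEquiv k H (Hpar.lift (B := Module.End k (baseAlg k H)) (actA k H)
      isPartialRep_actA x a) := rfl

theorem br_smul_unit (h : H) (a : baseAlg k H) :
    br k H h • unitEquiv k H a = unitEquiv k H (actA k H h a) := by
  rw [smul_unitEquiv, Hpar.lift_br]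

theorem lift_actA_comp : (Hpar.lift (B := Module.End k (baseAlg k H)) (actA k H)
    isPartialRep_actA).toLinearMap ∘ₗ br k H = actA k H := by ext1 h; simp

theorem base_smul_unit (b : baseAlg k H) (a : baseAlg k H) :
    (b : Hpar k H) • unitEquiv k H a = unitEquiv k H (b * a) := by
  obtain ⟨b, hb⟩ := b
  induction hb using Algebra.adjoin_induction generalizing a with
  | mem b hb =>
    obtain ⟨g, rfl⟩ := hb
    have e : Hpar.lift (B := Module.End k (baseAlg k H)) (actA k H) isPartialRep_actA
        (eps (br k H) g) = eps (B := Module.End k (baseAlg k H)) (actA k H) g := by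
      rw [eps, algHom_conv, ← LinearMap.comp_assoc, lift_actA_comp]; rfl
    rw [smul_unitEquiv, e]
    have := LinearMap.congr_fun (LinearMap.congr_fun
      (isSymPartialAction_actA (k := k) (H := H)).eps_eq g) a
    refine congrArg (unitEquiv k H) (this.trans ?_)
    apply Subtype.ext
    change adj k H g 1 * (a : Hpar k H) = _
    rw [adj_one]
    rfl
  | algebraMap r =>
    rw [smul_unitEquiv, AlgHom.commutes]
    congr 1
  | add x y hx' hy' hx hy =>
    have h1 := hx a
    have h2 := hy a
    simp only [add_smul] at h1 h2 ⊢
    rw [h1, h2, ← map_add, ← add_mul]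
    rfl
  | mul x y hx' hy' hx hy =>
    have h2 := hy a
    simp only [mul_smul] at h2 ⊢
    rw [h2]
    refine (hx _).trans ?_
    rw [← mul_assoc]
    rfl

theorem tgt_smul_unit (b : baseAlg k H) (a : baseAlg k H) :
    tgt (b : Hpar k H) • unitEquiv k H a = unitEquiv k H (a * b) := by
  obtain ⟨b, hb⟩ := b
  induction hb using Algebra.adjoin_induction generalizing a with
  | mem b hb =>
    obtain ⟨g, rfl⟩ := hb
    obtain ⟨g, rfl⟩ := antipode_surjective (k := k) g
    simp only [tgt_eps]
    rw [smul_unitEquiv, teps, algHom_conv, ← LinearMap.comp_assoc, lift_actA_comp]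
    have := LinearMap.congr_fun (LinearMap.congr_fun
      (isSymPartialAction_actA (k := k) (H := H)).teps_eq g) a
    refine congrArg (unitEquiv k H) (this.trans ?_)
    apply Subtype.ext
    change (a : Hpar k H) * adj k H (HopfAlgebra.antipode k g) 1 = _
    rw [adj_one]
    rfl
  | algebraMap r =>
    simp only [tgt_algebraMap]
    rw [smul_unitEquiv, AlgHom.commutes]
    congr 1
    apply Subtype.ext
    simp [Algebra.smul_def, Algebra.commutes]
  | add x y hx' hy' hx hy =>
    have h1 := hx a
    have h2 := hy a
    simp only [tgt_add, add_smul] at h1 h2 ⊢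
    rw [h1, h2, ← map_add, ← mul_add]
    rfl
  | mul x y hx' hy' hx hy =>
    have h1 := hx a
    simp only [tgt_mul, mul_smul] at h1 ⊢
    rw [h1]
    refine (hy _).trans ?_
    rw [mul_assoc]
    rfl

/-- `Σ (h₁ · a) [h₂] = [h] a` -/
theorem conv_adj_br {a : Hpar k H} (ha : a ∈ baseAlg k H) (h : H) :
    conv ((adj k H).flip a) (br k H) h = br k H h * a := by
  have hid : IsGL (toConv (LinearMap.id : H →ₗ[k] H)) := ⟨CoalgHom.id k H, rfl⟩
  set U := push (br k H) (toConv (LinearMap.id : H →ₗ[k] H)) with hU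
  set V := push (br k H) (sig (toConv (LinearMap.id : H →ₗ[k] H))) with hV
  have e : push ((adj k H).flip a) (toConv LinearMap.id) * U = U * cst a := by
    rw [push_adj hid, ← hU, ← hV]
    have h1 : cst a * (V * U) = V * U * cst a := (commute_cst_push hid ha).eq
    have h2 : U * V * U = U := isPartialRep_br.key (Or.inl ⟨hid, rfl⟩)
    rw [mul_assoc, mul_assoc, h1, ← mul_assoc, ← mul_assoc, h2]
  rw [mul_cst] at e
  exact LinearMap.congr_fun (congrArg ofConv e) h

variable (k H) in
/-- `t` as a `k`-linear map. -/
def tgtL : Hpar k H →ₗ[k] Hpar k H :=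
  (MulOpposite.opLinearEquiv k).symm.toLinearMap ∘ₗ (opAntipode k H).toLinearMap

theorem tgtL_apply (x : Hpar k H) : tgtL k H x = tgt x := rfl

theorem tgtL_conv_antipode (f g : H →ₗ[k] Hpar k H) :
    tgtL k H ∘ₗ conv f g ∘ₗ HopfAlgebra.antipode k =
      conv (tgtL k H ∘ₗ g ∘ₗ HopfAlgebra.antipode k)
        (tgtL k H ∘ₗ f ∘ₗ HopfAlgebra.antipode k) := by
  ext x
  rw [LinearMap.comp_apply, LinearMap.comp_apply, conv_antipode]
  simp only [conv, LinearMap.comp_apply]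
  generalize (Coalgebra.comul x : H ⊗[k] H) = t
  induction t with
  | zero => simp
  | tmul a b => simp [tgtL_apply, tgt_mul]
  | add x y hx hy => simp only [map_add, hx, hy]

theorem conv_mulRight (f g : H →ₗ[k] Hpar k H) (a : Hpar k H) :
    conv f (LinearMap.mulRight k a ∘ₗ g) = LinearMap.mulRight k a ∘ₗ conv f g := by
  ext x
  simp only [conv, LinearMap.comp_apply]
  generalize (Coalgebra.comul x : H ⊗[k] H) = t
  induction t with
  | zero => simp
  | tmul a b => simp [mul_assoc]
  | add x y hx hy => simp only [map_add, hx, hy]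

/-- `Σ t(h₂ · a) [h₁] = [h] t(a)` -/
theorem mul_tgt {a : Hpar k H} (ha : a ∈ baseAlg k H) (h : H) :
    LinearMap.mul' k _ (TensorProduct.comm k _ _ (TensorProduct.map (br k H)
      (tgtL k H ∘ₗ (adj k H).flip a) (Coalgebra.comul h))) = br k H h * tgt a := by
  obtain ⟨g, rfl⟩ := antipode_surjective (k := k) h
  have e : conv (tgtL k H ∘ₗ (adj k H).flip a ∘ₗ HopfAlgebra.antipode k)
      (br k H ∘ₗ HopfAlgebra.antipode k) = LinearMap.mulRight k (tgt a) ∘ₗ br k H ∘ₗ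
        HopfAlgebra.antipode k := by
    induction ha using Algebra.adjoin_induction with
    | mem a ha =>
      obtain ⟨x, rfl⟩ := ha
      obtain ⟨y, rfl⟩ := antipode_surjective (k := k) x
      have e0 : (adj k H).flip (eps (br k H) (HopfAlgebra.antipode k y)) =
          conv (eps (br k H) ∘ₗ LinearMap.mulRight k (HopfAlgebra.antipode k y))
            (eps (br k H)) := by
        have e : LinearMap.mulRight k (eps (br k H) (HopfAlgebra.antipode k y)) ∘ₗ br k H =
            conv (eps (br k H) ∘ₗ LinearMap.mulRight k (HopfAlgebra.antipode k y))
              (br k H) := by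
          ext x; exact isPartialRep_br.mul_eps x _
        rw [adj_flip, e, conv_assoc]
        rfl
      have e1 : tgtL k H ∘ₗ eps (br k H) ∘ₗ HopfAlgebra.antipode k = teps (br k H) := by
        ext x; exact tgt_eps x
      have e2 : tgtL k H ∘ₗ (eps (br k H) ∘ₗ LinearMap.mulRight k (HopfAlgebra.antipode k y)) ∘ₗ
          HopfAlgebra.antipode k = teps (br k H) ∘ₗ LinearMap.mulLeft k y := by
        ext x
        refine Eq.trans ?_ (tgt_eps (y * x))
        simp [tgtL_apply, HopfAlgebra.antipode_mul_antidistrib]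
      have e3 : conv (teps (br k H) ∘ₗ LinearMap.mulLeft k y)
          (br k H ∘ₗ HopfAlgebra.antipode k) = LinearMap.mulRight k (teps (br k H) y) ∘ₗ
            br k H ∘ₗ HopfAlgebra.antipode k := by
        ext x; exact (isPartialRep_br.mul_teps x y).symm
      rw [e0, tgtL_conv_antipode, e1, e2, conv_assoc, e3, conv_mulRight,
        isPartialRep_br.teps_key, tgt_eps]
    | algebraMap r =>
      have e0 : tgtL k H ∘ₗ (adj k H).flip (algebraMap k _ r) ∘ₗ HopfAlgebra.antipode k =
          r • teps (br k H) := by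
        ext x
        simp only [LinearMap.comp_apply, LinearMap.flip_apply, LinearMap.smul_apply]
        rw [Algebra.algebraMap_eq_smul_one, map_smul, map_smul, adj_one, tgtL_apply, tgt_eps]
      have e1 : conv (r • teps (br k H)) (br k H ∘ₗ HopfAlgebra.antipode k) =
          r • conv (teps (br k H)) (br k H ∘ₗ HopfAlgebra.antipode k) := by
        ext x; simp [conv, TensorProduct.map_smul_left]
      rw [e0, e1, isPartialRep_br.teps_key, tgt_algebraMap]
      ext x
      simp [Algebra.smul_def, Algebra.commutes]
    | add x y _ _ hx hy =>
      have e0 : tgtL k H ∘ₗ (adj k H).flip (x + y) ∘ₗ HopfAlgebra.antipode k =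
          tgtL k H ∘ₗ (adj k H).flip x ∘ₗ HopfAlgebra.antipode k +
          tgtL k H ∘ₗ (adj k H).flip y ∘ₗ HopfAlgebra.antipode k := by
        ext z; simp
      have e1 : ∀ f g h : H →ₗ[k] Hpar k H, conv (f + g) h = conv f h + conv g h :=
        fun f g h => by ext x; simp [conv, TensorProduct.map_add_left]
      rw [e0, e1, hx, hy, tgt_add]
      ext z
      simp [mul_add]
    | mul x y hx' _ hx hy =>
      rw [adj_mul' hx', tgtL_conv_antipode, conv_assoc, hx, conv_mulRight, hy, tgt_mul]
      ext z
      simp [mul_assoc]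
  refine Eq.trans ?_ (LinearMap.congr_fun e g)
  rw [comul_antipode]
  simp only [conv, LinearMap.comp_apply]
  generalize (Coalgebra.comul g : H ⊗[k] H) = t
  induction t with
  | zero => simp
  | tmul a b => simp
  | add x y hx hy => simp only [map_add, hx, hy]

end UnitObject

section Monoidal

open Coalgebra MonoidalCategory

variable {k : Type u} [CommRing k] {H : Type u} [Ring H] [HopfAlgebra k H]
  [HasInvertibleAntipode k H] {M N P M' N' P' X : ModuleCat.{u} (Hpar k H)}

theorem br_comm_of_tmul (F : tens M N →+ X)
    (hF : ∀ h m n, F (br k H h • tmul m n) = br k H h • F (tmul m n)) (h : H) (z : tens M N) :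
    F (br k H h • z) = br k H h • F z := by
  induction z using tens.induction with
  | h m n => exact hF h m n
  | hadd x y hx hy => rw [smul_add, map_add, map_add, smul_add, hx, hy]

/-- `(m, n) ↦ f m ⊗ g n` -/
def tensHomAux (f : M ⟶ M') (g : N ⟶ N') : M →+ N →+ tens M' N' :=
  AddMonoidHom.mk' (fun m => AddMonoidHom.mk' (fun n => tmul (f m) (g n))
    (fun n n' => by rw [map_add, tmul_add])) (fun m m' => by
      ext n
      change tmul (f (m + m')) (g n) = tmul (f m) (g n) + tmul (f m') (g n)
      rw [map_add, add_tmul])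

/-- The tensor product `f ⊗_A g` of two morphisms. -/
def tensHom (f : M ⟶ M') (g : N ⟶ N') : tens M N ⟶ tens M' N' :=
  homOfAdd (tens.lift (tensHomAux f g) fun a ha m n => by
    change tmul (f (tgt a • m)) (g n) = tmul (f m) (g (a • n))
    rw [map_smul, map_smul, tgt_smul_tmul ha]) (br_comm_of_tmul _ fun h m n => by
    rw [br_smul_tmul h (ℛ k h), map_sum, tens.lift_tmul]
    change _ = br k H h • tmul (f m) (g n)
    rw [br_smul_tmul h (ℛ k h)]
    refine Finset.sum_congr rfl fun i _ => ?_
    rw [tens.lift_tmul]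
    change tmul (f (_ • m)) (g (_ • n)) = _
    rw [map_smul, map_smul])

@[simp] theorem tensHom_tmul (f : M ⟶ M') (g : N ⟶ N') (m : M) (n : N) :
    tensHom f g (tmul m n) = tmul (f m) (g n) := by
  rw [tensHom, homOfAdd_apply, tens.lift_tmul]; rfl

/-- An isomorphism from a morphism and a set-theoretic inverse. -/
def isoOfInv (f : M ⟶ N) (g : N → M) (h1 : ∀ m, g (f m) = m) (h2 : ∀ n, f (g n) = n) : M ≅ N :=
  LinearEquiv.toModuleIso { f.hom with invFun := g, left_inv := h1, right_inv := h2 }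

@[simp] theorem isoOfInv_hom (f : M ⟶ N) (g : N → M) (h1 : ∀ m, g (f m) = m)
    (h2 : ∀ n, f (g n) = n) : (isoOfInv f g h1 h2).hom = f := rfl

/-- `(m, n, p) ↦ m ⊗ (n ⊗ p)` -/
def assocAux : M →+ N →+ P →+ tens M (tens N P) :=
  AddMonoidHom.mk' (fun m => AddMonoidHom.mk' (fun n => AddMonoidHom.mk'
    (fun p => tmul m (tmul n p))
    (fun p p' => by rw [tmul_add, tmul_add]))
    (fun n n' => by
      ext p
      change tmul m (tmul (n + n') p) = tmul m (tmul n p) + tmul m (tmul n' p)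
      rw [add_tmul, tmul_add]))
    (fun m m' => by
      ext n p
      change tmul (m + m') (tmul n p) = tmul m (tmul n p) + tmul m' (tmul n p)
      rw [add_tmul])

/-- `(m ⊗ n, p) ↦ m ⊗ (n ⊗ p)` -/
def assocAux' : tens M N →+ P →+ tens M (tens N P) :=
  tens.lift assocAux fun a ha m n => by
    ext p
    change tmul (tgt a • m) (tmul n p) = tmul m (tmul (a • n) p)
    rw [tgt_smul_tmul ha, base_smul_tmul ha]

theorem assocAux'_tmul (m : M) (n : N) (p : P) :
    assocAux' (tmul m n) p = tmul m (tmul n p) := by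
  rw [assocAux', tens.lift_tmul]; rfl

theorem tens.induction₃ {p : tens (tens M N) P → Prop} (h : ∀ m n x, p (tmul (tmul m n) x))
    (hadd : ∀ x y, p x → p y → p (x + y)) (z : tens (tens M N) P) : p z := by
  induction z using tens.induction with
  | h m n =>
    induction m using tens.induction with
    | h a b => exact h a b n
    | hadd x y hx hy => rw [add_tmul]; exact hadd _ _ hx hy
  | hadd x y hx hy => exact hadd _ _ hx hy

theorem tens.induction₃' {p : tens M (tens N P) → Prop} (h : ∀ m n x, p (tmul m (tmul n x)))
    (hadd : ∀ x y, p x → p y → p (x + y)) (z : tens M (tens N P)) : p z := by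
  induction z using tens.induction with
  | h m n =>
    induction n using tens.induction with
    | h a b => exact h m a b
    | hadd x y hx hy => rw [tmul_add]; exact hadd _ _ hx hy
  | hadd x y hx hy => exact hadd _ _ hx hy

variable (M N P) in
/-- The additive map `(m ⊗ n) ⊗ p ↦ m ⊗ (n ⊗ p)`. -/
def assocAdd : tens (tens M N) P →+ tens M (tens N P) :=
  tens.lift assocAux' fun a ha z p => by
    induction z using tens.induction with
    | h m n =>
      rw [tgt_smul_tmul' ha, assocAux'_tmul, assocAux'_tmul, tgt_smul_tmul ha]
    | hadd x y hx hy => rw [smul_add, map_add, map_add, AddMonoidHom.add_apply,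
        AddMonoidHom.add_apply, hx, hy]

theorem assocAdd_tmul (m : M) (n : N) (p : P) :
    assocAdd M N P (tmul (tmul m n) p) = tmul m (tmul n p) := by
  rw [assocAdd, tens.lift_tmul, assocAux'_tmul]

/-- `h ↦ [h] m` -/
def brMap (m : M) : H →ₗ[k] M := (lin M).toLinearMap.flip m ∘ₗ br k H

theorem brMap_apply (m : M) (h : H) : brMap m h = br k H h • m := rfl

theorem assocAdd_br (h : H) (z : tens (tens M N) P) :
    assocAdd M N P (br k H h • z) = br k H h • assocAdd M N P z := by
  induction z using tens.induction₃ with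
  | h m n p =>
    let Φ : H ⊗[k] (H ⊗[k] H) →ₗ[k] tens M (tens N P) :=
      TensorProduct.lift ((tmulL M (tens N P)).compl₁₂ (brMap m)
        (TensorProduct.lift ((tmulL N P).compl₁₂ (brMap n) (brMap p))))
    have e := congrArg Φ (Coalgebra.sum_tmul_tmul_eq (ℛ k h) (fun i => ℛ k ((ℛ k h).left i))
      (fun i => ℛ k ((ℛ k h).right i)))
    rw [assocAdd_tmul, br_smul_tmul h (ℛ k h), br_smul_tmul h (ℛ k h), map_sum]
    have e1 : ∀ x y z, Φ (x ⊗ₜ (y ⊗ₜ z)) =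
      tmul (br k H x • m) (tmul (br k H y • n) (br k H z • p)) := fun _ _ _ => rfl
    simp only [map_sum, e1] at e
    refine Eq.trans (Finset.sum_congr rfl fun i _ => ?_) (e.trans
      (Finset.sum_congr rfl fun i _ => ?_))
    · rw [br_smul_tmul _ (ℛ k ((ℛ k h).left i))]
      have : ∀ (s : Finset (H × H)) (f : H × H → tens M N) (y : P),
          tmul (∑ j ∈ s, f j) y = ∑ j ∈ s, tmul (f j) y := fun s f y =>
        map_sum ((tmulL (tens M N) P).flip y) f s
      rw [this, map_sum]
      exact Finset.sum_congr rfl fun j _ => assocAdd_tmul _ _ _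
    · rw [br_smul_tmul _ (ℛ k ((ℛ k h).right i))]
      exact (map_sum (tmulL M (tens N P) _) _ _).symm
  | hadd x y hx hy => rw [smul_add, map_add, map_add, smul_add, hx, hy]

/-- `(n, p) ↦ (m ⊗ n) ⊗ p` -/
def assocInvAux (m : M) : N →+ P →+ tens (tens M N) P :=
  AddMonoidHom.mk' (fun n => AddMonoidHom.mk' (fun p => tmul (tmul m n) p)
    (fun p p' => by rw [tmul_add]))
    (fun n n' => by
      ext p
      change tmul (tmul m (n + n')) p = tmul (tmul m n) p + tmul (tmul m n') p
      rw [tmul_add, add_tmul])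

/-- `n ⊗ p ↦ (m ⊗ n) ⊗ p` -/
def assocInvAux' (m : M) : tens N P →+ tens (tens M N) P :=
  tens.lift (assocInvAux m) fun a ha n p => by
    change tmul (tmul m (tgt a • n)) p = tmul (tmul m n) (a • p)
    rw [← tgt_smul_tmul' ha, tgt_smul_tmul ha]

theorem assocInvAux'_tmul (m : M) (n : N) (p : P) :
    assocInvAux' m (tmul n p) = tmul (tmul m n) p := by
  rw [assocInvAux', tens.lift_tmul]; rfl

theorem assocInvAux'_add (m m' : M) (z : tens N P) :
    assocInvAux' (m + m') z = assocInvAux' m z + assocInvAux' m' z := by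
  induction z using tens.induction with
  | h n p => rw [assocInvAux'_tmul, assocInvAux'_tmul, assocInvAux'_tmul, add_tmul, add_tmul]
  | hadd x y hx hy => rw [map_add, map_add, map_add, hx, hy]; abel

variable (M N P) in
/-- The additive map `m ⊗ (n ⊗ p) ↦ (m ⊗ n) ⊗ p`. -/
def assocInv : tens M (tens N P) →+ tens (tens M N) P :=
  tens.lift (AddMonoidHom.mk' assocInvAux' fun m m' => by
    ext z; exact assocInvAux'_add m m' z) fun a ha m z => by
    change assocInvAux' (tgt a • m) z = assocInvAux' m (a • z)
    induction z using tens.induction with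
    | h n p => rw [assocInvAux'_tmul, base_smul_tmul ha, assocInvAux'_tmul, tgt_smul_tmul ha]
    | hadd x y hx hy => rw [smul_add, map_add, map_add, hx, hy]

theorem assocInv_tmul (m : M) (n : N) (p : P) :
    assocInv M N P (tmul m (tmul n p)) = tmul (tmul m n) p := by
  rw [assocInv, tens.lift_tmul]
  exact assocInvAux'_tmul m n p

variable (M N P) in
/-- The associator `(m ⊗ n) ⊗ p ↦ m ⊗ (n ⊗ p)`. -/
def assocIso : tens (tens M N) P ≅ tens M (tens N P) :=
  isoOfInv (homOfAdd (assocAdd M N P) assocAdd_br) (assocInv M N P)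
    (fun z => by
      rw [homOfAdd_apply]
      induction z using tens.induction₃ with
      | h m n p => rw [assocAdd_tmul, assocInv_tmul]
      | hadd x y hx hy => rw [map_add, map_add, hx, hy])
    (fun z => by
      rw [homOfAdd_apply]
      induction z using tens.induction₃' with
      | h m n p => rw [assocInv_tmul, assocAdd_tmul]
      | hadd x y hx hy => rw [map_add, map_add, hx, hy])

@[simp] theorem assocIso_tmul (m : M) (n : N) (p : P) :
    (assocIso M N P).hom (tmul (tmul m n) p) = tmul m (tmul n p) := assocAdd_tmul m n p

variable (M) in
/-- The additive map `a ⊗ m ↦ a m`. -/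
def lunitAdd : tens (unitObj k H) M →+ M :=
  tens.lift (AddMonoidHom.mk' (fun a => AddMonoidHom.mk'
    (fun m => ((unitEquiv k H).symm a : Hpar k H) • m) fun m m' => smul_add _ _ _) fun a a' => by
      ext m
      change ((unitEquiv k H).symm (a + a') : Hpar k H) • m = _
      rw [map_add]
      exact add_smul _ _ _) fun b hb a m => by
      obtain ⟨a, rfl⟩ := (unitEquiv k H).surjective a
      change ((unitEquiv k H).symm (tgt b • unitEquiv k H a) : Hpar k H) • m =
        ((unitEquiv k H).symm (unitEquiv k H a) : Hpar k H) • (b • m)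
      rw [tgt_smul_unit ⟨b, hb⟩ a, AddEquiv.symm_apply_apply, AddEquiv.symm_apply_apply, ← mul_smul]
      rfl

theorem lunitAdd_tmul (a : baseAlg k H) (m : M) :
    lunitAdd M (tmul (unitEquiv k H a) m) = (a : Hpar k H) • m := by
  rw [lunitAdd, tens.lift_tmul]; rfl

theorem conv_repr {B : Type*} [Ring B] [Algebra k B] (f g : H →ₗ[k] B) (h : H) :
    conv f g h = ∑ i ∈ (ℛ k h).index, f ((ℛ k h).left i) * g ((ℛ k h).right i) := by
  rw [conv, LinearMap.comp_apply, LinearMap.comp_apply, ← (ℛ k h).eq]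
  simp

theorem lunitAdd_br (h : H) (z : tens (unitObj k H) M) :
    lunitAdd M (br k H h • z) = br k H h • lunitAdd M z := by
  refine br_comm_of_tmul (lunitAdd M) (fun h a m => ?_) h z
  obtain ⟨a, rfl⟩ := (unitEquiv k H).surjective a
  rw [br_smul_tmul h (ℛ k h), lunitAdd_tmul, ← mul_smul, ← conv_adj_br a.2, conv_repr,
    Finset.sum_smul, map_sum]
  refine Finset.sum_congr rfl fun i _ => ?_
  rw [br_smul_unit, lunitAdd_tmul, mul_smul]
  rfl

theorem lunit_inv (a : baseAlg k H) (m : M) :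
    tmul (unitEquiv k H 1) ((a : Hpar k H) • m) = tmul (unitEquiv k H a) m := by
  rw [← tgt_smul_tmul a.2, tgt_smul_unit, one_mul]

variable (M) in
/-- The left unitor `a ⊗ m ↦ a m`. -/
def lunitIso : tens (unitObj k H) M ≅ M :=
  isoOfInv (homOfAdd (lunitAdd M) lunitAdd_br) (fun m => tmul (unitEquiv k H 1) m)
    (fun z => by
      rw [homOfAdd_apply]
      induction z using tens.induction with
      | h a m =>
        obtain ⟨a, rfl⟩ := (unitEquiv k H).surjective a
        rw [lunitAdd_tmul, lunit_inv]
      | hadd x y hx hy => rw [map_add, tmul_add, hx, hy])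
    (fun m => by rw [homOfAdd_apply, lunitAdd_tmul]; exact one_smul _ m)

@[simp] theorem lunitIso_tmul (a : baseAlg k H) (m : M) :
    (lunitIso M).hom (tmul (unitEquiv k H a) m) = (a : Hpar k H) • m := lunitAdd_tmul a m

variable (M) in
/-- The additive map `m ⊗ a ↦ m a = t(a) m`. -/
def runitAdd : tens M (unitObj k H) →+ M :=
  tens.lift (AddMonoidHom.mk' (fun m => AddMonoidHom.mk'
    (fun a => tgt ((unitEquiv k H).symm a : Hpar k H) • m) fun a a' => by
      rw [map_add]
      exact (congrArg (· • m) (tgt_add _ _)).trans (add_smul _ _ _)) fun m m' => by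
      ext a
      exact smul_add _ _ _) fun b hb m a => by
      obtain ⟨a, rfl⟩ := (unitEquiv k H).surjective a
      change tgt ((unitEquiv k H).symm (unitEquiv k H a) : Hpar k H) • (tgt b • m) =
        tgt ((unitEquiv k H).symm (b • unitEquiv k H a) : Hpar k H) • m
      rw [base_smul_unit ⟨b, hb⟩ a, AddEquiv.symm_apply_apply, AddEquiv.symm_apply_apply, ← mul_smul,
        ← tgt_mul]
      rfl

theorem runitAdd_tmul (m : M) (a : baseAlg k H) :
    runitAdd M (tmul m (unitEquiv k H a)) = tgt (a : Hpar k H) • m := by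
  rw [runitAdd, tens.lift_tmul]; rfl

theorem runitAdd_br (h : H) (z : tens M (unitObj k H)) :
    runitAdd M (br k H h • z) = br k H h • runitAdd M z := by
  refine br_comm_of_tmul (runitAdd M) (fun h m a => ?_) h z
  obtain ⟨a, rfl⟩ := (unitEquiv k H).surjective a
  rw [br_smul_tmul h (ℛ k h), runitAdd_tmul, ← mul_smul, ← mul_tgt a.2, ← (ℛ k h).eq,
    map_sum, map_sum, map_sum, map_sum, Finset.sum_smul]
  refine Finset.sum_congr rfl fun i _ => ?_
  rw [br_smul_unit, runitAdd_tmul, ← mul_smul]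
  rfl

theorem runit_inv (a : baseAlg k H) (m : M) :
    tmul (tgt (a : Hpar k H) • m) (unitEquiv k H 1) = tmul m (unitEquiv k H a) := by
  rw [tgt_smul_tmul a.2, base_smul_unit, mul_one]

variable (M) in
/-- The right unitor `m ⊗ a ↦ m a`. -/
def runitIso : tens M (unitObj k H) ≅ M :=
  isoOfInv (homOfAdd (runitAdd M) runitAdd_br) (fun m => tmul m (unitEquiv k H 1))
    (fun z => by
      rw [homOfAdd_apply]
      induction z using tens.induction with
      | h m a =>
        obtain ⟨a, rfl⟩ := (unitEquiv k H).surjective a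
        rw [runitAdd_tmul, runit_inv]
      | hadd x y hx hy => rw [map_add, add_tmul, hx, hy])
    (fun m => by
      rw [homOfAdd_apply, runitAdd_tmul]
      exact (congrArg (· • m) tgt_one).trans (one_smul _ m))

@[simp] theorem runitIso_tmul (m : M) (a : baseAlg k H) :
    (runitIso M).hom (tmul m (unitEquiv k H a)) = tgt (a : Hpar k H) • m := runitAdd_tmul m a

theorem tens.hom_ext₃ {f g : tens (tens M N) P ⟶ X}
    (h : ∀ m n p, f (tmul (tmul m n) p) = g (tmul (tmul m n) p)) : f = g := by
  ext z
  induction z using tens.induction₃ with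
  | h m n p => exact h m n p
  | hadd x y hx hy => rw [map_add, map_add, hx, hy]

/-- The tensor product `⊗_A` on the category of `H_par`-modules (partial `H`-modules). -/
instance monoidalStruct : MonoidalCategoryStruct (ModuleCat.{u} (Hpar k H)) where
  tensorObj M N := tens M N
  whiskerLeft M _ _ f := tensHom (𝟙 M) f
  whiskerRight f N := tensHom f (𝟙 N)
  tensorHom f g := tensHom f g
  tensorUnit := unitObj k H
  associator := assocIso
  leftUnitor := lunitIso
  rightUnitor := runitIso

/-- The monoidal category of `H_par`-modules (partial `H`-modules) with `⊗_A` and unit `A`. -/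
instance monoidal : MonoidalCategory (ModuleCat.{u} (Hpar k H)) :=
  MonoidalCategory.ofTensorHom
    (id_tensorHom_id := fun M N => tens.hom_ext fun m n => tensHom_tmul (𝟙 M) (𝟙 N) m n)
    (id_tensorHom := fun _ _ _ _ => rfl)
    (tensorHom_id := fun _ _ => rfl)
    (tensorHom_comp_tensorHom := fun f₁ f₂ g₁ g₂ => tens.hom_ext fun m n => by
      change tensHom g₁ g₂ (tensHom f₁ f₂ (tmul m n)) = tensHom (f₁ ≫ g₁) (f₂ ≫ g₂) (tmul m n)
      rw [tensHom_tmul, tensHom_tmul, tensHom_tmul]; rfl)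
    (associator_naturality := fun {X₁ X₂ X₃ Y₁ Y₂ Y₃} f₁ f₂ f₃ => tens.hom_ext₃ fun m n p => by
      change (assocIso Y₁ Y₂ Y₃).hom (tensHom (tensHom f₁ f₂) f₃ (tmul (tmul m n) p)) =
        tensHom f₁ (tensHom f₂ f₃) ((assocIso X₁ X₂ X₃).hom (tmul (tmul m n) p))
      rw [tensHom_tmul, tensHom_tmul, assocIso_tmul, assocIso_tmul, tensHom_tmul, tensHom_tmul])
    (leftUnitor_naturality := fun {X Y} f => tens.hom_ext fun a m => by
      obtain ⟨a, rfl⟩ := (unitEquiv k H).surjective a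
      change (lunitIso Y).hom (tensHom (𝟙 (unitObj k H)) f (tmul (unitEquiv k H a) m)) =
        f ((lunitIso X).hom (tmul (unitEquiv k H a) m))
      rw [tensHom_tmul, lunitIso_tmul, ModuleCat.id_apply, lunitIso_tmul, map_smul])
    (rightUnitor_naturality := fun {X Y} f => tens.hom_ext fun m a => by
      obtain ⟨a, rfl⟩ := (unitEquiv k H).surjective a
      change (runitIso Y).hom (tensHom f (𝟙 (unitObj k H)) (tmul m (unitEquiv k H a))) =
        f ((runitIso X).hom (tmul m (unitEquiv k H a)))
      rw [tensHom_tmul, runitIso_tmul, ModuleCat.id_apply, runitIso_tmul, map_smul])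
    (pentagon := fun W X Y Z => tens.hom_ext fun t z => by
      induction t using tens.induction₃ with
      | h w x y =>
        change tensHom (𝟙 W) (assocIso X Y Z).hom ((assocIso W (tens X Y) Z).hom
          (tensHom (assocIso W X Y).hom (𝟙 Z) (tmul (tmul (tmul w x) y) z))) =
          (assocIso W X (tens Y Z)).hom ((assocIso (tens W X) Y Z).hom
            (tmul (tmul (tmul w x) y) z))
        rw [tensHom_tmul, assocIso_tmul, assocIso_tmul, tensHom_tmul, assocIso_tmul,
          assocIso_tmul, assocIso_tmul]
        rfl
      | hadd x y hx hy => rw [add_tmul, map_add, map_add, hx, hy])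
    (triangle := fun X Y => tens.hom_ext₃ fun x a y => by
      obtain ⟨a, rfl⟩ := (unitEquiv k H).surjective a
      change tensHom (𝟙 X) (lunitIso Y).hom ((assocIso X (unitObj k H) Y).hom
        (tmul (tmul x (unitEquiv k H a)) y)) =
        tensHom (runitIso X).hom (𝟙 Y) (tmul (tmul x (unitEquiv k H a)) y)
      rw [assocIso_tmul, tensHom_tmul, tensHom_tmul, lunitIso_tmul, runitIso_tmul,
        tgt_smul_tmul a.2]
      rfl)

end Monoidal

section Category

variable (k : Type u) [CommRing k] (H : Type u) [Ring H] [HopfAlgebra k H]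

/-- A symmetric partial `H`-module algebra: a unital associative `k`-algebra with a symmetric
partial action of `H`. -/
structure ParAct where
  /-- The underlying type of the algebra. -/
  carrier : Type u
  [ring : Ring carrier]
  [algebra : Algebra k carrier]
  /-- The action `h · b`. -/
  act : H →ₗ[k] carrier →ₗ[k] carrier
  isSymPartialAction : IsSymPartialAction act

attribute [instance] ParAct.ring ParAct.algebra

variable {k H}

/-- A morphism of partial `H`-module algebras: an algebra map `f` with `f (h · b) = h · f b`. -/
@[ext]
structure ParAct.Hom (B B' : ParAct k H) where
  /-- The underlying algebra map. -/
  toAlgHom : B.carrier →ₐ[k] B'.carrier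
  map_act : ∀ (h : H) (b : B.carrier), toAlgHom (B.act h b) = B'.act h (toAlgHom b)

instance : Category (ParAct k H) where
  Hom := ParAct.Hom
  id B := ⟨AlgHom.id k B.carrier, fun _ _ => rfl⟩
  comp f g := ⟨g.toAlgHom.comp f.toAlgHom, fun h b => by
    simp only [AlgHom.comp_apply, f.map_act, g.map_act]⟩

end Category

end

end PartialHopf

/-!
An algebra object in the category of `H_par`-modules and a symmetric partial `H`-module algebra
carry the same data: an additive group with a product, a unit and operators `[h] b = h · b`. The
point is that the axioms agree, and this rests on the elements `ε_h = [h₁][S h₂]`, which generate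
the base algebra `A`, and `t(ε_{S h}) = ẽ_h = [S h₁][h₂]`.

If `B` is a symmetric partial module algebra, then `ε_h` acts on `B` as left multiplication by
`h · 1` and `ẽ_h` as right multiplication by `S h · 1`. By induction along products, every `a ∈ A`
acts as left multiplication by `a · 1`, and `t(a)` as right multiplication by `a · 1`
(`ParAct.rep_base`, `ParAct.rep_tgt`). Hence the product of `B` is `A`-balanced, the map
`a ↦ a · 1` is a unit for it, and this map is `H_par`-linear (`ParAct.rep_adj_one`).

Conversely, let `M` be an algebra object. The unit constraints say that `a m = η(a) m` and
`t(a) m = m η(a)`, and `η` being `H_par`-linear gives `[h] 1 = η(ε_h)`. So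
`(h₁ · 1) (h₂ g · m) = ε_{h₁} [h₂ g] m` and, with `S h` in place of `h`,
`(S h₂ g · m) (S h₁ · 1) = ẽ_{h₁} [S h₂ g] m`. Both axioms for `h · (g · m)` therefore reduce to
identities valid for every partial representation (`IsPartialRep.conv_eps_mulRight`,
`IsPartialRep.conv_teps_mulRight`); since `S` is surjective, it suffices to know the second at `S h`.

The two constructions keep the carrier and the underlying functions. They are inverse to each other
on the nose because a ring is determined by its addition and multiplication, an `H_par`-module
structure by the operators `[h]`, and a monoid object by its multiplication.
-/

namespace PartialHopf

noncomputable section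

open WithConv MonoidalCategory Coalgebra

/-! ### Two identities for partial representations -/

section PartialRep

variable {k : Type u} [CommRing k] {H : Type u} [Ring H] [HopfAlgebra k H]
  {B : Type*} [Ring B] [Algebra k B] {π : H →ₗ[k] B}

/-- `ε_{h₁} π (h₂ g) = π h π g`. It is the relation `π h₁ π (S h₂) π k = π h₁ π (S h₂ k)`, read in the
convolution algebra of `H ⊗ H` with `k` replaced by `h₃ g`. -/
theorem IsPartialRep.conv_eps_mulRight (hπ : IsPartialRep π) (h g : H) :
    conv (eps π) (π ∘ₗ LinearMap.mulRight k g) h = π h * π g := by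
  have e := hπ.prB pair_inl (inl k H * inr k H)
  rw [← mul_assoc (sig (inl k H)), pair_inl.symm.mul, one_mul, push_mul_push_sig π isGL_inl,
    inl_mul_inr] at e
  have e2 := LinearMap.congr_fun (congrArg ofConv e) (h ⊗ₜ g)
  exact (conv_inl_left (π ∘ₗ LinearMap.mul' k H) (eps π) h g).symm.trans
    (e2.trans (conv_inl_inr π h g π))

/-- `π (S h₁) π h₂ π (S h₃ g) = π (S h) π g`, the analogue of `IsPartialRep.conv_eps_mulRight` for
`ẽ_h`. -/
theorem IsPartialRep.conv_teps_mulRight (hπ : IsPartialRep π) (h g : H) :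
    conv (teps π) (π ∘ₗ LinearMap.mulRight k g ∘ₗ HopfAlgebra.antipode k) h =
      π (HopfAlgebra.antipode k h) * π g := by
  have e := hπ.prB pair_inl.symm (sig (inl k H) * inr k H)
  rw [← mul_assoc (inl k H), pair_inl.mul, one_mul, push_sig_mul_push π isGL_inl] at e
  have e2 := LinearMap.congr_fun (congrArg ofConv e) (h ⊗ₜ g)
  refine Eq.trans ?_ ((conv_inl_left (push π (sig (inl k H) * inr k H)).ofConv
    (teps π) h g).symm.trans
    (e2.trans (conv_inl_inr π h g (π ∘ₗ HopfAlgebra.antipode k))))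
  congr 2
  ext x
  exact congrArg π (conv_inl_inr LinearMap.id x g (HopfAlgebra.antipode k)).symm

end PartialRep

/-! ### From partial module algebras to monoids -/

section ToMon

variable {k : Type u} [CommRing k] {H : Type u} [Ring H] [HopfAlgebra k H]
  [HasInvertibleAntipode k H]

/-- The extension of a symmetric partial action of `H` to an action of `H_par`. -/
def ParAct.rep (B : ParAct k H) : Hpar k H →ₐ[k] Module.End k B.carrier :=
  Hpar.lift (B := Module.End k B.carrier) B.act B.isSymPartialAction.isPartialRep

namespace ParAct

variable (B : ParAct k H)

theorem rep_br (h : H) : B.rep (br k H h) = B.act h := Hpar.lift_br _ _ h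

theorem rep_comp_br : B.rep.toLinearMap ∘ₗ br k H = B.act := LinearMap.ext B.rep_br

theorem rep_eps (h : H) (b : B.carrier) : B.rep (eps (br k H) h) b = B.act h 1 * b := by
  rw [eps, algHom_conv, ← LinearMap.comp_assoc, rep_comp_br]
  exact LinearMap.congr_fun (LinearMap.congr_fun B.isSymPartialAction.eps_eq h) b

theorem rep_teps (h : H) (b : B.carrier) :
    B.rep (teps (br k H) h) b = b * B.act (HopfAlgebra.antipode k h) 1 := by
  rw [teps, algHom_conv, ← LinearMap.comp_assoc, rep_comp_br]
  exact LinearMap.congr_fun (LinearMap.congr_fun B.isSymPartialAction.teps_eq h) b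

/-- The base algebra acts on `B` by left multiplication with `a · 1`. -/
theorem rep_base {a : Hpar k H} (ha : a ∈ baseAlg k H) (b : B.carrier) :
    B.rep a b = B.rep a 1 * b := by
  induction ha using Algebra.adjoin_induction generalizing b with
  | mem a ha => obtain ⟨g, rfl⟩ := ha; rw [rep_eps, rep_eps, mul_one]
  | algebraMap r => simp [AlgHom.commutes]
  | add x y _ _ hx hy =>
    rw [map_add, LinearMap.add_apply, LinearMap.add_apply, hx, hy, add_mul]
  | mul x y _ _ hx hy =>
    rw [map_mul, Module.End.mul_apply, Module.End.mul_apply, hy, hx, hx (B.rep y 1), mul_assoc]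

/-- The image of the base algebra under `t` acts on `B` by right multiplication with `a · 1`. -/
theorem rep_tgt {a : Hpar k H} (ha : a ∈ baseAlg k H) (b : B.carrier) :
    B.rep (tgt a) b = b * B.rep a 1 := by
  induction ha using Algebra.adjoin_induction generalizing b with
  | mem a ha =>
    obtain ⟨g, rfl⟩ := ha
    obtain ⟨y, rfl⟩ := antipode_surjective (k := k) g
    rw [tgt_eps, rep_teps, rep_eps, mul_one]
  | algebraMap r => simp [tgt_algebraMap, AlgHom.commutes]
  | add x y _ _ hx hy =>
    rw [tgt_add, map_add, map_add, LinearMap.add_apply, LinearMap.add_apply, hx, hy, mul_add]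
  | mul x y hx' _ hx hy =>
    rw [tgt_mul, map_mul, map_mul, Module.End.mul_apply, Module.End.mul_apply, hy, hx,
      B.rep_base hx' (B.rep y 1), mul_assoc]

/-- The map `a ↦ a · 1` on the base algebra intertwines the actions of `H`: since
`h · a = (h₁ · a) (h₂ · 1_A)`, applying `h · a` to `1` gives `Σ (h₁ · a) [h₂] · 1 = [h] a · 1`. -/
theorem rep_adj_one (h : H) {a : Hpar k H} (ha : a ∈ baseAlg k H) :
    B.rep (adj k H h a) 1 = B.act h (B.rep a 1) := by
  have e1 : conv ((adj k H).flip a) ((adj k H).flip 1) h = adj k H h a := by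
    rw [← adj_mul' ha, mul_one]; rfl
  -- `(h · 1_A) · 1_B = ε_h · 1_B = [h] · 1_B`, so the second factor may be replaced by `[h]`
  have e2 : ∀ x : H ⊗[k] H,
      B.rep (LinearMap.mul' k _ (TensorProduct.map ((adj k H).flip a) ((adj k H).flip 1) x)) 1 =
      B.rep (LinearMap.mul' k _ (TensorProduct.map ((adj k H).flip a) (br k H) x)) 1 := by
    intro x
    induction x with
    | zero => simp
    | tmul x y =>
      simp only [TensorProduct.map_tmul, LinearMap.mul'_apply, LinearMap.flip_apply, map_mul,
        Module.End.mul_apply, adj_one, rep_eps, rep_br, mul_one]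
    | add x y hx hy => simp only [map_add, LinearMap.add_apply, hx, hy]
  have e3 := e2 (Coalgebra.comul h)
  change B.rep (conv ((adj k H).flip a) ((adj k H).flip 1) h) 1 =
    B.rep (conv ((adj k H).flip a) (br k H) h) 1 at e3
  rw [e1, conv_adj_br ha, map_mul, rep_br] at e3
  exact e3

/-- The `H_par`-module underlying a symmetric partial `H`-module algebra, on the same additive
group. -/
def toModuleCat : ModuleCat.{u} (Hpar k H) :=
  letI : Module (Hpar k H) B.carrier := Module.compHom _ B.rep.toRingHom
  ModuleCat.of (Hpar k H) B.carrier

/-- The identity map of `B`, as a `k`-linear equivalence. On `B.toModuleCat` the scalars of `k` act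
through `H_par`, which agrees with the algebra structure of `B` propositionally only. -/
def equiv : B.carrier ≃ₗ[k] B.toModuleCat where
  toAddEquiv := AddEquiv.refl B.carrier
  map_smul' c b := by
    change c • b = B.rep (algebraMap k (Hpar k H) c) b
    rw [AlgHom.commutes]
    rfl

theorem smul_equiv (x : Hpar k H) (b : B.carrier) : x • B.equiv b = B.equiv (B.rep x b) := rfl

theorem br_smul_equiv (h : H) (b : B.carrier) :
    br k H h • B.equiv b = B.equiv (B.act h b) := by rw [smul_equiv, rep_br]

/-- The multiplication of `B` as an additive map on `B ⊗_A B`. -/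
def mulAdd : tens B.toModuleCat B.toModuleCat →+ B.toModuleCat :=
  tens.lift (AddMonoidHom.mul (R := B.carrier)) fun a ha m n => by
    obtain ⟨x, rfl⟩ := B.equiv.surjective m
    obtain ⟨y, rfl⟩ := B.equiv.surjective n
    rw [smul_equiv, smul_equiv, B.rep_tgt ha, B.rep_base ha y]
    exact mul_assoc x (B.rep a 1) y

theorem mulAdd_tmul (x y : B.carrier) :
    B.mulAdd (tmul (B.equiv x) (B.equiv y)) = B.equiv (x * y) := tens.lift_tmul _ _ _ _

theorem mulAdd_br (h : H) (z : tens B.toModuleCat B.toModuleCat) :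
    B.mulAdd (br k H h • z) = br k H h • B.mulAdd z := by
  refine br_comm_of_tmul B.mulAdd (fun h x y => ?_) h z
  obtain ⟨x, rfl⟩ := B.equiv.surjective x
  obtain ⟨y, rfl⟩ := B.equiv.surjective y
  rw [br_smul_tmul h (ℛ k h), mulAdd_tmul, br_smul_equiv, B.isSymPartialAction.act_mul, conv_repr,
    map_sum, map_sum]
  refine Finset.sum_congr rfl fun i _ => ?_
  rw [br_smul_equiv, br_smul_equiv, mulAdd_tmul]
  rfl

/-- The additive map `a ↦ a · 1` from the unit object. -/
def unitAdd : unitObj k H →+ B.toModuleCat :=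
  AddMonoidHom.mk' (fun a => B.equiv (B.rep ((unitEquiv k H).symm a : Hpar k H) 1)) fun a b => by
    rw [map_add]
    exact congrArg (fun f : Module.End k B.carrier => B.equiv (f 1)) (map_add B.rep _ _)

theorem unitAdd_unitEquiv (a : baseAlg k H) :
    B.unitAdd (unitEquiv k H a) = B.equiv (B.rep (a : Hpar k H) 1) := rfl

theorem unitAdd_br (h : H) (z : unitObj k H) :
    B.unitAdd (br k H h • z) = br k H h • B.unitAdd z := by
  obtain ⟨a, rfl⟩ := (unitEquiv k H).surjective z
  rw [br_smul_unit, unitAdd_unitEquiv, unitAdd_unitEquiv, br_smul_equiv, coe_actA,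
    B.rep_adj_one h a.2]

/-- The multiplication `B ⊗_A B ⟶ B`. -/
def mulHom : tens B.toModuleCat B.toModuleCat ⟶ B.toModuleCat := homOfAdd B.mulAdd B.mulAdd_br

/-- The unit `A ⟶ B`, `a ↦ a · 1`. -/
def unitHom : unitObj k H ⟶ B.toModuleCat := homOfAdd B.unitAdd B.unitAdd_br

theorem mulHom_tmul (x y : B.carrier) :
    B.mulHom (tmul (B.equiv x) (B.equiv y)) = B.equiv (x * y) := B.mulAdd_tmul x y

theorem unitHom_unitEquiv (a : baseAlg k H) :
    B.unitHom (unitEquiv k H a) = B.equiv (B.rep (a : Hpar k H) 1) := rfl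

instance : MonObj B.toModuleCat where
  one := B.unitHom
  mul := B.mulHom
  one_mul := tens.hom_ext fun a x => by
    obtain ⟨a, rfl⟩ := (unitEquiv k H).surjective a
    obtain ⟨x, rfl⟩ := B.equiv.surjective x
    change B.mulHom (tensHom B.unitHom (𝟙 _) (tmul (unitEquiv k H a) (B.equiv x))) =
      (lunitIso B.toModuleCat).hom (tmul (unitEquiv k H a) (B.equiv x))
    rw [tensHom_tmul, lunitIso_tmul, unitHom_unitEquiv, ModuleCat.id_apply, mulHom_tmul,
      ← B.rep_base a.2, smul_equiv]
  mul_one := tens.hom_ext fun x a => by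
    obtain ⟨a, rfl⟩ := (unitEquiv k H).surjective a
    obtain ⟨x, rfl⟩ := B.equiv.surjective x
    change B.mulHom (tensHom (𝟙 _) B.unitHom (tmul (B.equiv x) (unitEquiv k H a))) =
      (runitIso B.toModuleCat).hom (tmul (B.equiv x) (unitEquiv k H a))
    rw [tensHom_tmul, runitIso_tmul, unitHom_unitEquiv, ModuleCat.id_apply, mulHom_tmul,
      ← B.rep_tgt a.2, smul_equiv]
  mul_assoc := tens.hom_ext₃ fun x y z => by
    obtain ⟨x, rfl⟩ := B.equiv.surjective x
    obtain ⟨y, rfl⟩ := B.equiv.surjective y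
    obtain ⟨z, rfl⟩ := B.equiv.surjective z
    change B.mulHom (tensHom B.mulHom (𝟙 _) (tmul (tmul (B.equiv x) (B.equiv y)) (B.equiv z))) =
      B.mulHom (tensHom (𝟙 _) B.mulHom ((assocIso _ _ _).hom
        (tmul (tmul (B.equiv x) (B.equiv y)) (B.equiv z))))
    rw [assocIso_tmul, tensHom_tmul, tensHom_tmul, mulHom_tmul, mulHom_tmul, ModuleCat.id_apply,
      ModuleCat.id_apply, mulHom_tmul, mulHom_tmul, mul_assoc]

end ParAct

/-- A morphism of partial module algebras, as a morphism of `H_par`-modules. -/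
def ParAct.Hom.toModuleHom {B B' : ParAct k H} (f : ParAct.Hom B B') :
    B.toModuleCat ⟶ B'.toModuleCat :=
  homOfAdd (M := B.toModuleCat) (N := B'.toModuleCat) (f.toAlgHom : B.carrier →+ B'.carrier)
    fun h m => by
      obtain ⟨x, rfl⟩ := B.equiv.surjective m
      rw [B.br_smul_equiv]
      exact (f.map_act h x).trans (B'.br_smul_equiv h (f.toAlgHom x)).symm

theorem ParAct.Hom.toModuleHom_equiv {B B' : ParAct k H} (f : ParAct.Hom B B') (b : B.carrier) :
    f.toModuleHom (B.equiv b) = B'.equiv (f.toAlgHom b) := rfl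

theorem ParAct.Hom.map_rep_one {B B' : ParAct k H} (f : ParAct.Hom B B') (x : Hpar k H) :
    f.toAlgHom (B.rep x 1) = B'.rep x 1 := by
  refine (map_smul f.toModuleHom.hom x (B.equiv 1)).trans ?_
  change x • f.toModuleHom (B.equiv 1) = _
  rw [toModuleHom_equiv, map_one]
  rfl

instance {B B' : ParAct k H} (f : ParAct.Hom B B') : IsMonHom f.toModuleHom where
  one_hom := by
    ext a
    obtain ⟨a, rfl⟩ := (unitEquiv k H).surjective a
    exact f.map_rep_one a
  mul_hom := tens.hom_ext fun x y => by
    obtain ⟨x, rfl⟩ := B.equiv.surjective x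
    obtain ⟨y, rfl⟩ := B.equiv.surjective y
    change f.toModuleHom (B.mulHom (tmul (B.equiv x) (B.equiv y))) =
      B'.mulHom (tensHom f.toModuleHom f.toModuleHom (tmul (B.equiv x) (B.equiv y)))
    rw [tensHom_tmul, B.mulHom_tmul, f.toModuleHom_equiv, f.toModuleHom_equiv,
      f.toModuleHom_equiv, B'.mulHom_tmul, map_mul]

variable (k H) in
/-- The functor from symmetric partial `H`-module algebras to algebra objects in the monoidal
category of partial `H`-modules. -/
def toMon : ParAct k H ⥤ Mon (ModuleCat.{u} (Hpar k H)) where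
  obj B := ⟨B.toModuleCat⟩
  map f := ⟨ParAct.Hom.toModuleHom f⟩

end ToMon

/-! ### From monoids to partial module algebras -/

section PartialModule

variable {k : Type u} [CommRing k] {H : Type u} [Ring H] [HopfAlgebra k H]

/-- The action `h · m = [h] m` of `H` on a partial module. -/
def brAct (M : ModuleCat.{u} (Hpar k H)) : H →ₗ[k] M →ₗ[k] M := (lin M).toLinearMap ∘ₗ br k H

theorem brAct_apply {M : ModuleCat.{u} (Hpar k H)} (h : H) (m : M) :
    brAct M h m = br k H h • m := rfl

end PartialModule

section OfMon

variable {k : Type u} [CommRing k] {H : Type u} [Ring H] [HopfAlgebra k H]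
  [HasInvertibleAntipode k H] (M : ModuleCat.{u} (Hpar k H)) [MonObj M]

/-- The multiplication of an algebra object, as a map `M ⊗_A M ⟶ M`. -/
def monMul : tens M M ⟶ M := MonObj.mul (X := M)

/-- The unit of an algebra object, as a map `A ⟶ M`. -/
def monOne : unitObj k H ⟶ M := MonObj.one (X := M)

variable {M}

theorem monMul_one_tmul (a : baseAlg k H) (x : M) :
    monMul M (tmul (monOne M (unitEquiv k H a)) x) = (a : Hpar k H) • x := by
  have h := congrArg (fun f : tens (unitObj k H) M ⟶ M => f (tmul (unitEquiv k H a) x))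
    (MonObj.one_mul M)
  change monMul M (tensHom (monOne M) (𝟙 M) (tmul (unitEquiv k H a) x)) =
    (lunitIso M).hom (tmul (unitEquiv k H a) x) at h
  rwa [tensHom_tmul, lunitIso_tmul] at h

theorem monMul_tmul_one (a : baseAlg k H) (x : M) :
    monMul M (tmul x (monOne M (unitEquiv k H a))) = tgt (a : Hpar k H) • x := by
  have h := congrArg (fun f : tens M (unitObj k H) ⟶ M => f (tmul x (unitEquiv k H a)))
    (MonObj.mul_one M)
  change monMul M (tensHom (𝟙 M) (monOne M) (tmul x (unitEquiv k H a))) =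
    (runitIso M).hom (tmul x (unitEquiv k H a)) at h
  rwa [tensHom_tmul, runitIso_tmul] at h

theorem monMul_assoc (x y z : M) :
    monMul M (tmul (monMul M (tmul x y)) z) = monMul M (tmul x (monMul M (tmul y z))) := by
  have h := congrArg (fun f : tens (tens M M) M ⟶ M => f (tmul (tmul x y) z))
    (MonObj.mul_assoc M)
  change monMul M (tensHom (monMul M) (𝟙 M) (tmul (tmul x y) z)) =
    monMul M (tensHom (𝟙 M) (monMul M) ((assocIso M M M).hom (tmul (tmul x y) z))) at h
  rwa [assocIso_tmul, tensHom_tmul, tensHom_tmul] at h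

variable (M) in
/-- The ring structure on the underlying group of an algebra object `M`, with `x y = μ (x ⊗ y)` and
`1 = η 1_A`. -/
abbrev monRing : Ring M :=
  { (inferInstance : AddCommGroup M) with
    mul := fun x y => monMul M (tmul x y)
    one := monOne M (unitEquiv k H 1)
    mul_assoc := monMul_assoc
    one_mul := fun x => (monMul_one_tmul 1 x).trans (one_smul _ x)
    mul_one := fun x => (monMul_tmul_one 1 x).trans
      ((congrArg (· • x) tgt_one).trans (one_smul _ x))
    left_distrib := fun x y z =>
      (congrArg (monMul M) (tmul_add x y z)).trans (map_add _ _ _)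
    right_distrib := fun x y z =>
      (congrArg (monMul M) (add_tmul x y z)).trans (map_add _ _ _)
    zero_mul := fun x =>
      (congrArg (monMul M) (LinearMap.map_zero₂ (tmulL M M) x)).trans (map_zero (monMul M).hom)
    mul_zero := fun x =>
      (congrArg (monMul M) (map_zero (tmulL M M x))).trans (map_zero (monMul M).hom) }

theorem monMul_smul_tmul (c : k) (x y : M) :
    monMul M (tmul (c • x) y) = c • monMul M (tmul x y) := by
  rw [← tmulL_apply, LinearMap.map_smul₂]
  exact map_smul (monMul M).hom (algebraMap k (Hpar k H) c) (tmul x y)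

theorem monMul_tmul_smul (c : k) (x y : M) :
    monMul M (tmul x (c • y)) = c • monMul M (tmul x y) := by
  rw [← tmulL_apply, map_smul]
  exact map_smul (monMul M).hom (algebraMap k (Hpar k H) c) (tmul x y)

variable (M) in
/-- The `k`-algebra structure on the underlying group of an algebra object. -/
abbrev monAlgebra : letI := monRing M; Algebra k M :=
  letI := monRing M
  Algebra.ofModule monMul_smul_tmul (fun c x y => monMul_tmul_smul c x y)

theorem br_smul_monMul (h : H) (x y : M) : br k H h • monMul M (tmul x y) =
    ∑ i ∈ (ℛ k h).index,
      monMul M (tmul (br k H ((ℛ k h).left i) • x) (br k H ((ℛ k h).right i) • y)) := by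
  rw [← map_smul, br_smul_tmul h (ℛ k h), map_sum]

/-- `[h] 1_M = ε_h 1_M`, since the unit `A ⟶ M` is a map of partial modules. -/
theorem br_smul_monOne (h : H) : br k H h • monOne M (unitEquiv k H 1) =
    monOne M (unitEquiv k H ⟨eps (br k H) h, eps_mem h⟩) := by
  rw [← map_smul, br_smul_unit]
  congr 2
  exact Subtype.ext (adj_one h)

theorem monMul_br_one_tmul (h : H) (x : M) :
    monMul M (tmul (br k H h • monOne M (unitEquiv k H 1)) x) = eps (br k H) h • x := by
  rw [br_smul_monOne, monMul_one_tmul]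

theorem monMul_tmul_br_antipode_one (h : H) (x : M) :
    monMul M (tmul x (br k H (HopfAlgebra.antipode k h) • monOne M (unitEquiv k H 1))) =
      teps (br k H) h • x := by
  rw [br_smul_monOne, monMul_tmul_one, tgt_eps]

variable (M) in
/-- The operators `[h]` on an algebra object form a symmetric partial action. -/
theorem isSymPartialAction_brAct :
    letI := monRing M
    letI := monAlgebra M
    IsSymPartialAction (B := M) (brAct M) := by
  let := monRing M
  let := monAlgebra M
  refine ⟨fun a => ?_, fun h a b => ?_, fun h g a => ?_, fun h g a => ?_⟩
  · rw [brAct_apply, isPartialRep_br.pr1, one_smul]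
  · rw [conv_repr]
    exact br_smul_monMul h a b
  · rw [conv_repr, brAct_apply, brAct_apply, ← mul_smul, ← isPartialRep_br.conv_eps_mulRight,
      conv_repr, Finset.sum_smul]
    refine Finset.sum_congr rfl fun i _ => ?_
    rw [mul_smul]
    exact (monMul_br_one_tmul _ _).symm
  · obtain ⟨h, rfl⟩ := antipode_surjective (k := k) h
    rw [conv_antipode, brAct_apply, brAct_apply, ← mul_smul,
      ← isPartialRep_br.conv_teps_mulRight, conv_repr, Finset.sum_smul, ← (ℛ k h).eq]
    simp only [map_sum, TensorProduct.map_tmul, TensorProduct.comm_tmul, LinearMap.mul'_apply]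
    refine Finset.sum_congr rfl fun i _ => ?_
    rw [mul_smul]
    exact (monMul_tmul_br_antipode_one _ _).symm

variable (M) in
/-- The symmetric partial `H`-module algebra given by an algebra object. -/
def monParAct : ParAct k H :=
  letI := monRing M
  letI := monAlgebra M
  { carrier := M
    act := brAct M
    isSymPartialAction := isSymPartialAction_brAct M }

/-- A morphism of algebra objects, as a morphism of partial module algebras. -/
def monParActHom {N : ModuleCat.{u} (Hpar k H)} [MonObj N] (f : M ⟶ N) [IsMonHom f] :
    ParAct.Hom (monParAct M) (monParAct N) :=
  letI := monRing M
  letI := monAlgebra M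
  letI := monRing N
  letI := monAlgebra N
  { toAlgHom := AlgHom.ofLinearMap (A := M) (B := N)
      { toFun := f
        map_add' := map_add f.hom
        map_smul' := fun c x => map_smul f.hom (algebraMap k (Hpar k H) c) x }
      (congrArg (fun g : unitObj k H ⟶ N => g (unitEquiv k H 1)) (IsMonHom.one_hom f))
      fun x y => (congrArg (fun g : tens M M ⟶ N => g (tmul x y)) (IsMonHom.mul_hom f)).trans
        (congrArg (monMul N) (tensHom_tmul f f x y))
    map_act := fun h x => f.hom.map_smul (br k H h) x }

variable (k H) in
/-- The functor from algebra objects in the monoidal category of partial `H`-modules to symmetric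
partial `H`-module algebras. -/
def ofMon : Mon (ModuleCat.{u} (Hpar k H)) ⥤ ParAct k H where
  obj M := monParAct M.X
  map f := monParActHom f.hom

end OfMon

/-! ### The two functors are mutually inverse -/

section Inverse

variable {k : Type u} [CommRing k] {H : Type u} [Ring H] [HopfAlgebra k H]

/-- A partial module algebra is determined by the addition, multiplication, scalar multiplication
and partial action on its carrier. -/
theorem ParAct.mk_congr {X : Type u} {r r' : Ring X} {a : @Algebra k X _ r.toSemiring}
    {a' : @Algebra k X _ r'.toSemiring}
    {α : letI := r; letI := a; H →ₗ[k] X →ₗ[k] X} {α' : letI := r'; letI := a'; H →ₗ[k] X →ₗ[k] X}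
    (hα : letI := r; letI := a; IsSymPartialAction α)
    (hα' : letI := r'; letI := a'; IsSymPartialAction α')
    (hadd : ∀ x y, r.add x y = r'.add x y) (hmul : ∀ x y, r.mul x y = r'.mul x y)
    (hsmul : ∀ c x, a.smul c x = a'.smul c x)
    (hact : ∀ h x, (letI := r; letI := a; α h x) = (letI := r'; letI := a'; α' h x)) :
    @ParAct.mk k _ H _ _ X r a α hα = @ParAct.mk k _ H _ _ X r' a' α' hα' := by
  obtain rfl : r = r' := Ring.ext (funext fun x => funext (hadd x))
    (funext fun x => funext (hmul x))
  obtain rfl : a = a' := Algebra.algebra_ext _ _ fun c => by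
    rw [@Algebra.algebraMap_eq_smul_one _ _ _ _ a, @Algebra.algebraMap_eq_smul_one _ _ _ _ a']
    exact hsmul c 1
  obtain rfl : α = α' := LinearMap.ext fun h => LinearMap.ext (hact h)
  rfl

/-- Morphisms of partial module algebras between equal objects agree if their underlying functions
do. -/
theorem ParAct.hom_heq {B B' C C' : ParAct k H} (hB : B = C) (hB' : B' = C') (f : B ⟶ B')
    (g : C ⟶ C') (h : HEq (fun b => f.toAlgHom b) (fun c => g.toAlgHom c)) : HEq f g := by
  subst hB hB'
  exact heq_of_eq (ParAct.Hom.ext (AlgHom.ext fun b => congrFun (eq_of_heq h) b))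

variable [HasInvertibleAntipode k H]

/-- Morphisms of algebra objects between equal objects agree if their underlying functions do. -/
theorem monHom_heq {M M' N N' : Mon (ModuleCat.{u} (Hpar k H))} (hM : M = N) (hM' : M' = N')
    (f : M ⟶ M') (g : N ⟶ N') (h : HEq (fun m => f.hom m) (fun n => g.hom n)) : HEq f g := by
  subst hM hM'
  refine heq_of_eq (Mon.Hom.ext ?_)
  ext m
  exact congrFun (eq_of_heq h) m

/-- An algebra object is determined by the underlying additive group, the action of `H_par` and the
products of its elements. -/
theorem mon_mk_congr {X : Type u} [AddCommGroup X] {m m' : Module (Hpar k H) X}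
    {s : MonObj (@ModuleCat.of (Hpar k H) _ X _ m)}
    {s' : MonObj (@ModuleCat.of (Hpar k H) _ X _ m')}
    (hm : ∀ (h : H) (x : X), m.smul (br k H h) x = m'.smul (br k H h) x)
    (hs : ∀ x y : X, @monMul k _ H _ _ _ (@ModuleCat.of (Hpar k H) _ X _ m) s (tmul x y) =
      @monMul k _ H _ _ _ (@ModuleCat.of (Hpar k H) _ X _ m') s' (tmul x y)) :
    (⟨@ModuleCat.of (Hpar k H) _ X _ m⟩ : Mon (ModuleCat.{u} (Hpar k H))) =
      ⟨@ModuleCat.of (Hpar k H) _ X _ m'⟩ := by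
  obtain rfl : m = m' := Module.ext (by
    ext x y
    exact smul_of_br (M := @ModuleCat.of (Hpar k H) _ X _ m)
      (N := @ModuleCat.of (Hpar k H) _ X _ m') (AddMonoidHom.id X) hm x y)
  obtain rfl : s = s' := MonObj.ext _ _ (tens.hom_ext hs)
  rfl

theorem ofMon_obj_toMon_obj (B : ParAct k H) : (ofMon k H).obj ((toMon k H).obj B) = B := by
  obtain ⟨X, α, hα⟩ := B
  refine ParAct.mk_congr _ _ (fun _ _ => rfl) (fun x y => ?_) (fun c x => ?_) (fun h x => ?_)
  · exact ParAct.mulHom_tmul (⟨X, α, hα⟩ : ParAct k H) x y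
  · exact ((ParAct.equiv (⟨X, α, hα⟩ : ParAct k H)).map_smul c x).symm
  · exact ParAct.br_smul_equiv (⟨X, α, hα⟩ : ParAct k H) h x

theorem toMon_obj_ofMon_obj (M : Mon (ModuleCat.{u} (Hpar k H))) :
    (toMon k H).obj ((ofMon k H).obj M) = M := by
  obtain ⟨⟨X⟩⟩ := M
  refine mon_mk_congr (fun h x => ?_) (fun x y => ?_)
  · exact ParAct.br_smul_equiv (monParAct _) h x
  · exact ParAct.mulHom_tmul (monParAct _) x y

-- The carriers agree definitionally, so the underlying functions can be compared by `HEq.rfl`.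
theorem toMon_comp_ofMon : toMon k H ⋙ ofMon k H = 𝟭 (ParAct k H) :=
  Functor.hext ofMon_obj_toMon_obj fun B B' _ =>
    ParAct.hom_heq (ofMon_obj_toMon_obj B) (ofMon_obj_toMon_obj B') _ _ HEq.rfl

theorem ofMon_comp_toMon : ofMon k H ⋙ toMon k H = 𝟭 (Mon (ModuleCat.{u} (Hpar k H))) :=
  Functor.hext toMon_obj_ofMon_obj fun M M' _ =>
    monHom_heq (toMon_obj_ofMon_obj M) (toMon_obj_ofMon_obj M') _ _ HEq.rfl

end Inverse

end

end PartialHopf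

theorem mainTheorem4 (k H : Type u) [CommRing k] [Ring H] [HopfAlgebra k H]
    [PartialHopf.HasInvertibleAntipode k H] :
    ∃ (F : PartialHopf.ParAct k H ⥤ Mon (ModuleCat.{u} (PartialHopf.Hpar k H)))
      (G : Mon (ModuleCat.{u} (PartialHopf.Hpar k H)) ⥤ PartialHopf.ParAct k H)
      (φ : ∀ B : PartialHopf.ParAct k H, B.carrier ≃ₗ[k] (F.obj B).X),
      -- `F` and `G` are mutually inverse, so that `F` is an isomorphism of categories
      F ⋙ G = 𝟭 (PartialHopf.ParAct k H) ∧
      G ⋙ F = 𝟭 (Mon (ModuleCat.{u} (PartialHopf.Hpar k H))) ∧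
      -- `F B` is `B` itself: `[h] b = h · b`, `μ (x ⊗ y) = x y`, `η 1_A = 1_B`
      (∀ (B : PartialHopf.ParAct k H) (h : H) (b : B.carrier),
        φ B (B.act h b) = PartialHopf.br k H h • φ B b) ∧
      (∀ (B : PartialHopf.ParAct k H) (x y : B.carrier),
        φ B (x * y) =
          (MonObj.mul (X := (F.obj B).X)).hom (PartialHopf.tmul (φ B x) (φ B y))) ∧
      (∀ B : PartialHopf.ParAct k H,
        φ B 1 = (MonObj.one (X := (F.obj B).X)).hom (PartialHopf.unitEquiv k H 1)) ∧
      -- and `F f` is `f` itself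
      (∀ (B B' : PartialHopf.ParAct k H) (f : B ⟶ B') (b : B.carrier),
        φ B' (f.toAlgHom b) = (F.map f).hom.hom (φ B b)) := by
  exact ⟨PartialHopf.toMon k H, PartialHopf.ofMon k H, PartialHopf.ParAct.equiv,
    PartialHopf.toMon_comp_ofMon, PartialHopf.ofMon_comp_toMon,
    fun B h b => (B.br_smul_equiv h b).symm, fun B x y => (B.mulHom_tmul x y).symm,
    fun B => (congrArg (fun f : Module.End k B.carrier => B.equiv (f 1)) (map_one B.rep)).symm,
    fun _ _ f b => (PartialHopf.ParAct.Hom.toModuleHom_equiv f b).symm⟩
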